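/- Let $B_0>0$, let $\mathbf A=(A_1,A_2)\in C^2(\mathbb R^2,\mathbb R^2)$ be a vector potential generating the constant magnetic field $B=\partial_1A_2-\partial_2A_1\equiv B_0$, and let $V\in C^2(\mathbb R^2,\mathbb R)$ satisfy $V(x)\ge -c|x|^2+d$ for all $x\in\mathbb R^2$, with some constants $c>0$, $d\in\mathbb R$. Let $H$ be the Pauli operator with electric potential $V$, i.e. the (self-adjoint) closure in $L^2(\mathbb R^2,\mathbb C^2)$ of $$H\varphi=\big[(-i\nabla-\mathbf A)^2-\sigma_3B+V\big]\varphi,\qquad \varphi\in C_0^\infty(\mathbb R^2,\mathbb C^2),\qquad \sigma_3=\begin{pmatrix}1&0\\0&-1\end{pmatrix}.$$ Say that $f:\mathbb R^2\to\mathbb R$ varies with rate $\nu\in[0,1]$ on $X\subset\mathbb R^2$ if there is $C>0$ such that $|f(x+y)|\le C|f(x)|$ for all $x\in X$ and all $y\in\mathbb R^2$ with $|y|\le\frac12|x|^\nu$. Let $\|\mathrm{Hess}(V)\|_2(x)$ denote the spectral norm of the Hessian matrix of $V$ at $x$. Assume that there are a continuous path $\gamma:(0,\infty)\to\mathbb R^2$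 with $|\gamma(t)|\to\infty$ as $t\to\infty$ and constants $\epsilon>0$, $\nu\in[0,1]$ such that $\|\mathrm{Hess}(V)\|_2$ varies with rate $\nu$ on $\mathrm{Im}(\gamma)$, and such that, as $t\to\infty$, $$V(\gamma(t))\to-\infty,\qquad \|\mathrm{Hess}(V)\|_2(\gamma(t))\,|V(\gamma(t))|^{1+\epsilon}\to0,\qquad \frac{1}{|\gamma(t)|^{2\nu}}\,|V(\gamma(t))|^{1+\epsilon}\to0,$$ and $$\limsup_{t\to\infty}\frac{|\nabla V(\gamma(t))|^2}{|V(\gamma(t))|}<(2B_0)^2 .$$ Then the essential spectrum of $H$ (the spectrum of $H$ without the isolated eigenvalues of finite multiplicity) is the whole real line: $\sigma_{\rm ess}(H)=\mathbb R$. -/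

import Mathlib

open MeasureTheory Filter Topology
open scoped ContDiff Gradient

noncomputable section

namespace Pauli

/-- The plane with its Euclidean norm. -/
abbrev Plane : Type := EuclideanSpace ℝ (Fin 2)

/-- Two-component spinors with their Hermitian norm. -/
abbrev Spinor : Type := EuclideanSpace ℂ (Fin 2)

/-- The Hilbert space of square integrable spinor fields on the plane. -/
abbrev Hilb : Type := Lp Spinor 2 (volume : Measure Plane)

/-! ### Spectra of unbounded operators -/

section Spectrum

variable {E : Type*} [NormedAddCommGroup E] [InnerProductSpace ℂ E]

/-- `z` belongs to the resolvent set of `T` if `T - z` is a bijection from the domain of `T` onto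
the whole space whose inverse `R` is bounded. -/
def resolventSet (T : E →ₗ.[ℂ] E) : Set ℂ :=
  {z | ∃ R : E →L[ℂ] E,
    (∀ x : E, ∃ h : R x ∈ T.domain, T ⟨R x, h⟩ - z • R x = x) ∧
    (∀ u : T.domain, R (T u - z • (u : E)) = u)}

/-- The spectrum of `T`, the complement of the resolvent set. -/
def spectrum (T : E →ₗ.[ℂ] E) : Set ℂ := (resolventSet T)ᶜ

/-- The space of solutions `u` in the domain of `T` of `T u = z u`. -/
def eigenspace (T : E →ₗ.[ℂ] E) (z : ℂ) : Submodule ℂ T.domain :=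
  LinearMap.ker (T.toFun - z • T.domain.subtype)

/-- The discrete spectrum of `T`: the isolated points of the spectrum that are eigenvalues of
finite multiplicity. -/
def discreteSpectrum (T : E →ₗ.[ℂ] E) : Set ℂ :=
  {z ∈ spectrum T | (∃ r > 0, Metric.ball z r ∩ spectrum T = {z}) ∧
    eigenspace T z ≠ ⊥ ∧ FiniteDimensional ℂ (eigenspace T z)}

/-- The essential spectrum of a self-adjoint operator `T`. -/
def essentialSpectrum (T : E →ₗ.[ℂ] E) : Set ℂ := spectrum T \ discreteSpectrum T

end Spectrum

/-! ### The Pauli operator -/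

/-- The `j`-th standard unit vector of the plane. -/
def e (j : Fin 2) : Plane := EuclideanSpace.single j 1

/-- The magnetic field `∂₁A₂ - ∂₂A₁` generated by the vector potential `A`. -/
def curl (A : Plane → Plane) (x : Plane) : ℝ :=
  fderiv ℝ A x (e 0) 1 - fderiv ℝ A x (e 1) 0

/-- The `j`-th component `-i∂ⱼ - Aⱼ` of `-i∇ - A`, acting on spinor fields. -/
def momentum (A : Plane → Plane) (j : Fin 2) (φ : Plane → Spinor) : Plane → Spinor :=
  fun x => -(Complex.I • fderiv ℝ φ x (e j)) - (A x j : ℂ) • φ x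

/-- The third Pauli matrix. -/
def σ₃ : Matrix (Fin 2) (Fin 2) ℂ := !![1, 0; 0, -1]

/-- The differential expression `((-i∇ - A)² - σ₃ B + V) φ` with `B = curl A`. -/
def pauliExpr (A : Plane → Plane) (V : Plane → ℝ) (φ : Plane → Spinor) : Plane → Spinor :=
  fun x => ∑ j, momentum A j (momentum A j φ) x
    - (curl A x : ℂ) • Matrix.toEuclideanLin σ₃ (φ x) + (V x : ℂ) • φ x

/-- Smooth compactly supported spinor fields. -/
def testFunctions : Submodule ℂ (Plane → Spinor) where
  carrier := {φ | ContDiff ℝ ∞ φ ∧ HasCompactSupport φ}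
  add_mem' := fun h₁ h₂ => ⟨h₁.1.add h₂.1, h₁.2.add h₂.2⟩
  zero_mem' := ⟨contDiff_const, HasCompactSupport.zero⟩
  smul_mem' := fun c _ h => ⟨h.1.const_smul c, h.2.smul_left (f := fun _ => c)⟩

theorem memLp_test (φ : testFunctions) : MemLp (φ : Plane → Spinor) 2 volume :=
  φ.2.1.continuous.memLp_of_hasCompactSupport φ.2.2

/-- Test functions as elements of the Hilbert space. -/
def testToHilb : testFunctions →ₗ[ℂ] Hilb where
  toFun φ := (memLp_test φ).toLp φ
  map_add' _ _ := rfl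
  map_smul' _ _ := rfl

theorem testToHilb_injective : Function.Injective testToHilb := by
  intro φ ψ h
  have h' := (MemLp.toLp_eq_toLp_iff (memLp_test φ) (memLp_test ψ)).1 h
  exact Subtype.ext
    ((Continuous.ae_eq_iff_eq volume φ.2.1.continuous ψ.2.1.continuous).1 h')

theorem contDiff_component {A : Plane → Plane} (hA : ContDiff ℝ 1 A) (j : Fin 2) :
    ContDiff ℝ 1 (fun x => (A x j : ℂ)) :=
  Complex.ofRealCLM.contDiff.comp ((EuclideanSpace.proj (𝕜 := ℝ) j).contDiff.comp hA)

theorem contDiff_momentum {A : Plane → Plane} (hA : ContDiff ℝ 1 A) (j : Fin 2)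
    (φ : testFunctions) : ContDiff ℝ 1 (momentum A j φ) := by
  have h1 : ContDiff ℝ 1 (fun x => fderiv ℝ (φ : Plane → Spinor) x (e j)) :=
    (φ.2.1.fderiv_right (m := 1) (by norm_cast)).clm_apply contDiff_const
  have h2 : ContDiff ℝ 1 (φ : Plane → Spinor) := φ.2.1.of_le (by norm_cast)
  exact (h1.const_smul Complex.I).neg.sub ((contDiff_component hA j).smul h2)

theorem continuous_momentum {A : Plane → Plane} (hA : ContDiff ℝ 1 A) (j : Fin 2)
    {φ : Plane → Spinor} (hφ : ContDiff ℝ 1 φ) : Continuous (momentum A j φ) := by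
  have h1 : Continuous (fun x => fderiv ℝ φ x (e j)) :=
    (hφ.continuous_fderiv one_ne_zero).clm_apply continuous_const
  exact (h1.const_smul Complex.I).neg.sub
    ((contDiff_component hA j).continuous.smul hφ.continuous)

theorem hasCompactSupport_momentum (A : Plane → Plane) (j : Fin 2)
    {φ : Plane → Spinor} (hφ : HasCompactSupport φ) : HasCompactSupport (momentum A j φ) := by
  refine HasCompactSupport.intro' (K := tsupport φ) hφ (isClosed_tsupport φ) fun x hx => ?_
  have h2 : fderiv ℝ φ x = 0 := image_eq_zero_of_notMem_tsupport
    fun h => hx (tsupport_fderiv_subset ℝ h)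
  simp [momentum, h2, image_eq_zero_of_notMem_tsupport hx]

theorem momentum_add (A : Plane → Plane) (j : Fin 2) {φ ψ : Plane → Spinor}
    (hφ : ContDiff ℝ 1 φ) (hψ : ContDiff ℝ 1 ψ) :
    momentum A j (φ + ψ) = momentum A j φ + momentum A j ψ := by
  funext x
  have h := fderiv_add (hφ.differentiable one_ne_zero x) (hψ.differentiable one_ne_zero x)
  simp only [momentum, h, Pi.add_apply, _root_.add_apply, smul_add]
  abel

theorem momentum_smul (A : Plane → Plane) (j : Fin 2) (c : ℂ) {φ : Plane → Spinor}
    (hφ : ContDiff ℝ 1 φ) : momentum A j (c • φ) = c • momentum A j φ := by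
  funext x
  have h := fderiv_const_smul (hφ.differentiable one_ne_zero x) c
  simp only [momentum, h, Pi.smul_apply, _root_.smul_apply, smul_sub, smul_neg,
    smul_comm c]

theorem continuous_curl {A : Plane → Plane} (hA : ContDiff ℝ 1 A) : Continuous (curl A) := by
  have h (i j : Fin 2) : Continuous (fun x => fderiv ℝ A x (e i) j) :=
    (EuclideanSpace.proj (𝕜 := ℝ) j).continuous.comp
      ((hA.continuous_fderiv one_ne_zero).clm_apply continuous_const)
  exact (h 0 1).sub (h 1 0)

theorem memLp_pauliExpr {A : Plane → Plane} {V : Plane → ℝ} (hA : ContDiff ℝ 1 A)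
    (hV : Continuous V) (φ : testFunctions) : MemLp (pauliExpr A V φ) 2 volume := by
  refine Continuous.memLp_of_hasCompactSupport ?_ ?_
  · refine Continuous.add (Continuous.sub ?_ ?_) ?_
    · exact continuous_finsetSum _ fun j _ =>
        continuous_momentum hA j (contDiff_momentum hA j φ)
    · exact (Complex.continuous_ofReal.comp (continuous_curl hA)).smul
        ((Matrix.toEuclideanLin σ₃).continuous_of_finiteDimensional.comp φ.2.1.continuous)
    · exact (Complex.continuous_ofReal.comp hV).smul φ.2.1.continuous
  · have h (j : Fin 2) := hasCompactSupport_momentum A j (hasCompactSupport_momentum A j φ.2.2)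
    have hs : HasCompactSupport (fun x => ∑ j, momentum A j (momentum A j φ) x) := by
      simp only [Fin.sum_univ_two]
      exact (h 0).add (h 1)
    have h3 : HasCompactSupport
        (fun x => (curl A x : ℂ) • Matrix.toEuclideanLin σ₃ ((φ : Plane → Spinor) x)) :=
      HasCompactSupport.smul_left (f := fun x => (curl A x : ℂ))
        (φ.2.2.comp_left (g := Matrix.toEuclideanLin σ₃) (map_zero _))
    exact (hs.sub h3).add (HasCompactSupport.smul_left (f := fun x => (V x : ℂ)) φ.2.2)

/-- The differential expression as a linear map from test functions to the Hilbert space. -/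
def pauliOnTest (A : Plane → Plane) (V : Plane → ℝ) (hA : ContDiff ℝ 1 A)
    (hV : Continuous V) : testFunctions →ₗ[ℂ] Hilb where
  toFun φ := (memLp_pauliExpr hA hV φ).toLp (pauliExpr A V φ)
  map_add' φ ψ := by
    have h1 (χ : testFunctions) : ContDiff ℝ 1 (χ : Plane → Spinor) :=
      χ.2.1.of_le (by norm_cast)
    rw [← MemLp.toLp_add]
    congr 1
    funext x
    have h2 (j : Fin 2) : momentum A j (momentum A j ((φ : Plane → Spinor) + ψ)) =
        momentum A j (momentum A j φ) + momentum A j (momentum A j ψ) := by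
      rw [momentum_add A j (h1 φ) (h1 ψ),
        momentum_add A j (contDiff_momentum hA j φ) (contDiff_momentum hA j ψ)]
    simp only [pauliExpr, h2, Pi.add_apply, Submodule.coe_add, map_add, smul_add,
      Finset.sum_add_distrib]
    abel
  map_smul' c φ := by
    have h1 : ContDiff ℝ 1 (φ : Plane → Spinor) := φ.2.1.of_le (by norm_cast)
    rw [RingHom.id_apply, ← MemLp.toLp_const_smul]
    congr 1
    funext x
    have h2 (j : Fin 2) : momentum A j (momentum A j (c • (φ : Plane → Spinor))) =
        c • momentum A j (momentum A j φ) := by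
      rw [momentum_smul A j c h1,
        momentum_smul A j c (contDiff_momentum hA j φ)]
    simp only [pauliExpr, h2, Pi.smul_apply, Submodule.coe_smul, map_smul, smul_add, smul_sub,
      Finset.smul_sum, smul_comm c]

/-- The Pauli operator with electric potential `V` on the core of test functions. -/
def pauliMinimal (A : Plane → Plane) (V : Plane → ℝ) (hA : ContDiff ℝ 1 A)
    (hV : Continuous V) : Hilb →ₗ.[ℂ] Hilb where
  domain := LinearMap.range testToHilb
  toFun := pauliOnTest A V hA hV ∘ₗ
    (LinearEquiv.ofInjective testToHilb testToHilb_injective).symm.toLinearMap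

/-- The Pauli operator `H` with vector potential `A` and electric potential `V`: the closure of
`(-i∇ - A)² - σ₃ B + V` on test functions. -/
def pauliOperator (A : Plane → Plane) (V : Plane → ℝ) (hA : ContDiff ℝ 1 A)
    (hV : Continuous V) : Hilb →ₗ.[ℂ] Hilb :=
  (pauliMinimal A V hA hV).closure

/-! ### The hypotheses on the potential -/

/-- `f` varies with rate `ν` on the set `X`. -/
def VariesWithRate (f : Plane → ℝ) (ν : ℝ) (X : Set Plane) : Prop :=
  ∃ C > 0, ∀ x ∈ X, ∀ y : Plane, ‖y‖ ≤ 1 / 2 * ‖x‖ ^ ν → |f (x + y)| ≤ C * |f x|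

/-- The spectral norm of the Hessian of `V` at `x`, that is, the operator norm (with respect to
the Euclidean norm) of the derivative at `x` of the gradient field of `V`. -/
def hessNorm (V : Plane → ℝ) (x : Plane) : ℝ := ‖fderiv ℝ (∇ V) x‖

end Pauli

end

open MeasureTheory Filter Topology
open scoped ContDiff Gradient

noncomputable section

namespace Pauli

/-! ### Symmetric operators and their spectra -/

section Abstract

variable {E : Type*} [NormedAddCommGroup E] [InnerProductSpace ℂ E]

open scoped InnerProductSpace

/-! Two facts suffice: nonreal numbers belong to the resolvent set of the closed operator, and every
real number belongs to its spectrum. A spectrum equal to the real line has no isolated points, so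
all of it is essential (`essentialSpectrum_eq_range_ofReal`).

Nonreal numbers. The operator on test functions is symmetric, so by `mem_resolventSet_closure` it is
enough that a square integrable `w` orthogonal to the range of `H - z` vanishes. In the symmetric
gauge the components of `w` become weak solutions of scalar magnetic Schrödinger equations with
nonreal spectral parameter. The first order term of this gauge is an angular derivative and
therefore commutes with mollification by a radial kernel; the only error is a commutator with the
zeroth order coefficient, which tends to zero locally in the mean (`mollify_equation`,
`meanTendsto_mollify_commutator`). For a solution `ψ`, the mass inside a cut-off times the imaginary
part of `z` is a flux of the probability current through the region where the cut-off varies. The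
quadratic lower bound on the potential controls the kinetic energy weighted by `R⁻²`, and the flux
is at most `s C ‖ψ‖²` plus `C / s` times the mass outside radius `R`. Letting `R → ∞` and then `s →
0` gives `ψ = 0` (`integral_eq_zero_of_weak`).

Real numbers. Near `x₀ = γ t` the potential is nearly `V x₀ + E s`, where `E = ‖∇ V x₀‖` and `s` is
the coordinate along the gradient. In the Landau gauge, the spin-up part of the operator with this
affine potential, on functions of `s` alone, is a shifted harmonic oscillator with levels `2 n B + V
x₀ - E² / (4 B²)`. Such a level equals `r` when `(r - V x₀ + E² / (4 B²)) / (2 B)` is the natural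
number `n`; this quantity is continuous along `γ` and tends to infinity, so that happens arbitrarily
far out. The trial field is the oscillator eigenfunction cut off at scale `L` with `L² = |V x₀| ^ (1
+ ε)` (`exists_wavePacket`). By the gradient hypothesis its mean square momentum and width are `O(|V
x₀|)`, so cutting off produces a squared relative error that vanishes like `|V x₀| / L²`. The Taylor
error is `O(‖Hess V‖ L²)`, which tends to zero; the growth condition places the packet where the
Hessian is comparable to its value at `x₀`. Weyl's criterion concludes
(`ofReal_mem_spectrum_pauliOperator`). -/

theorem isClosable_of_symmetric [CompleteSpace E] {T : E →ₗ.[ℂ] E}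
    (hd : Dense (T.domain : Set E)) (hs : T.IsFormalAdjoint T) : T.IsClosable :=
  (T.adjoint_isClosed hd).isClosable.leIsClosable (hs.le_adjoint hd)

/-- Since `⟪u, T u⟫` is real, the imaginary part of `⟪u, (T - z) u⟫` is `-Im z ‖u‖²`; then apply
Cauchy–Schwarz. -/
theorem abs_im_mul_norm_le_of_symmetric {T : E →ₗ.[ℂ] E} (hs : T.IsFormalAdjoint T) (z : ℂ)
    (u : T.domain) : |z.im| * ‖(u : E)‖ ≤ ‖T u - z • (u : E)‖ := by
  have h1 : (⟪(u : E), T u - z • (u : E)⟫_ℂ).im = - z.im * ‖(u : E)‖ ^ 2 := by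
    have h2 : (⟪(u : E), T u⟫_ℂ).im = 0 := by
      have h3 := hs u u
      rw [← inner_conj_symm] at h3
      exact Complex.conj_eq_iff_im.1 h3
    rw [inner_sub_right, inner_smul_right, Complex.sub_im, h2, inner_self_eq_norm_sq_to_K]
    have : ((‖(u : E)‖ : ℂ) ^ 2) = ((‖(u : E)‖ ^ 2 : ℝ) : ℂ) := by push_cast; rfl
    simp only [Complex.coe_algebraMap, this, Complex.mul_im, Complex.ofReal_re, Complex.ofReal_im]
    ring
  have h4 : |z.im| * ‖(u : E)‖ ^ 2 ≤ ‖(u : E)‖ * ‖T u - z • (u : E)‖ := by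
    calc |z.im| * ‖(u : E)‖ ^ 2 = |(⟪(u : E), T u - z • (u : E)⟫_ℂ).im| := by
          rw [h1, abs_mul, abs_neg, abs_of_nonneg (sq_nonneg ‖(u : E)‖)]
      _ ≤ ‖⟪(u : E), T u - z • (u : E)⟫_ℂ‖ := Complex.abs_im_le_norm _
      _ ≤ _ := norm_inner_le_norm _ _
  rcases (norm_nonneg (u : E)).eq_or_lt with h | h
  · rw [← h]; simp
  · nlinarith

/-- The inequality is a closed condition on pairs `(u, T u)`, so it passes to the closure of the
graph. -/
theorem abs_im_mul_norm_le_of_mem_graph_closure {T : E →ₗ.[ℂ] E} (hs : T.IsFormalAdjoint T)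
    (hc : T.IsClosable) (z : ℂ) (u : T.closure.domain) :
    |z.im| * ‖(u : E)‖ ≤ ‖T.closure u - z • (u : E)‖ := by
  have hmem : ((u : E), T.closure u) ∈ T.graph.topologicalClosure := by
    rw [hc.graph_closure_eq_closure_graph]
    exact T.closure.mem_graph u
  have hcl : IsClosed {p : E × E | |z.im| * ‖p.1‖ ≤ ‖p.2 - z • p.1‖} :=
    isClosed_le (by fun_prop) (by fun_prop)
  refine closure_minimal (t := {p : E × E | |z.im| * ‖p.1‖ ≤ ‖p.2 - z • p.1‖}) ?_ hcl hmem
  rintro ⟨x, y⟩ hxy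
  obtain ⟨v, hv, rfl⟩ := (LinearPMap.mem_graph_iff _).1 hxy
  simp only at hv
  subst hv
  exact abs_im_mul_norm_le_of_symmetric hs z v

/-- A nonreal number is in the resolvent set of the closure of a symmetric operator whose
corresponding deficiency space is trivial. -/
theorem mem_resolventSet_closure [CompleteSpace E] {T : E →ₗ.[ℂ] E}
    (hd : Dense (T.domain : Set E)) (hs : T.IsFormalAdjoint T) {z : ℂ} (hz : z.im ≠ 0)
    (h : ∀ w : E, (∀ u : T.domain, ⟪w, T u - z • (u : E)⟫_ℂ = 0) → w = 0) :
    z ∈ resolventSet T.closure := by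
  have hc := isClosable_of_symmetric hd hs
  have hz' : 0 < |z.im| := abs_pos.2 hz
  set S : T.closure.domain →ₗ[ℂ] E := T.closure.toFun - z • T.closure.domain.subtype with hS
  have hSapp (u : T.closure.domain) : S u = T.closure u - z • (u : E) := rfl
  have hbound (u : T.closure.domain) : |z.im| * ‖(u : E)‖ ≤ ‖S u‖ :=
    abs_im_mul_norm_le_of_mem_graph_closure hs hc z u
  have hinj : Function.Injective S := by
    refine (injective_iff_map_eq_zero S).2 fun u hu => ?_
    have := hbound u
    rw [hu, norm_zero] at this
    have h0 : ‖(u : E)‖ = 0 := le_antisymm (by nlinarith [norm_nonneg (u : E)]) (norm_nonneg _)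
    exact Subtype.ext (norm_eq_zero.1 h0)
  -- `hbound` makes the preimages of a convergent sequence in the range Cauchy, and closedness of
  -- the graph puts their limit in the domain.
  have hclosed : IsClosed (LinearMap.range S : Set E) := by
    refine isClosed_of_closure_subset fun y hy => ?_
    obtain ⟨s, hs1, hs2⟩ := mem_closure_iff_seq_limit.1 hy
    choose v hv using hs1
    have hcau : CauchySeq fun n => (v n : E) := by
      have hsc := hs2.cauchySeq
      rw [Metric.cauchySeq_iff] at hsc ⊢
      intro δ hδ
      obtain ⟨N, hN⟩ := hsc (|z.im| * δ) (by positivity)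
      refine ⟨N, fun m hm n hn => ?_⟩
      have h1 := hbound (v m - v n)
      rw [map_sub, hv, hv, ← dist_eq_norm] at h1
      have h2 := hN m hm n hn
      have h3 : ((v m - v n : T.closure.domain) : E) = (v m : E) - v n := rfl
      rw [h3, ← dist_eq_norm] at h1
      exact lt_of_mul_lt_mul_left (h1.trans_lt h2) hz'.le
    obtain ⟨x, hx⟩ := cauchySeq_tendsto_of_complete hcau
    have hgr : (x, y + z • x) ∈ T.closure.graph := by
      have hcl : IsClosed (T.closure.graph : Set (E × E)) := hc.closure_isClosed
      refine hcl.mem_of_tendsto (f := fun n => ((v n : E), T.closure (v n))) (b := atTop) ?_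
        (Eventually.of_forall fun n => T.closure.mem_graph (v n))
      refine hx.prodMk_nhds ?_
      have : (fun n => T.closure (v n)) = fun n => s n + z • (v n : E) := by
        funext n; rw [← hv n, hSapp]; abel
      rw [this]
      exact hs2.add (hx.const_smul z)
    obtain ⟨w, hw1, hw2⟩ := (LinearPMap.mem_graph_iff _).1 hgr
    simp only at hw1 hw2
    exact ⟨w, by rw [hSapp, hw2, hw1]; abel⟩
  -- The range is closed, so it is everything once its orthogonal complement is trivial; for that
  -- `h` needs only vectors of the original domain.
  have hsurj : LinearMap.range S = ⊤ := by
    have : CompleteSpace (LinearMap.range S) := hclosed.completeSpace_coe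
    rw [← Submodule.orthogonal_eq_bot_iff, Submodule.eq_bot_iff]
    intro w hw
    refine h w fun u => ?_
    have hle := T.le_closure
    have hu : T u - z • (u : E) = S ⟨u, hle.1 u.2⟩ := by
      rw [hSapp, ← hle.2 (x := u) (y := ⟨u, hle.1 u.2⟩) rfl]
    rw [hu]
    exact (Submodule.mem_orthogonal' _ _).1 hw _ ⟨_, rfl⟩
  let e := LinearEquiv.ofBijective S ⟨hinj, LinearMap.range_eq_top.1 hsurj⟩
  let R : E →ₗ[ℂ] E := T.closure.domain.subtype ∘ₗ e.symm.toLinearMap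
  have he (x : E) : S (e.symm x) = x := e.apply_symm_apply x
  let R' : E →L[ℂ] E := R.mkContinuous (|z.im|⁻¹) fun x => by
    have h1 := hbound (e.symm x)
    rw [he] at h1
    rw [inv_mul_eq_div, le_div_iff₀ hz', mul_comm]
    exact h1
  refine ⟨R', fun x => ⟨(e.symm x).2, he x⟩, fun u => ?_⟩
  change ((e.symm (S u) : T.closure.domain) : E) = u
  congr 1
  exact e.symm_apply_apply u

/-- The easy half of Weyl's criterion: a bounded inverse `R` would give `‖u‖ ≤ ‖R‖ δ ‖u‖`, which is
impossible for `δ = (‖R‖ + 1)⁻¹`. -/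
theorem mem_spectrum_of_approx {T : E →ₗ.[ℂ] E} {z : ℂ}
    (h : ∀ δ > 0, ∃ u : T.domain, (u : E) ≠ 0 ∧ ‖T u - z • (u : E)‖ ≤ δ * ‖(u : E)‖) :
    z ∈ spectrum T := by
  rintro ⟨R, -, hR⟩
  obtain ⟨u, hu0, hu⟩ := h (‖R‖ + 1)⁻¹ (by positivity)
  have h1 : ‖(u : E)‖ ≤ ‖R‖ * ((‖R‖ + 1)⁻¹ * ‖(u : E)‖) := by
    calc ‖(u : E)‖ = ‖R (T u - z • (u : E))‖ := by rw [hR]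
      _ ≤ ‖R‖ * ‖T u - z • (u : E)‖ := R.le_opNorm _
      _ ≤ _ := by gcongr
  have h4 : ‖R‖ * ((‖R‖ + 1)⁻¹ * ‖(u : E)‖) = ‖(u : E)‖ - (‖R‖ + 1)⁻¹ * ‖(u : E)‖ := by
    field_simp; ring
  have h5 : 0 < (‖R‖ + 1)⁻¹ * ‖(u : E)‖ := by positivity
  linarith

theorem essentialSpectrum_eq_range_ofReal {T : E →ₗ.[ℂ] E}
    (h1 : ∀ z : ℂ, z.im ≠ 0 → z ∈ resolventSet T) (h2 : ∀ r : ℝ, (r : ℂ) ∈ spectrum T) :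
    essentialSpectrum T = Set.range ((↑) : ℝ → ℂ) := by
  have hreal (z : ℂ) (hz : z ∈ spectrum T) : ∃ r : ℝ, (r : ℂ) = z := by
    refine ⟨z.re, Complex.ext rfl ?_⟩
    by_contra h
    exact hz (h1 z fun h' => h (by simp [h']))
  refine Set.Subset.antisymm (fun z hz => hreal z hz.1) ?_
  rintro _ ⟨r, rfl⟩
  refine ⟨h2 r, ?_⟩
  rintro ⟨-, ⟨ρ, hρ, hball⟩, -⟩
  -- The real point `r + ρ / 2` is again in the spectrum, so `r` is not isolated.
  have hmem : ((r + ρ / 2 : ℝ) : ℂ) ∈ Metric.ball (r : ℂ) ρ ∩ spectrum T := by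
    refine ⟨?_, h2 _⟩
    rw [Metric.mem_ball, dist_eq_norm, ← Complex.ofReal_sub, Complex.norm_real, Real.norm_eq_abs]
    rw [abs_lt]; constructor <;> linarith
  rw [hball, Set.mem_singleton_iff, Complex.ofReal_inj] at hmem
  linarith

end Abstract

/-! ### Radial mollifiers -/

open ContinuousLinearMap (lsmul)
open scoped Convolution ENNReal

/-- A smooth radial bump function supported in the ball of radius `ε`. -/
def radialBump (ε : ℝ) (x : Plane) : ℝ := Real.smoothTransition (1 - ‖x‖ ^ 2 / ε ^ 2)

theorem contDiff_radialBump (ε : ℝ) : ContDiff ℝ ∞ (radialBump ε) :=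
  Real.smoothTransition.contDiff.comp (contDiff_const.sub ((contDiff_norm_sq ℝ).div_const _))

theorem radialBump_nonneg (ε : ℝ) (x : Plane) : 0 ≤ radialBump ε x :=
  Real.smoothTransition.nonneg _

theorem support_radialBump {ε : ℝ} (hε : 0 < ε) :
    Function.support (radialBump ε) = Metric.ball 0 ε := by
  ext x
  rw [Function.mem_support, mem_ball_zero_iff]
  constructor
  · intro h
    by_contra! hx
    refine h (Real.smoothTransition.zero_of_nonpos ?_)
    rw [sub_nonpos, one_le_div (by positivity)]
    gcongr
  · intro h
    refine (Real.smoothTransition.pos_of_pos ?_).ne'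
    rw [sub_pos, div_lt_one (by positivity)]
    gcongr

theorem hasCompactSupport_radialBump {ε : ℝ} (hε : 0 < ε) : HasCompactSupport (radialBump ε) :=
  HasCompactSupport.of_support_subset_isCompact (isCompact_closedBall 0 ε)
    ((support_radialBump hε).subset.trans Metric.ball_subset_closedBall)

theorem integral_radialBump_pos {ε : ℝ} (hε : 0 < ε) : 0 < ∫ x, radialBump ε x := by
  refine (integral_pos_iff_support_of_nonneg (radialBump_nonneg ε)
    ((contDiff_radialBump ε).continuous.integrable_of_hasCompactSupport
      (hasCompactSupport_radialBump hε))).2 ?_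
  rw [support_radialBump hε]
  exact Metric.measure_ball_pos _ _ hε

/-- The normalized radial bump function. -/
def mollifier (ε : ℝ) (x : Plane) : ℝ := (∫ y, radialBump ε y)⁻¹ * radialBump ε x

theorem contDiff_mollifier (ε : ℝ) : ContDiff ℝ ∞ (mollifier ε) :=
  contDiff_const.mul (contDiff_radialBump ε)

theorem mollifier_nonneg (ε : ℝ) (x : Plane) : 0 ≤ mollifier ε x :=
  mul_nonneg (inv_nonneg.2 (integral_nonneg (radialBump_nonneg ε))) (radialBump_nonneg ε x)

theorem hasCompactSupport_mollifier {ε : ℝ} (hε : 0 < ε) : HasCompactSupport (mollifier ε) :=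
  (hasCompactSupport_radialBump hε).mul_left

theorem support_mollifier_subset {ε : ℝ} (hε : 0 < ε) :
    Function.support (mollifier ε) ⊆ Metric.ball 0 ε := by
  rw [← support_radialBump hε]
  exact fun x hx => right_ne_zero_of_mul hx

theorem integrable_mollifier {ε : ℝ} (hε : 0 < ε) : Integrable (mollifier ε) :=
  (contDiff_mollifier ε).continuous.integrable_of_hasCompactSupport (hasCompactSupport_mollifier hε)

theorem integral_mollifier {ε : ℝ} (hε : 0 < ε) : ∫ x, mollifier ε x = 1 := by
  simp only [mollifier]
  rw [integral_const_mul, inv_mul_cancel₀ (integral_radialBump_pos hε).ne']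

/-- The derivative of a radial function vanishes in tangential directions. -/
theorem fderiv_mollifier_of_inner_eq_zero (ε : ℝ) {x v : Plane} (h : inner ℝ x v = 0) :
    fderiv ℝ (mollifier ε) x v = 0 := by
  have h1 : HasFDerivAt (fun x : Plane => 1 - ‖x‖ ^ 2 / ε ^ 2)
      (-((ε ^ 2)⁻¹ • (2 • innerSL ℝ x))) x := by
    have := ((hasStrictFDerivAt_norm_sq x).hasFDerivAt.const_mul ((ε ^ 2)⁻¹)).const_sub 1
    refine this.congr_of_eventuallyEq (Eventually.of_forall fun y => ?_)
    simp only [div_eq_inv_mul]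
  have h2 : HasDerivAt Real.smoothTransition
      (deriv Real.smoothTransition (1 - ‖x‖ ^ 2 / ε ^ 2)) (1 - ‖x‖ ^ 2 / ε ^ 2) :=
    ((Real.smoothTransition.contDiff (n := 1)).differentiable one_ne_zero _).hasDerivAt
  have h3 : HasFDerivAt (mollifier ε) _ x :=
    (h2.comp_hasFDerivAt x h1).const_mul (∫ y, radialBump ε y)⁻¹
  rw [h3.fderiv]
  simp [h]

theorem eLpNorm_two_sq {F : Type*} [NormedAddCommGroup F] (g : Plane → F) (μ : Measure Plane) :
    eLpNorm g 2 μ ^ 2 = ∫⁻ x, ‖g x‖ₑ ^ 2 ∂μ := by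
  have := eLpNorm_nnreal_pow_eq_lintegral (f := g) (p := 2) (μ := μ) two_ne_zero
  simpa using this

/-! ### Mollification and its convergence in the mean. -/

section Mollify

variable {F : Type*} [NormedAddCommGroup F] [NormedSpace ℝ F]

/-- The convolution of `f` with the mollifier. -/
def mollify (ε : ℝ) (f : Plane → F) : Plane → F := mollifier ε ⋆[lsmul ℝ ℝ, volume] f

theorem mollify_apply (ε : ℝ) (f : Plane → F) (x : Plane) :
    mollify ε f x = ∫ y, mollifier ε (x - y) • f y := by
  simp only [mollify, convolution_eq_swap, ContinuousLinearMap.lsmul_apply]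

theorem mollify_apply' (ε : ℝ) (f : Plane → F) (x : Plane) :
    mollify ε f x = ∫ y, mollifier ε y • f (x - y) := by
  simp only [mollify, convolution_def, ContinuousLinearMap.lsmul_apply]

theorem contDiff_mollify {ε : ℝ} (hε : 0 < ε) {f : Plane → F} (hf : LocallyIntegrable f) :
    ContDiff ℝ ∞ (mollify ε f) :=
  (hasCompactSupport_mollifier hε).contDiff_convolution_left _ (contDiff_mollifier ε) hf

theorem norm_mollify_sub_le [CompleteSpace F] {ε δ : ℝ} (hε : 0 < ε) {f : Plane → F}
    (hf : Continuous f) (x : Plane)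
    (h : ∀ y ∈ Metric.ball x ε, dist (f y) (f x) ≤ δ) : ‖mollify ε f x - f x‖ ≤ δ := by
  rw [← dist_eq_norm]
  exact dist_convolution_le ((dist_self (f x)).symm.le.trans (h x (Metric.mem_ball_self hε)))
    (support_mollifier_subset hε) (mollifier_nonneg ε) (integral_mollifier hε)
    hf.aestronglyMeasurable h

/-- Jensen's inequality for the probability measure with density `mollifier ε`, in the form that the
norm in `L¹` is at most the norm in `L²`. -/
theorem norm_mollify_sub_self_sq_le [CompleteSpace F] {ε : ℝ} (hε : 0 < ε) {f : Plane → F}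
    (hf : LocallyIntegrable f) (hf' : StronglyMeasurable f) (x : Plane) :
    ‖mollify ε f x - f x‖ₑ ^ 2 ≤
      ∫⁻ t, ENNReal.ofReal (mollifier ε t) * ‖f (x - t) - f x‖ₑ ^ 2 := by
  have hi1 : Integrable (fun t => mollifier ε t • f (x - t)) :=
    ((hasCompactSupport_mollifier hε).convolutionExists_left (lsmul ℝ ℝ)
      (contDiff_mollifier ε).continuous hf x)
  have hi2 : Integrable (fun t => mollifier ε t • f x) := (integrable_mollifier hε).smul_const _
  have h1 : mollify ε f x - f x = ∫ t, mollifier ε t • (f (x - t) - f x) := by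
    simp only [smul_sub]
    rw [integral_sub hi1 hi2, mollify_apply', integral_smul_const, integral_mollifier hε, one_smul]
  have hm : Measurable fun t => ENNReal.ofReal (mollifier ε t) :=
    (contDiff_mollifier ε).continuous.measurable.ennreal_ofReal
  have hg : StronglyMeasurable fun t => f (x - t) - f x :=
    (hf'.comp_measurable (measurable_const.sub measurable_id)).sub stronglyMeasurable_const
  set μ := (volume : Measure Plane).withDensity fun t => ENNReal.ofReal (mollifier ε t) with hμ
  have hprob : IsProbabilityMeasure μ := by
    constructor
    rw [withDensity_apply _ MeasurableSet.univ, Measure.restrict_univ,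
      ← ofReal_integral_eq_lintegral_ofReal (integrable_mollifier hε)
        (Eventually.of_forall (mollifier_nonneg ε)), integral_mollifier hε, ENNReal.ofReal_one]
  have h2 : ‖mollify ε f x - f x‖ₑ ≤ eLpNorm (fun t => f (x - t) - f x) 1 μ := by
    rw [h1, eLpNorm_one_eq_lintegral_enorm, lintegral_withDensity_eq_lintegral_mul _ hm hg.enorm]
    refine (enorm_integral_le_lintegral_enorm _).trans (lintegral_mono fun t => ?_)
    simp only [Pi.mul_apply, enorm_smul, Real.enorm_eq_ofReal (mollifier_nonneg ε t), le_refl]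
  have h3 := h2.trans (eLpNorm_le_eLpNorm_of_exponent_le (q := 2) (by norm_num)
    hg.aestronglyMeasurable)
  calc ‖mollify ε f x - f x‖ₑ ^ 2 ≤ (eLpNorm (fun t => f (x - t) - f x) 2 μ) ^ 2 := by gcongr
    _ = ∫⁻ t, ‖f (x - t) - f x‖ₑ ^ 2 ∂μ := by
      exact eLpNorm_two_sq _ _
    _ = _ := by
      rw [lintegral_withDensity_eq_lintegral_mul _ hm (hg.enorm.pow_const 2)]
      rfl

/-- Translations act continuously on `L²`, as an instance of continuity of composition with measure
preserving maps. -/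
theorem tendsto_eLpNorm_translate_sub {F : Type*} [NormedAddCommGroup F] {f : Plane → F}
    (hf : MemLp f 2) :
    Tendsto (fun t => eLpNorm (fun x => f (x - t) - f x) 2 volume) (𝓝 0) (𝓝 0) := by
  let g : Plane → C(Plane, Plane) := fun t => ⟨fun x => x - t, continuous_id.sub continuous_const⟩
  have hg : Continuous g :=
    (ContinuousMap.curry ⟨fun p : Plane × Plane => p.2 - p.1, by fun_prop⟩).continuous
  have hgm (t : Plane) : MeasurePreserving (g t) volume volume := measurePreserving_sub_right _ t
  have hc : Continuous fun t => Lp.compMeasurePreserving (g t) (hgm t) (hf.toLp f) :=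
    continuous_const.compMeasurePreservingLp hg hgm (by norm_num)
  have h0 : Lp.compMeasurePreserving (g 0) (hgm 0) (hf.toLp f) = hf.toLp f := by
    refine Lp.ext ?_
    filter_upwards [Lp.coeFn_compMeasurePreserving (hf.toLp f) (hgm 0)] with x hx
    rw [hx]
    simp [g]
  have h1 := hc.tendsto 0
  rw [h0] at h1
  have h2 := (Lp.tendsto_Lp_iff_tendsto_eLpNorm' _ _).1 h1
  refine h2.congr fun t => eLpNorm_congr_ae ?_
  filter_upwards [Lp.coeFn_compMeasurePreserving (hf.toLp f) (hgm t), hf.coeFn_toLp,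
    (hgm t).quasiMeasurePreserving.ae hf.coeFn_toLp] with x h1 h2 h3
  simp only [Pi.sub_apply, h1, Function.comp_apply, h2, h3]
  rfl

theorem mollify_congr_ae (ε : ℝ) {f g : Plane → F} (h : f =ᵐ[volume] g) :
    mollify ε f = mollify ε g :=
  convolution_congr _ EventuallyEq.rfl h

/-- The pointwise Jensen bound is integrated in `x` and the integrals are exchanged by Tonelli.
Strong measurability of `f` itself makes the integrand jointly measurable; for general `f` one
passes to a representative. -/
theorem eLpNorm_mollify_sub_le_of_stronglyMeasurable [CompleteSpace F] {f : Plane → F}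
    (hloc : LocallyIntegrable f) (hsm : StronglyMeasurable f) {ε : ℝ} (hε0 : 0 < ε) {δ : ℝ≥0∞}
    (hball : ∀ t ∈ Metric.ball (0 : Plane) ε, eLpNorm (fun x => f (x - t) - f x) 2 volume ≤ δ) :
    eLpNorm (mollify ε f - f) 2 volume ≤ δ := by
  have hjm : Measurable fun p : Plane × Plane =>
      ENNReal.ofReal (mollifier ε p.2) * ‖f (p.1 - p.2) - f p.1‖ₑ ^ 2 := by
    refine Measurable.mul ?_ (Measurable.pow_const (StronglyMeasurable.enorm ?_) 2)
    · exact ((contDiff_mollifier ε).continuous.measurable.comp measurable_snd).ennreal_ofReal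
    · exact (hsm.comp_measurable (measurable_fst.sub measurable_snd)).sub
        (hsm.comp_measurable measurable_fst)
  have h1 : eLpNorm (mollify ε f - f) 2 volume ^ 2 ≤ δ ^ 2 := by
    calc eLpNorm (mollify ε f - f) 2 volume ^ 2 = ∫⁻ x, ‖mollify ε f x - f x‖ₑ ^ 2 := by
          rw [eLpNorm_two_sq]; rfl
      _ ≤ ∫⁻ x, ∫⁻ t, ENNReal.ofReal (mollifier ε t) * ‖f (x - t) - f x‖ₑ ^ 2 :=
          lintegral_mono fun x => norm_mollify_sub_self_sq_le hε0 hloc hsm x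
      _ = ∫⁻ t, ∫⁻ x, ENNReal.ofReal (mollifier ε t) * ‖f (x - t) - f x‖ₑ ^ 2 :=
          lintegral_lintegral_swap hjm.aemeasurable
      _ ≤ ∫⁻ t, ENNReal.ofReal (mollifier ε t) * δ ^ 2 := by
          refine lintegral_mono fun t => ?_
          have hmeas : Measurable fun x => ‖f (x - t) - f x‖ₑ ^ 2 :=
            (((hsm.comp_measurable (measurable_id.sub_const t)).sub hsm).enorm).pow_const 2
          rw [lintegral_const_mul _ hmeas]
          by_cases ht : t ∈ Metric.ball (0 : Plane) ε
          · gcongr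
            rw [← eLpNorm_two_sq (fun x => f (x - t) - f x)]
            exact pow_le_pow_left₀ zero_le (hball t ht) 2
          · have : mollifier ε t = 0 := by
              by_contra hne
              exact ht (support_mollifier_subset hε0 hne)
            simp [this]
      _ = δ ^ 2 := by
          rw [lintegral_mul_const _
            (contDiff_mollifier ε).continuous.measurable.ennreal_ofReal,
            ← ofReal_integral_eq_lintegral_ofReal (integrable_mollifier hε0)
            (Eventually.of_forall (mollifier_nonneg ε)), integral_mollifier hε0,
            ENNReal.ofReal_one, one_mul]
  exact (ENNReal.pow_le_pow_left_iff two_ne_zero).1 h1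

theorem eLpNorm_mollify_sub_le [CompleteSpace F] {f : Plane → F} (hf : MemLp f 2) {ε : ℝ}
    (hε : 0 < ε) {δ : ℝ≥0∞}
    (hball : ∀ t ∈ Metric.ball (0 : Plane) ε, eLpNorm (fun x => f (x - t) - f x) 2 volume ≤ δ) :
    eLpNorm (mollify ε f - f) 2 volume ≤ δ := by
  have hae := hf.aestronglyMeasurable.ae_eq_mk
  have hmk := (memLp_congr_ae hae).1 hf
  rw [mollify_congr_ae ε hae, eLpNorm_congr_ae (EventuallyEq.rfl.sub hae)]
  refine eLpNorm_mollify_sub_le_of_stronglyMeasurable (hmk.locallyIntegrable (by norm_num))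
    hf.aestronglyMeasurable.stronglyMeasurable_mk hε fun t ht => ?_
  refine le_of_eq_of_le (eLpNorm_congr_ae ?_) (hball t ht)
  filter_upwards [hae, (measurePreserving_sub_right volume t).quasiMeasurePreserving.ae hae]
    with x h1 h2
  rw [h1, h2]

/-- Every translate differs from `f` by at most `2 ‖f‖` in `L²`, so the preceding estimate applies
to `mollify ε f - f` with this bound and no restriction on `ε`. -/
theorem memLp_mollify [CompleteSpace F] {f : Plane → F} (hf : MemLp f 2) {ε : ℝ} (hε : 0 < ε) :
    MemLp (mollify ε f) 2 volume := by
  have hcont := (contDiff_mollify hε (hf.locallyIntegrable (by norm_num))).continuous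
  have h1 : MemLp (mollify ε f - f) 2 volume := by
    refine ⟨hcont.aestronglyMeasurable.sub hf.1, ?_⟩
    refine (eLpNorm_mollify_sub_le hf hε (δ := eLpNorm f 2 volume + eLpNorm f 2 volume)
      fun t _ => ?_).trans_lt (ENNReal.add_lt_top.2 ⟨hf.2, hf.2⟩)
    have hmp := measurePreserving_sub_right (volume : Measure Plane) t
    have h2 : eLpNorm (fun x => f (x - t)) 2 volume = eLpNorm f 2 volume :=
      eLpNorm_comp_measurePreserving hf.1 hmp
    calc _ ≤ eLpNorm (fun x => f (x - t)) 2 volume + eLpNorm f 2 volume :=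
          eLpNorm_sub_le (hf.1.comp_measurePreserving hmp) hf.1 (by norm_num)
      _ = _ := by rw [h2]
  simpa using h1.add hf

/-- Mollifications of a square integrable function converge to it in the mean. -/
theorem tendsto_eLpNorm_mollify_sub [CompleteSpace F] {f : Plane → F} (hf : MemLp f 2) :
    Tendsto (fun ε => eLpNorm (mollify ε f - f) 2 volume) (𝓝[>] 0) (𝓝 0) := by
  have key := tendsto_eLpNorm_translate_sub hf
  rw [ENNReal.tendsto_nhds_zero] at key ⊢
  intro δ hδ
  obtain ⟨r, hr, hball⟩ := Metric.eventually_nhds_iff_ball.1 (key δ hδ)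
  filter_upwards [Ioo_mem_nhdsGT hr] with ε hε
  exact eLpNorm_mollify_sub_le hf hε.1 fun t ht => hball t (Metric.ball_subset_ball hε.2.le ht)

end Mollify

/-! ### Differentiation of mollified functions -/

section MollifyDeriv

open ContinuousLinearMap (lsmul)
open scoped Convolution

variable {F : Type*} [NormedAddCommGroup F] [NormedSpace ℝ F]

theorem fderiv_mollify_of_contDiff {ε : ℝ} (hε : 0 < ε) {f : Plane → F} (hf : ContDiff ℝ 1 f)
    (hc : HasCompactSupport f) (x v : Plane) :
    fderiv ℝ (mollify ε f) x v = mollify ε (fun y => fderiv ℝ f y v) x := by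
  have hl : LocallyIntegrable (mollifier ε) := (integrable_mollifier hε).locallyIntegrable
  rw [mollify, (hc.hasFDerivAt_convolution_right (lsmul ℝ ℝ) hl hf x).fderiv,
    convolution_precompR_apply _ hl (hc.fderiv ℝ) (hf.continuous_fderiv one_ne_zero)]
  rfl

/-- Here the derivative falls on the kernel, so `f` need only be locally integrable; this is the
form required for weak solutions. -/
theorem fderiv_convolution_apply {g : Plane → ℝ} (hg : ContDiff ℝ 1 g) (hc : HasCompactSupport g)
    {f : Plane → F} (hf : LocallyIntegrable f) (x v : Plane) :
    fderiv ℝ (g ⋆[lsmul ℝ ℝ, volume] f) x v =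
      ((fun y => fderiv ℝ g y v) ⋆[lsmul ℝ ℝ, volume] f) x := by
  rw [(hc.hasFDerivAt_convolution_left (lsmul ℝ ℝ) hg hf x).fderiv]
  have hi : Integrable (fun t => (lsmul ℝ ℝ : ℝ →L[ℝ] F →L[ℝ] F).precompL Plane
      (fderiv ℝ g t) (f (x - t))) :=
    (hc.fderiv ℝ).convolutionExists_left ((lsmul ℝ ℝ : ℝ →L[ℝ] F →L[ℝ] F).precompL Plane)
      (hg.continuous_fderiv one_ne_zero) hf x
  rw [convolution_def, convolution_def, ContinuousLinearMap.integral_apply hi]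
  rfl

theorem eventually_norm_mollify_sub_le [CompleteSpace F] {f : Plane → F} (hf : Continuous f)
    (hc : HasCompactSupport f) {δ : ℝ} (hδ : 0 < δ) :
    ∀ᶠ ε in 𝓝[>] 0, ∀ x, ‖mollify ε f x - f x‖ ≤ δ := by
  obtain ⟨r, hr, h⟩ := Metric.uniformContinuous_iff.1
    (hc.uniformContinuous_of_continuous hf) δ hδ
  filter_upwards [Ioo_mem_nhdsGT hr] with ε hε x
  exact norm_mollify_sub_le hε.1 hf x fun y hy =>
    (h ((Metric.mem_ball.1 hy).trans hε.2)).le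

theorem mollify_eq_zero {ε R : ℝ} (hε : 0 < ε) {f : Plane → F}
    (hf : Function.support f ⊆ Metric.closedBall 0 R) {x : Plane} (hx : R + ε < ‖x‖) :
    mollify ε f x = 0 := by
  rw [mollify_apply]
  refine integral_eq_zero_of_ae (Eventually.of_forall fun y => ?_)
  by_contra h
  have h1 : f y ≠ 0 := fun h' => h (by simp [h'])
  have h2 : mollifier ε (x - y) ≠ 0 := fun h' => h (by simp [h'])
  have h3 := mem_closedBall_zero_iff.1 (hf h1)
  have h4 := mem_ball_zero_iff.1 (support_mollifier_subset hε h2)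
  have h5 := norm_add_le (x - y) y
  rw [sub_add_cancel] at h5
  linarith

end MollifyDeriv

/-! ### The Pauli expression on twice differentiable fields -/

theorem contDiff_momentum_of_contDiff {A : Plane → Plane} (hA : ContDiff ℝ 1 A) (j : Fin 2)
    {φ : Plane → Spinor} (hφ : ContDiff ℝ 2 φ) : ContDiff ℝ 1 (momentum A j φ) := by
  have h1 : ContDiff ℝ 1 (fun x => fderiv ℝ φ x (e j)) :=
    (hφ.fderiv_right (m := 1) (by norm_num)).clm_apply contDiff_const
  exact (h1.const_smul Complex.I).neg.sub
    ((contDiff_component hA j).smul (hφ.of_le one_le_two))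

theorem momentum_momentum {A : Plane → Plane} (hA : ContDiff ℝ 1 A) (j : Fin 2)
    {φ : Plane → Spinor} (hφ : ContDiff ℝ 2 φ) (x : Plane) :
    momentum A j (momentum A j φ) x =
      -(fderiv ℝ (fun y => fderiv ℝ φ y (e j)) x (e j))
        + (2 * Complex.I * (A x j : ℂ)) • fderiv ℝ φ x (e j)
        + (Complex.I * ((fderiv ℝ A x (e j) j : ℝ) : ℂ) + (A x j : ℂ) ^ 2) • φ x := by
  have h1 : ContDiff ℝ 1 (fun x => fderiv ℝ φ x (e j)) :=
    (hφ.fderiv_right (m := 1) (by norm_num)).clm_apply contDiff_const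
  have h2 := (h1.differentiable one_ne_zero x).hasFDerivAt
  have h3 := (hφ.differentiable two_ne_zero x).hasFDerivAt
  have h4 : HasFDerivAt (fun x => (A x j : ℂ))
      (Complex.ofRealCLM.comp ((EuclideanSpace.proj (𝕜 := ℝ) j).comp (fderiv ℝ A x))) x :=
    Complex.ofRealCLM.hasFDerivAt.comp x ((EuclideanSpace.proj (𝕜 := ℝ) j).hasFDerivAt.comp x
      (hA.differentiable one_ne_zero x).hasFDerivAt)
  have h5 : HasFDerivAt (momentum A j φ) _ x := (h2.const_smul Complex.I).neg.sub (h4.smul h3)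
  conv_lhs => rw [momentum]
  rw [h5.fderiv]
  simp only [momentum, _root_.sub_apply, _root_.neg_apply, _root_.add_apply, _root_.smul_apply,
    ContinuousLinearMap.smulRight_apply, ContinuousLinearMap.comp_apply]
  have h6 : Complex.ofRealCLM ((EuclideanSpace.proj (𝕜 := ℝ) j) (fderiv ℝ A x (e j)))
    = ((fderiv ℝ A x (e j) j : ℝ) : ℂ) := rfl
  rw [h6]
  match_scalars
  all_goals ring_nf
  all_goals simp

theorem pauliExpr_eq_zero_of_notMem (A : Plane → Plane) (V : Plane → ℝ) {φ : Plane → Spinor}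
    {x : Plane} (hx : x ∉ tsupport φ) : pauliExpr A V φ x = 0 := by
  have hev : φ =ᶠ[𝓝 x] 0 := notMem_tsupport_iff_eventuallyEq.1 hx
  have h1 (j : Fin 2) {ψ : Plane → Spinor} (hψ : ψ =ᶠ[𝓝 x] 0) : momentum A j ψ =ᶠ[𝓝 x] 0 := by
    filter_upwards [hψ.eventuallyEq_nhds] with y hy
    simp [momentum, hy.fderiv_eq, hy.eq_of_nhds]
  have h2 (j : Fin 2) : momentum A j (momentum A j φ) x = 0 := (h1 j (h1 j hev)).eq_of_nhds
  simp [pauliExpr, h2, hev.eq_of_nhds]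

theorem continuous_pauliExpr {A : Plane → Plane} {V : Plane → ℝ} (hA : ContDiff ℝ 1 A)
    (hV : Continuous V) {φ : Plane → Spinor} (hφ : ContDiff ℝ 2 φ) :
    Continuous (pauliExpr A V φ) := by
  refine Continuous.add (Continuous.sub ?_ ?_) ?_
  · exact continuous_finsetSum _ fun j _ =>
      continuous_momentum hA j (contDiff_momentum_of_contDiff hA j hφ)
  · exact (Complex.continuous_ofReal.comp (continuous_curl hA)).smul
      ((Matrix.toEuclideanLin σ₃).continuous_of_finiteDimensional.comp hφ.continuous)
  · exact (Complex.continuous_ofReal.comp hV).smul hφ.continuous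

theorem memLp_pauliExpr_of_contDiff {A : Plane → Plane} {V : Plane → ℝ} (hA : ContDiff ℝ 1 A)
    (hV : Continuous V) {φ : Plane → Spinor} (hφ : ContDiff ℝ 2 φ) (hc : HasCompactSupport φ) :
    MemLp (pauliExpr A V φ) 2 volume :=
  (continuous_pauliExpr hA hV hφ).memLp_of_hasCompactSupport
    (HasCompactSupport.intro' hc (isClosed_tsupport φ) fun _ hx =>
      pauliExpr_eq_zero_of_notMem A V hx)

/-- The coefficients in `momentum_momentum` are continuous, hence bounded on compact sets. Only the
pure second derivatives occur, so only these have to be close. -/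
theorem exists_norm_pauliExpr_sub_le {A : Plane → Plane} {V : Plane → ℝ} (hA : ContDiff ℝ 1 A)
    (hV : Continuous V) {K : Set Plane} (hK : IsCompact K) :
    ∃ M, 0 ≤ M ∧ ∀ φ ψ : Plane → Spinor, ContDiff ℝ 2 φ → ContDiff ℝ 2 ψ → ∀ x ∈ K, ∀ δ,
      ‖φ x - ψ x‖ ≤ δ → (∀ j, ‖fderiv ℝ φ x (e j) - fderiv ℝ ψ x (e j)‖ ≤ δ) →
      (∀ j, ‖fderiv ℝ (fun y => fderiv ℝ φ y (e j)) x (e j) -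
        fderiv ℝ (fun y => fderiv ℝ ψ y (e j)) x (e j)‖ ≤ δ) →
      ‖pauliExpr A V φ x - pauliExpr A V ψ x‖ ≤ M * δ := by
  let c1 : Fin 2 → Plane → ℝ := fun j x => ‖2 * Complex.I * (A x j : ℂ)‖
  let c2 : Fin 2 → Plane → ℝ := fun j x =>
    ‖Complex.I * ((fderiv ℝ A x (e j) j : ℝ) : ℂ) + (A x j : ℂ) ^ 2‖
  let S : Spinor →L[ℂ] Spinor := LinearMap.toContinuousLinearMap (Matrix.toEuclideanLin σ₃)
  let C : Plane → ℝ := fun x => ∑ j, (1 + c1 j x + c2 j x) + |curl A x| * ‖S‖ + |V x|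
  have hAc (j : Fin 2) : Continuous fun x => (A x j : ℂ) := (contDiff_component hA j).continuous
  have hAd (j : Fin 2) : Continuous fun x => ((fderiv ℝ A x (e j) j : ℝ) : ℂ) :=
    Complex.continuous_ofReal.comp ((EuclideanSpace.proj (𝕜 := ℝ) j).continuous.comp
      ((hA.continuous_fderiv one_ne_zero).clm_apply continuous_const))
  have hC : Continuous C := by
    refine ((continuous_finsetSum _ fun j _ => ?_).add
      ((continuous_curl hA).abs.mul continuous_const)).add hV.abs
    exact (continuous_const.add (continuous_const.mul (hAc j)).norm).add
      ((continuous_const.mul (hAd j)).add ((hAc j).pow 2)).norm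
  obtain ⟨M, hM⟩ := hK.exists_bound_of_continuousOn hC.continuousOn
  refine ⟨max M 0, le_max_right _ _, fun φ ψ hφ hψ x hx δ h0 h1 h2 => ?_⟩
  have hδ : 0 ≤ δ := (norm_nonneg _).trans h0
  have hm (j : Fin 2) : ‖momentum A j (momentum A j φ) x - momentum A j (momentum A j ψ) x‖
      ≤ (1 + c1 j x + c2 j x) * δ := by
    rw [momentum_momentum hA j hφ, momentum_momentum hA j hψ]
    have : ∀ (a a' b b' c c' : Spinor) (s t : ℂ), (-a + s • b + t • c) - (-a' + s • b' + t • c')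
        = -(a - a') + s • (b - b') + t • (c - c') := by
      intros; module
    rw [this]
    refine (norm_add₃_le).trans ?_
    rw [norm_neg, norm_smul, norm_smul]
    have e1 := mul_le_mul_of_nonneg_left (h1 j) (norm_nonneg (2 * Complex.I * (A x j : ℂ)))
    have e2 := mul_le_mul_of_nonneg_left h0
      (norm_nonneg (Complex.I * ((fderiv ℝ A x (e j) j : ℝ) : ℂ) + (A x j : ℂ) ^ 2))
    have e3 := h2 j
    simp only [c1, c2]
    linarith
  have hS : ‖S (φ x - ψ x)‖ ≤ ‖S‖ * δ := S.le_of_opNorm_le_of_le le_rfl h0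
  have heq : pauliExpr A V φ x - pauliExpr A V ψ x =
      ∑ j, (momentum A j (momentum A j φ) x - momentum A j (momentum A j ψ) x)
      + -((curl A x : ℂ) • S (φ x - ψ x)) + (V x : ℂ) • (φ x - ψ x) := by
    rw [map_sub]
    simp only [pauliExpr, Finset.sum_sub_distrib]
    have hSx (y : Spinor) : S y = Matrix.toEuclideanLin σ₃ y := rfl
    rw [hSx, hSx]
    module
  rw [heq]
  calc _ ≤ ∑ j, (1 + c1 j x + c2 j x) * δ + |curl A x| * (‖S‖ * δ) + |V x| * δ := by
        refine (norm_add₃_le).trans ?_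
        rw [norm_neg, norm_smul, norm_smul, Complex.norm_real, Complex.norm_real, Real.norm_eq_abs,
          Real.norm_eq_abs]
        gcongr
        exact (norm_sum_le _ _).trans (Finset.sum_le_sum fun j _ => hm j)
    _ = C x * δ := by simp only [C, ← Finset.sum_mul]; ring
    _ ≤ max M 0 * δ := by
        gcongr
        exact ((le_abs_self _).trans (hM x hx)).trans (le_max_left _ _)

theorem contDiff_fderiv_apply {φ : Plane → Spinor} (hφ : ContDiff ℝ 2 φ) (v : Plane) :
    ContDiff ℝ 1 (fun x => fderiv ℝ φ x v) :=
  (hφ.fderiv_right (m := 1) (by norm_num)).clm_apply contDiff_const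

theorem hasCompactSupport_fderiv_apply {φ : Plane → Spinor} (hc : HasCompactSupport φ)
    (v : Plane) : HasCompactSupport (fun x => fderiv ℝ φ x v) :=
  hc.fderiv_apply ℝ v

/-- A twice continuously differentiable field of compact support is approximated, together with its
image under the Pauli expression, by test functions. -/
theorem exists_testFunction_close {A : Plane → Plane} {V : Plane → ℝ} (hA : ContDiff ℝ 1 A)
    (hV : Continuous V) {φ : Plane → Spinor} (hφ : ContDiff ℝ 2 φ) (hc : HasCompactSupport φ)
    {δ : ℝ} (hδ : 0 < δ) :
    ∃ χ : testFunctions, eLpNorm ((χ : Plane → Spinor) - φ) 2 volume ≤ ENNReal.ofReal δ ∧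
      eLpNorm (pauliExpr A V χ - pauliExpr A V φ) 2 volume ≤ ENNReal.ofReal δ := by
  obtain ⟨R, hR⟩ := hc.isCompact.isBounded.subset_closedBall (0 : Plane)
  -- Mollifiers of radius less than `1` enlarge the support by at most `1`.
  set K : Set Plane := Metric.closedBall 0 (R + 1) with hKdef
  have hK : IsCompact K := isCompact_closedBall _ _
  obtain ⟨M, hM0, hM⟩ := exists_norm_pauliExpr_sub_le hA hV hK
  set m : ℝ := (volume K).toReal ^ (1 / 2 : ℝ) with hm
  have hm0 : 0 ≤ m := by positivity
  -- A field supported in `K` and bounded by `c` has `L²` norm at most `c * m`; this choice makes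
  -- both `δ' * m` and `M * δ' * m` at most `δ`.
  set δ' : ℝ := δ / ((M + 1) * (m + 1)) with hδ'
  have hδ'0 : 0 < δ' := by positivity
  have hd1 (j : Fin 2) := contDiff_fderiv_apply hφ (e j)
  have hcd1 (j : Fin 2) := hasCompactSupport_fderiv_apply hc (e j)
  have hcont2 (j : Fin 2) : Continuous fun x => fderiv ℝ (fun y => fderiv ℝ φ y (e j)) x (e j) :=
    ((hd1 j).continuous_fderiv one_ne_zero).clm_apply continuous_const
  have hcd2 (j : Fin 2) := hasCompactSupport_fderiv_apply (hcd1 j) (e j)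
  obtain ⟨ε, ⟨⟨⟨h0, h1⟩, h2⟩, hε0, hε1⟩⟩ :=
    (((eventually_norm_mollify_sub_le hφ.continuous hc hδ'0).and
      (eventually_all.2 fun j => eventually_norm_mollify_sub_le (hd1 j).continuous (hcd1 j)
        hδ'0)).and
      (eventually_all.2 fun j => eventually_norm_mollify_sub_le (hcont2 j) (hcd2 j) hδ'0)).and
      (Ioo_mem_nhdsGT one_pos) |>.exists
  have hsm : ContDiff ℝ ∞ (mollify ε φ) := contDiff_mollify hε0 hφ.continuous.locallyIntegrable
  have hsupp (x : Plane) (hx : x ∉ K) : mollify ε φ x = 0 := by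
    refine mollify_eq_zero hε0 ((subset_tsupport φ).trans hR) ?_
    rw [hKdef, mem_closedBall_zero_iff, not_le] at hx
    linarith
  have hcs : HasCompactSupport (mollify ε φ) := HasCompactSupport.intro hK hsupp
  have htsupp : tsupport (mollify ε φ) ⊆ K :=
    closure_minimal (fun x hx => by_contra fun h => hx (hsupp x h)) hK.isClosed
  have hφK : tsupport φ ⊆ K :=
    hR.trans (Metric.closedBall_subset_closedBall (by linarith))
  have hf1 (j : Fin 2) (x : Plane) : fderiv ℝ (mollify ε φ) x (e j) =
      mollify ε (fun y => fderiv ℝ φ y (e j)) x :=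
    fderiv_mollify_of_contDiff hε0 (hφ.of_le one_le_two) hc x (e j)
  have hf2 (j : Fin 2) (x : Plane) :
      fderiv ℝ (fun y => fderiv ℝ (mollify ε φ) y (e j)) x (e j) =
      mollify ε (fun z => fderiv ℝ (fun y => fderiv ℝ φ y (e j)) z (e j)) x := by
    rw [funext (hf1 j)]
    exact fderiv_mollify_of_contDiff hε0 (hd1 j) (hcd1 j) x (e j)
  have hL2 {f : Plane → Spinor} {c : ℝ} (hc0 : 0 ≤ c) (hcδ : c * m ≤ δ)
      (hf0 : ∀ x ∉ K, f x = 0) (hf : ∀ x ∈ K, ‖f x‖ ≤ c) :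
      eLpNorm f 2 volume ≤ ENNReal.ofReal δ := by
    have hind : f = K.indicator f := by
      funext x
      by_cases hx : x ∈ K
      · rw [Set.indicator_of_mem hx]
      · rw [Set.indicator_of_notMem hx, hf0 x hx]
    rw [hind, eLpNorm_indicator_eq_eLpNorm_restrict hK.measurableSet]
    refine (eLpNorm_le_of_ae_bound (C := c)
      ((ae_restrict_iff' hK.measurableSet).2 (Eventually.of_forall hf))).trans ?_
    rw [Measure.restrict_apply_univ]
    have hv : volume K ^ ((2 : ENNReal).toReal)⁻¹ = ENNReal.ofReal m := by
      rw [hm, ← ENNReal.ofReal_rpow_of_nonneg ENNReal.toReal_nonneg (by norm_num),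
        ENNReal.ofReal_toReal hK.measure_lt_top.ne]
      norm_num
    rw [hv, ← ENNReal.ofReal_mul hm0]
    exact ENNReal.ofReal_le_ofReal (by linarith [mul_comm m c])
  have hsmall : δ' * m ≤ δ ∧ M * δ' * m ≤ δ := by
    have hb : (M + 1) * (m + 1) * δ' = δ := by rw [hδ']; field_simp
    constructor <;> nlinarith
  refine ⟨⟨mollify ε φ, hsm, hcs⟩, ?_, ?_⟩
  · refine hL2 hδ'0.le hsmall.1 (fun x hx => ?_) fun x _ => h0 x
    have : φ x = 0 := image_eq_zero_of_notMem_tsupport fun h => hx (hφK h)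
    simp [hsupp x hx, this]
  · refine hL2 (by positivity) hsmall.2 (fun x hx => ?_) fun x hx => ?_
    · simp [pauliExpr_eq_zero_of_notMem A V fun h => hx (hφK h),
        pauliExpr_eq_zero_of_notMem A V fun h => hx (htsupp h)]
    · refine hM _ _ (hsm.of_le (by norm_cast)) hφ x hx δ' (h0 x) (fun j => ?_) fun j => ?_
      · rw [hf1]; exact h1 j x
      · rw [hf2]; exact h2 j x

/-! ### The Pauli operator on its core -/

section Core

open scoped InnerProductSpace

theorem integral_inner_fderiv {f g : Plane → Spinor} (hf : ContDiff ℝ 1 f) (hg : ContDiff ℝ 1 g)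
    (hfc : HasCompactSupport f) (v : Plane) :
    ∫ x, ⟪f x, fderiv ℝ g x v⟫_ℂ = -∫ x, ⟪fderiv ℝ f x v, g x⟫_ℂ := by
  have hf' : Continuous fun x => fderiv ℝ f x v :=
    (hf.continuous_fderiv one_ne_zero).clm_apply continuous_const
  have hg' : Continuous fun x => fderiv ℝ g x v :=
    (hg.continuous_fderiv one_ne_zero).clm_apply continuous_const
  have hint {p q : Plane → Spinor} (hp : Continuous p) (hq : Continuous q)
      (hc : HasCompactSupport p) : Integrable fun x => ⟪p x, q x⟫_ℂ := by
    refine (hp.inner hq).integrable_of_hasCompactSupport (hc.mono fun x hx => ?_)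
    exact fun h => hx (by simp [h])
  have := integral_bilinear_fderiv_right_eq_neg_left_of_integrable (μ := volume) (v := v)
    (B := (isBoundedBilinearMap_inner (𝕜 := ℂ) (E := Spinor)).toContinuousLinearMap)
    (f := f) (g := g)
    (hint hf' hg.continuous (hfc.fderiv_apply ℝ v)) (hint hf.continuous hg' hfc)
    (hint hf.continuous hg.continuous hfc)
    (fun x _ => hf.differentiable one_ne_zero x) (fun x _ => hg.differentiable one_ne_zero x)
  exact this

theorem integral_inner_momentum (A : Plane → Plane) (hA : ContDiff ℝ 1 A) (j : Fin 2)
    {f g : Plane → Spinor} (hf : ContDiff ℝ 1 f) (hg : ContDiff ℝ 1 g)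
    (hfc : HasCompactSupport f) :
    ∫ x, ⟪momentum A j f x, g x⟫_ℂ = ∫ x, ⟪f x, momentum A j g x⟫_ℂ := by
  have hf' : Continuous fun x => fderiv ℝ f x (e j) :=
    (hf.continuous_fderiv one_ne_zero).clm_apply continuous_const
  have hg' : Continuous fun x => fderiv ℝ g x (e j) :=
    (hg.continuous_fderiv one_ne_zero).clm_apply continuous_const
  have hint {p q : Plane → Spinor} (hp : Continuous p) (hq : Continuous q)
      (hc : HasCompactSupport p) : Integrable fun x => ⟪p x, q x⟫_ℂ := by
    refine (hp.inner hq).integrable_of_hasCompactSupport (hc.mono fun x hx => ?_)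
    exact fun h => hx (by simp [h])
  have hA' : Continuous fun x => (A x j : ℂ) := (contDiff_component hA j).continuous
  have h1 (x : Plane) : ⟪momentum A j f x, g x⟫_ℂ =
      Complex.I * ⟪fderiv ℝ f x (e j), g x⟫_ℂ - ⟪f x, (A x j : ℂ) • g x⟫_ℂ := by
    rw [inner_smul_right, momentum, inner_sub_left, inner_neg_left, inner_smul_left,
      inner_smul_left]
    simp
  have h2 (x : Plane) : ⟪f x, momentum A j g x⟫_ℂ =
      -(Complex.I * ⟪f x, fderiv ℝ g x (e j)⟫_ℂ) - ⟪f x, (A x j : ℂ) • g x⟫_ℂ := by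
    rw [momentum, inner_sub_right, inner_neg_right, inner_smul_right _ _ Complex.I]
  have h3 : Integrable fun x => ⟪f x, (A x j : ℂ) • g x⟫_ℂ :=
    hint hf.continuous (hA'.smul hg.continuous) hfc
  have h4 : Integrable fun x => -(Complex.I * ⟪f x, fderiv ℝ g x (e j)⟫_ℂ) :=
    ((hint hf.continuous hg' hfc).const_mul _).neg
  simp only [h1, h2]
  rw [integral_sub ((hint hf' hg.continuous (hfc.fderiv_apply ℝ _)).const_mul _) h3,
    integral_sub h4 h3, integral_neg,
    integral_const_mul, integral_const_mul, integral_inner_fderiv hf hg hfc]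
  ring

theorem inner_σ₃ (x y : Spinor) :
    ⟪Matrix.toEuclideanLin σ₃ x, y⟫_ℂ = ⟪x, Matrix.toEuclideanLin σ₃ y⟫_ℂ := by
  simp [PiLp.inner_apply, Fin.sum_univ_two, Matrix.toLpLin_apply, σ₃, dotProduct]

theorem integral_inner_pauliExpr {A : Plane → Plane} {V : Plane → ℝ} (hA : ContDiff ℝ 1 A)
    (hV : Continuous V) {φ ψ : Plane → Spinor} (hφ : ContDiff ℝ 2 φ) (hψ : ContDiff ℝ 2 ψ)
    (hφc : HasCompactSupport φ) :
    ∫ x, ⟪pauliExpr A V φ x, ψ x⟫_ℂ = ∫ x, ⟪φ x, pauliExpr A V ψ x⟫_ℂ := by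
  have hint {p q : Plane → Spinor} (hp : Continuous p) (hq : Continuous q)
      (hc : HasCompactSupport p) : Integrable fun x => ⟪p x, q x⟫_ℂ := by
    refine (hp.inner hq).integrable_of_hasCompactSupport (hc.mono fun x hx => ?_)
    exact fun h => hx (by simp [h])
  have hmφ (j : Fin 2) := contDiff_momentum_of_contDiff hA j hφ
  have hmψ (j : Fin 2) := contDiff_momentum_of_contDiff hA j hψ
  have hcm (j : Fin 2) := hasCompactSupport_momentum A j hφc
  have hσ : Continuous fun x => Matrix.toEuclideanLin σ₃ (ψ x) :=
    (Matrix.toEuclideanLin σ₃).continuous_of_finiteDimensional.comp hψ.continuous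
  have hcurl : Continuous fun x => (curl A x : ℂ) :=
    Complex.continuous_ofReal.comp (continuous_curl hA)
  have h1 (x : Plane) : ⟪pauliExpr A V φ x, ψ x⟫_ℂ =
      ∑ j, ⟪momentum A j (momentum A j φ) x, ψ x⟫_ℂ
      + ⟪φ x, -((curl A x : ℂ) • Matrix.toEuclideanLin σ₃ (ψ x)) + (V x : ℂ) • ψ x⟫_ℂ := by
    simp only [pauliExpr, inner_add_left, inner_sub_left, sum_inner, inner_smul_left,
      inner_add_right, inner_neg_right, inner_smul_right, inner_σ₃, Complex.conj_ofReal]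
    ring
  have h2 (x : Plane) : ⟪φ x, pauliExpr A V ψ x⟫_ℂ =
      ∑ j, ⟪φ x, momentum A j (momentum A j ψ) x⟫_ℂ
      + ⟪φ x, -((curl A x : ℂ) • Matrix.toEuclideanLin σ₃ (ψ x)) + (V x : ℂ) • ψ x⟫_ℂ := by
    simp only [pauliExpr, inner_add_right, inner_sub_right, inner_sum, inner_smul_right,
      inner_neg_right]
    ring
  have h3 : Integrable fun x =>
      ⟪φ x, -((curl A x : ℂ) • Matrix.toEuclideanLin σ₃ (ψ x)) + (V x : ℂ) • ψ x⟫_ℂ :=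
    hint hφ.continuous ((hcurl.smul hσ).neg.add
      ((Complex.continuous_ofReal.comp hV).smul hψ.continuous)) hφc
  simp only [h1, h2]
  rw [integral_add (integrable_finsetSum _ fun j _ =>
      hint (continuous_momentum hA j (hmφ j)) hψ.continuous
        (hasCompactSupport_momentum A j (hcm j))) h3,
    integral_add (integrable_finsetSum _ fun j _ =>
      hint hφ.continuous (continuous_momentum hA j (hmψ j)) hφc) h3,
    integral_finsetSum _ fun j _ => hint (continuous_momentum hA j (hmφ j)) hψ.continuous
        (hasCompactSupport_momentum A j (hcm j)),
    integral_finsetSum _ fun j _ => hint hφ.continuous (continuous_momentum hA j (hmψ j)) hφc]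
  congr 1
  refine Finset.sum_congr rfl fun j _ => ?_
  rw [integral_inner_momentum A hA j (hmφ j) (hψ.of_le one_le_two) (hcm j),
    integral_inner_momentum A hA j (hφ.of_le one_le_two) (hmψ j) hφc]

variable {A : Plane → Plane} {V : Plane → ℝ} (hA : ContDiff ℝ 1 A) (hV : Continuous V)

theorem pauliMinimal_apply (φ : testFunctions)
    (h : testToHilb φ ∈ (pauliMinimal A V hA hV).domain) :
    pauliMinimal A V hA hV ⟨testToHilb φ, h⟩ = pauliOnTest A V hA hV φ := by
  change pauliOnTest A V hA hV ((LinearEquiv.ofInjective testToHilb testToHilb_injective).symm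
    ⟨testToHilb φ, h⟩) = _
  congr 1
  rw [LinearEquiv.symm_apply_eq]
  rfl

theorem pauliMinimal_symmetric :
    (pauliMinimal A V hA hV).IsFormalAdjoint (pauliMinimal A V hA hV) := by
  rintro ⟨_, φ, rfl⟩ ⟨_, ψ, rfl⟩
  have e1 : ⟪pauliOnTest A V hA hV φ, testToHilb ψ⟫_ℂ =
      ∫ x, ⟪pauliExpr A V φ x, (ψ : Plane → Spinor) x⟫_ℂ := by
    rw [L2.inner_def]
    refine integral_congr_ae ?_
    filter_upwards [(memLp_pauliExpr hA hV φ).coeFn_toLp, (memLp_test ψ).coeFn_toLp] with x h1 h2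
    rw [← h1, ← h2]
    rfl
  have e2 : ⟪testToHilb φ, pauliOnTest A V hA hV ψ⟫_ℂ =
      ∫ x, ⟪(φ : Plane → Spinor) x, pauliExpr A V ψ x⟫_ℂ := by
    rw [L2.inner_def]
    refine integral_congr_ae ?_
    filter_upwards [(memLp_pauliExpr hA hV ψ).coeFn_toLp, (memLp_test φ).coeFn_toLp] with x h1 h2
    rw [← h1, ← h2]
    rfl
  have e3 := integral_inner_pauliExpr hA hV (φ.2.1.of_le (by norm_cast)) (ψ.2.1.of_le (by norm_cast))
    φ.2.2
  rw [← e1, ← e2] at e3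
  rw [← pauliMinimal_apply hA hV φ ⟨φ, rfl⟩, ← pauliMinimal_apply hA hV ψ ⟨ψ, rfl⟩] at e3
  exact e3

theorem dense_domain_pauliMinimal : Dense ((pauliMinimal A V hA hV).domain : Set Hilb) := by
  refine (Lp.dense_hasCompactSupport_contDiff (F := Spinor) (E := Plane) (μ := volume) (p := 2)
    (by norm_num)).mono ?_
  rintro f ⟨g, hfg, hgc, hg⟩
  refine ⟨⟨g, hg, hgc⟩, ?_⟩
  refine Lp.ext ?_
  exact ((memLp_test ⟨g, hg, hgc⟩).coeFn_toLp).trans hfg.symm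

theorem isClosable_pauliMinimal : (pauliMinimal A V hA hV).IsClosable :=
  isClosable_of_symmetric (dense_domain_pauliMinimal hA hV) (pauliMinimal_symmetric hA hV)

/-- Gauge functions are only `C²`, so multiplying by `exp (i χ)` takes test functions out of the
core; this lemma keeps the resulting fields in the domain of the closure. -/
theorem mem_closure_graph_pauliMinimal {φ : Plane → Spinor} (hφ : ContDiff ℝ 2 φ)
    (hc : HasCompactSupport φ) :
    ((hφ.continuous.memLp_of_hasCompactSupport hc).toLp φ,
      (memLp_pauliExpr_of_contDiff hA hV hφ hc).toLp (pauliExpr A V φ)) ∈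
      closure ((pauliMinimal A V hA hV).graph : Set (Hilb × Hilb)) := by
  rw [Metric.mem_closure_iff]
  intro δ hδ
  obtain ⟨χ, h1, h2⟩ := exists_testFunction_close hA hV hφ hc (half_pos hδ)
  refine ⟨(testToHilb χ, pauliOnTest A V hA hV χ), ?_, ?_⟩
  · rw [SetLike.mem_coe, LinearPMap.mem_graph_iff]
    exact ⟨⟨testToHilb χ, χ, rfl⟩, rfl, pauliMinimal_apply hA hV χ _⟩
  · rw [Prod.dist_eq, max_lt_iff]
    have key {f g : Plane → Spinor} (hf : MemLp f 2 volume) (hg : MemLp g 2 volume)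
        (h : eLpNorm (g - f) 2 volume ≤ ENNReal.ofReal (δ / 2)) :
        dist (hf.toLp f) (hg.toLp g) < δ := by
      rw [dist_comm, dist_eq_norm, ← MemLp.toLp_sub, Lp.norm_toLp]
      exact (ENNReal.toReal_le_of_le_ofReal (half_pos hδ).le h).trans_lt (half_lt_self hδ)
    exact ⟨key (hφ.continuous.memLp_of_hasCompactSupport hc) (memLp_test χ) h1,
      key (memLp_pauliExpr_of_contDiff hA hV hφ hc) (memLp_pauliExpr hA hV χ) h2⟩

theorem exists_mem_domain_pauliOperator {φ : Plane → Spinor} (hφ : ContDiff ℝ 2 φ)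
    (hc : HasCompactSupport φ) :
    ∃ u : (pauliOperator A V hA hV).domain,
      (u : Hilb) = (hφ.continuous.memLp_of_hasCompactSupport hc).toLp φ ∧
      pauliOperator A V hA hV u =
        (memLp_pauliExpr_of_contDiff hA hV hφ hc).toLp (pauliExpr A V φ) := by
  have h := mem_closure_graph_pauliMinimal hA hV hφ hc
  rw [← Submodule.topologicalClosure_coe,
    (isClosable_pauliMinimal hA hV).graph_closure_eq_closure_graph] at h
  obtain ⟨u, h1, h2⟩ := (LinearPMap.mem_graph_iff _).1 h
  exact ⟨u, h1, h2⟩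

/-- A vector orthogonal to the range of `H - z` on test functions is a weak solution against
all twice continuously differentiable fields of compact support. -/
theorem integral_inner_eq_zero_of_orthogonal {z : ℂ} {w : Hilb}
    (hw : ∀ u : (pauliMinimal A V hA hV).domain,
      ⟪w, pauliMinimal A V hA hV u - z • (u : Hilb)⟫_ℂ = 0)
    {φ : Plane → Spinor} (hφ : ContDiff ℝ 2 φ) (hc : HasCompactSupport φ) :
    ∫ x, ⟪w x, pauliExpr A V φ x - z • φ x⟫_ℂ = 0 := by
  have hcl : IsClosed {p : Hilb × Hilb | ⟪w, p.2 - z • p.1⟫_ℂ = 0} :=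
    isClosed_eq (by fun_prop) continuous_const
  have h := closure_minimal (t := {p : Hilb × Hilb | ⟪w, p.2 - z • p.1⟫_ℂ = 0}) (fun p hp => ?_)
    hcl (mem_closure_graph_pauliMinimal hA hV hφ hc)
  · rw [Set.mem_ofPred_eq, L2.inner_def] at h
    rw [← h]
    refine integral_congr_ae ?_
    filter_upwards [(memLp_pauliExpr_of_contDiff hA hV hφ hc).coeFn_toLp,
      (hφ.continuous.memLp_of_hasCompactSupport hc).coeFn_toLp,
      Lp.coeFn_sub ((memLp_pauliExpr_of_contDiff hA hV hφ hc).toLp (pauliExpr A V φ))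
        (z • (hφ.continuous.memLp_of_hasCompactSupport hc).toLp φ),
      Lp.coeFn_smul z ((hφ.continuous.memLp_of_hasCompactSupport hc).toLp φ)]
      with x h1 h2 h3 h4
    simp only at h3 h4 ⊢
    rw [h3, Pi.sub_apply, h4, Pi.smul_apply, h1, h2]
  · obtain ⟨u, h1, h2⟩ := (LinearPMap.mem_graph_iff _).1 hp
    rw [Set.mem_ofPred_eq, ← h1, ← h2]
    exact hw u

end Core

/-! ### Gauge transformations -/

section Gauge

theorem inner_e (j : Fin 2) (x : Plane) : inner ℝ x (e j) = x j := by
  simp [e, EuclideanSpace.inner_single_right]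

/-- Two vector potentials with the same magnetic field differ by a gradient. -/
theorem exists_gauge {A A' : Plane → Plane} (hA : ContDiff ℝ 1 A) (hA' : ContDiff ℝ 1 A')
    (h : ∀ x, curl A x = curl A' x) :
    ∃ χ : Plane → ℝ, ContDiff ℝ 2 χ ∧ ∀ x j, fderiv ℝ χ x (e j) = A x j - A' x j := by
  let α : Plane → Plane →L[ℝ] ℝ := fun x => innerSL ℝ (A x - A' x)
  have hα : ContDiff ℝ 1 α := (innerSL ℝ).contDiff.comp (hA.sub hA')
  have hdα (x v : Plane) : fderiv ℝ α x v = innerSL ℝ (fderiv ℝ A x v - fderiv ℝ A' x v) := by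
    have h1 : HasFDerivAt α ((innerSL ℝ : Plane →L[ℝ] Plane →L[ℝ] ℝ).comp
        (fderiv ℝ A x - fderiv ℝ A' x)) x :=
      (innerSL ℝ : Plane →L[ℝ] Plane →L[ℝ] ℝ).hasFDerivAt.comp x
        ((hA.differentiable one_ne_zero x).hasFDerivAt.sub
          (hA'.differentiable one_ne_zero x).hasFDerivAt)
    rw [h1.fderiv]
    rfl
  have hdec (v : Plane) : v = v 0 • e 0 + v 1 • e 1 := by
    ext j; fin_cases j <;> simp [e]
  -- Poincaré's lemma on the plane: equality of the two curls says that the derivative of the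
  -- one-form `α` is symmetric. As `α` is `C¹`, its primitive is `C²`.
  obtain ⟨χ, hχ⟩ := convex_univ.exists_forall_hasFDerivAt_of_fderiv_symmetric isOpen_univ
    (hα.differentiable one_ne_zero).differentiableOn (fun a _ x y => by
      have hsymm : fderiv ℝ α a (e 0) (e 1) = fderiv ℝ α a (e 1) (e 0) := by
        have := h a
        simp only [curl] at this
        rw [hdα, hdα, innerSL_apply_apply, innerSL_apply_apply, inner_e, inner_e]
        simp only [PiLp.sub_apply]
        linarith
      rw [hdec x, hdec y]
      simp only [map_add, map_smul, _root_.add_apply, _root_.smul_apply, smul_eq_mul, hsymm]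
      ring)
  have hfd : fderiv ℝ χ = α := funext fun x => (hχ x trivial).fderiv
  refine ⟨χ, ?_, fun x j => ?_⟩
  · rw [show (2 : WithTop ℕ∞) = 1 + 1 from one_add_one_eq_two.symm, contDiff_succ_iff_fderiv]
    exact ⟨fun x => (hχ x trivial).differentiableAt, by simp, hfd ▸ hα⟩
  · rw [hfd]
    simp [α, inner_e]

variable {A A' : Plane → Plane} {χ : Plane → ℝ}

theorem hasFDerivAt_gauge (hχ : ContDiff ℝ 2 χ) (x : Plane) :
    HasFDerivAt (fun x => Complex.exp (Complex.I * χ x))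
      (Complex.exp (Complex.I * χ x) • (Complex.I • Complex.ofRealCLM.comp (fderiv ℝ χ x))) x := by
  have h1 : HasFDerivAt (fun x => (χ x : ℂ)) (Complex.ofRealCLM.comp (fderiv ℝ χ x)) x :=
    Complex.ofRealCLM.hasFDerivAt.comp x (hχ.differentiable two_ne_zero x).hasFDerivAt
  exact (h1.const_mul Complex.I).cexp

theorem contDiff_gauge (hχ : ContDiff ℝ 2 χ) :
    ContDiff ℝ 2 (fun x => Complex.exp (Complex.I * χ x)) :=
  Complex.contDiff_exp.comp (contDiff_const.mul (Complex.ofRealCLM.contDiff.comp hχ))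

theorem momentum_gauge (hχ : ContDiff ℝ 2 χ) {j : Fin 2}
    (h : ∀ x, fderiv ℝ χ x (e j) = A x j - A' x j) {ψ : Plane → Spinor} (hψ : ContDiff ℝ 1 ψ) :
    momentum A j (fun x => Complex.exp (Complex.I * χ x) • ψ x) =
      fun x => Complex.exp (Complex.I * χ x) • momentum A' j ψ x := by
  funext x
  have h1 : HasFDerivAt (fun x => Complex.exp (Complex.I * χ x) • ψ x) _ x :=
    (hasFDerivAt_gauge hχ x).smul (hψ.differentiable one_ne_zero x).hasFDerivAt
  simp only [momentum]
  rw [h1.fderiv]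
  simp only [_root_.add_apply, _root_.smul_apply,
    ContinuousLinearMap.smulRight_apply, ContinuousLinearMap.comp_apply, h,
    Complex.ofRealCLM_apply]
  match_scalars
  · ring
  · simp only [smul_eq_mul]
    linear_combination (-Complex.exp (Complex.I * χ x) * ((A x j : ℂ) - A' x j)) * Complex.I_sq

/-- The gradient of `χ` produced by differentiating the phase cancels `A - A'`, so each momentum
component, and hence its square, passes through the phase. -/
theorem pauliExpr_gauge (hA' : ContDiff ℝ 1 A') (hχ : ContDiff ℝ 2 χ)
    (h : ∀ x j, fderiv ℝ χ x (e j) = A x j - A' x j) (hcurl : ∀ x, curl A x = curl A' x)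
    (V : Plane → ℝ) {ψ : Plane → Spinor} (hψ : ContDiff ℝ 2 ψ) (x : Plane) :
    pauliExpr A V (fun x => Complex.exp (Complex.I * χ x) • ψ x) x =
      Complex.exp (Complex.I * χ x) • pauliExpr A' V ψ x := by
  have h2 (j : Fin 2) : momentum A j (momentum A j (fun x => Complex.exp (Complex.I * χ x) • ψ x))
      = fun x => Complex.exp (Complex.I * χ x) • momentum A' j (momentum A' j ψ) x := by
    rw [momentum_gauge hχ (fun x => h x j) (hψ.of_le one_le_two),
      momentum_gauge hχ (fun x => h x j) (contDiff_momentum_of_contDiff hA' j hψ)]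
  simp only [pauliExpr, h2, hcurl, map_smul, ← Finset.smul_sum]
  module

end Gauge

/-! ### Local energy estimate -/

section Energy

/-- The partial derivative of `f` in the direction of the `j`-th unit vector. -/
def pd (j : Fin 2) (f : Plane → ℝ) (x : Plane) : ℝ := fderiv ℝ f x (e j)

/-- The Laplacian of `f`. -/
def lap (f : Plane → ℝ) (x : Plane) : ℝ := pd 0 (pd 0 f) x + pd 1 (pd 1 f) x

theorem contDiff_pd (j : Fin 2) {f : Plane → ℝ} {n m : WithTop ℕ∞} (hf : ContDiff ℝ n f)
    (h : m + 1 ≤ n) : ContDiff ℝ m (pd j f) :=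
  (hf.fderiv_right h).clm_apply contDiff_const

theorem continuous_pd (j : Fin 2) {f : Plane → ℝ} (hf : ContDiff ℝ 1 f) : Continuous (pd j f) :=
  (hf.continuous_fderiv one_ne_zero).clm_apply continuous_const

theorem continuous_lap {f : Plane → ℝ} (hf : ContDiff ℝ 2 f) : Continuous (lap f) :=
  (continuous_pd 0 (contDiff_pd 0 hf (by norm_num))).add
    (continuous_pd 1 (contDiff_pd 1 hf (by norm_num)))

theorem hasCompactSupport_pd (j : Fin 2) {f : Plane → ℝ} (hf : HasCompactSupport f) :
    HasCompactSupport (pd j f) :=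
  hf.fderiv_apply ℝ _

theorem hasCompactSupport_lap {f : Plane → ℝ} (hf : HasCompactSupport f) :
    HasCompactSupport (lap f) :=
  (hasCompactSupport_pd 0 (hasCompactSupport_pd 0 hf)).add
    (hasCompactSupport_pd 1 (hasCompactSupport_pd 1 hf))

theorem pd_add (j : Fin 2) {f g : Plane → ℝ} (hf : ContDiff ℝ 1 f) (hg : ContDiff ℝ 1 g)
    (x : Plane) : pd j (fun x => f x + g x) x = pd j f x + pd j g x := by
  have := (hf.differentiable one_ne_zero x).hasFDerivAt.fun_add
    (hg.differentiable one_ne_zero x).hasFDerivAt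
  simp [pd, this.fderiv]

theorem pd_sub (j : Fin 2) {f g : Plane → ℝ} (hf : ContDiff ℝ 1 f) (hg : ContDiff ℝ 1 g)
    (x : Plane) : pd j (fun x => f x - g x) x = pd j f x - pd j g x := by
  have := (hf.differentiable one_ne_zero x).hasFDerivAt.fun_sub
    (hg.differentiable one_ne_zero x).hasFDerivAt
  simp [pd, this.fderiv]

theorem pd_mul (j : Fin 2) {f g : Plane → ℝ} (hf : ContDiff ℝ 1 f) (hg : ContDiff ℝ 1 g)
    (x : Plane) : pd j (fun x => f x * g x) x = f x * pd j g x + pd j f x * g x := by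
  have := (hf.differentiable one_ne_zero x).hasFDerivAt.fun_mul
    (hg.differentiable one_ne_zero x).hasFDerivAt
  simp only [pd, this.fderiv, _root_.add_apply, _root_.smul_apply, smul_eq_mul]
  ring

theorem integral_mul_pd (j : Fin 2) {f g : Plane → ℝ} (hf : ContDiff ℝ 1 f) (hg : ContDiff ℝ 1 g)
    (hc : HasCompactSupport f) : ∫ x, f x * pd j g x = -∫ x, pd j f x * g x := by
  refine integral_mul_fderiv_eq_neg_fderiv_mul_of_integrable ?_ ?_ ?_
    (fun x _ => hf.differentiable one_ne_zero x) (fun x _ => hg.differentiable one_ne_zero x)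
  · exact ((continuous_pd j hf).mul hg.continuous).integrable_of_hasCompactSupport
      (hasCompactSupport_pd j hc).mul_right
  · exact (hf.continuous.mul (continuous_pd j hg)).integrable_of_hasCompactSupport hc.mul_right
  · exact (hf.continuous.mul hg.continuous).integrable_of_hasCompactSupport hc.mul_right

theorem integral_lap_mul {θ f : Plane → ℝ} (hθ : ContDiff ℝ 2 θ) (hf : ContDiff ℝ 2 f)
    (hc : HasCompactSupport θ) : ∫ x, lap θ x * f x = ∫ x, θ x * lap f x := by
  have hj (j : Fin 2) : ∫ x, pd j (pd j θ) x * f x = ∫ x, θ x * pd j (pd j f) x := by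
    have h1 := integral_mul_pd j (contDiff_pd j hθ (by norm_num)) (hf.of_le one_le_two)
      (hasCompactSupport_pd j hc)
    have h2 := integral_mul_pd j (hθ.of_le one_le_two) (contDiff_pd j hf (m := 1) (by norm_num)) hc
    linarith
  have hi1 (j : Fin 2) : Integrable fun x => pd j (pd j θ) x * f x :=
    ((continuous_pd j (contDiff_pd j hθ (by norm_num))).mul
      hf.continuous).integrable_of_hasCompactSupport
      (hasCompactSupport_pd j (hasCompactSupport_pd j hc)).mul_right
  have hi2 (j : Fin 2) : Integrable fun x => θ x * pd j (pd j f) x :=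
    (hθ.continuous.mul (continuous_pd j
      (contDiff_pd j hf (by norm_num)))).integrable_of_hasCompactSupport hc.mul_right
  simp only [lap, add_mul, mul_add]
  rw [integral_add (hi1 0) (hi1 1), integral_add (hi2 0) (hi2 1), hj, hj]

theorem lap_sq_add_sq {p q : Plane → ℝ} (hp : ContDiff ℝ 2 p) (hq : ContDiff ℝ 2 q) (x : Plane) :
    lap (fun x => p x * p x + q x * q x) x =
      2 * (pd 0 p x ^ 2 + pd 1 p x ^ 2 + pd 0 q x ^ 2 + pd 1 q x ^ 2
        + p x * lap p x + q x * lap q x) := by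
  have hp1 := hp.of_le (m := 1) one_le_two
  have hq1 := hq.of_le (m := 1) one_le_two
  have h1 (j : Fin 2) : pd j (fun x => p x * p x + q x * q x) = fun x =>
      (p x * pd j p x + pd j p x * p x) + (q x * pd j q x + pd j q x * q x) := by
    funext x
    rw [pd_add j (hp1.mul hp1) (hq1.mul hq1), pd_mul j hp1 hp1, pd_mul j hq1 hq1]
  have hpj (j : Fin 2) : ContDiff ℝ 1 (pd j p) := contDiff_pd j hp (by norm_num)
  have hqj (j : Fin 2) : ContDiff ℝ 1 (pd j q) := contDiff_pd j hq (by norm_num)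
  have h2 (j : Fin 2) : pd j (pd j (fun x => p x * p x + q x * q x)) x =
      2 * (pd j p x ^ 2 + pd j q x ^ 2 + p x * pd j (pd j p) x + q x * pd j (pd j q) x) := by
    rw [h1, pd_add j ((hp1.mul (hpj j)).add ((hpj j).mul hp1))
        ((hq1.mul (hqj j)).add ((hqj j).mul hq1)),
      pd_add j (hp1.mul (hpj j)) ((hpj j).mul hp1), pd_add j (hq1.mul (hqj j)) ((hqj j).mul hq1),
      pd_mul j hp1 (hpj j), pd_mul j (hpj j) hp1, pd_mul j hq1 (hqj j), pd_mul j (hqj j) hq1]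
    ring
  rw [lap, h2, h2, lap, lap]
  ring

/-- The energy estimate for a solution `p + i q` of a magnetic Schrödinger equation
with right hand side `r₁ + i r₂`, localized by cut-off functions `η` and `θ`. -/
theorem abs_integral_le_of_equation {a : Fin 2 → Plane → ℝ} (ha : ∀ j, ContDiff ℝ 1 (a j))
    (hdiv : ∀ j x, pd j (a j) x = 0) {W p q r₁ r₂ η θ κ : Plane → ℝ} (hW : Continuous W) {x₀ y₀ s : ℝ}
    (hp : ContDiff ℝ 2 p) (hq : ContDiff ℝ 2 q)
    (h₁ : ∀ x, r₁ x = -lap p x + 2 * (a 0 x * pd 0 q x + a 1 x * pd 1 q x)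
      + (a 0 x ^ 2 + a 1 x ^ 2 + W x - x₀) * p x + y₀ * q x)
    (h₂ : ∀ x, r₂ x = -lap q x - 2 * (a 0 x * pd 0 p x + a 1 x * pd 1 p x)
      + (a 0 x ^ 2 + a 1 x ^ 2 + W x - x₀) * q x - y₀ * p x)
    (hη : ContDiff ℝ 1 η) (hηc : HasCompactSupport η) (hθ : ContDiff ℝ 2 θ)
    (hθc : HasCompactSupport θ) (hθ0 : ∀ x, 0 ≤ θ x) (hκ0 : ∀ x, 0 ≤ κ x)
    (hκ : ∀ x, pd 0 η x ^ 2 + pd 1 η x ^ 2 ≤ κ x * θ x)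
    (hκi : Integrable fun x => κ x * (p x * p x + q x * q x)) (hs : 0 < s) :
    |∫ x, η x * (y₀ * (p x * p x + q x * q x) + (p x * r₂ x - q x * r₁ x))| ≤
      s / 2 * (∫ x, ((1 / 2 * lap θ x - θ x * (W x - x₀)) * (p x * p x + q x * q x)
        + θ x * (p x * r₁ x + q x * r₂ x)))
      + 1 / (2 * s) * ∫ x, κ x * (p x * p x + q x * q x) := by
  have hp1 := hp.of_le (m := 1) one_le_two
  have hq1 := hq.of_le (m := 1) one_le_two
  have hpj (j : Fin 2) : ContDiff ℝ 1 (pd j p) := contDiff_pd j hp (by norm_num)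
  have hqj (j : Fin 2) : ContDiff ℝ 1 (pd j q) := contDiff_pd j hq (by norm_num)
  have cp := hp.continuous
  have cq := hq.continuous
  have cpj (j : Fin 2) := (hpj j).continuous
  have cqj (j : Fin 2) := (hqj j).continuous
  have ca (j : Fin 2) := (ha j).continuous
  have clp := continuous_lap hp
  have clq := continuous_lap hq
  have clθ := continuous_lap hθ
  have cη := hη.continuous
  have cθ := hθ.continuous
  have cr₁ : Continuous r₁ := by rw [funext h₁]; fun_prop
  have cr₂ : Continuous r₂ := by rw [funext h₂]; fun_prop
  -- With `ψ = p + i q`, this is the probability current `Im (conj ψ (∇ + i a) ψ)`. By the equation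
  -- its divergence is `-(y₀ |ψ|² + p r₂ - q r₁)`.
  let J : Fin 2 → Plane → ℝ := fun j x =>
    (p x * pd j q x - q x * pd j p x) + a j x * (p x * p x + q x * q x)
  have hJ (j : Fin 2) : ContDiff ℝ 1 (J j) :=
    ((hp1.mul (hqj j)).sub (hq1.mul (hpj j))).add ((ha j).mul ((hp1.mul hp1).add (hq1.mul hq1)))
  have hdJ (j : Fin 2) (x : Plane) : pd j (J j) x =
      p x * pd j (pd j q) x - q x * pd j (pd j p) x
        + 2 * a j x * (p x * pd j p x + q x * pd j q x) := by
    rw [pd_add j ((hp1.mul (hqj j)).sub (hq1.mul (hpj j)))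
        ((ha j).mul ((hp1.mul hp1).add (hq1.mul hq1))),
      pd_sub j (hp1.mul (hqj j)) (hq1.mul (hpj j)), pd_mul j hp1 (hqj j), pd_mul j hq1 (hpj j),
      pd_mul j (ha j) ((hp1.mul hp1).add (hq1.mul hq1)), pd_add j (hp1.mul hp1) (hq1.mul hq1),
      pd_mul j hp1 hp1, pd_mul j hq1 hq1, hdiv]
    ring
  -- The kinetic energy density `|(∇ + i a) ψ|²`.
  let D : Plane → ℝ := fun x => (pd 0 p x - a 0 x * q x) ^ 2 + (pd 1 p x - a 1 x * q x) ^ 2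
    + (pd 0 q x + a 0 x * p x) ^ 2 + (pd 1 q x + a 1 x * p x) ^ 2
  have cD : Continuous D := by
    have := cpj 0; have := cpj 1; have := cqj 0; have := cqj 1
    have := ca 0; have := ca 1
    fun_prop
  have hD0 (x : Plane) : 0 ≤ D x := by positivity
  have current : ∫ x, η x * (y₀ * (p x * p x + q x * q x) + (p x * r₂ x - q x * r₁ x)) =
      ∫ x, (pd 0 η x * J 0 x + pd 1 η x * J 1 x) := by
    have hib (j : Fin 2) := integral_mul_pd j hη (hJ j) hηc
    have hi1 (j : Fin 2) : Integrable fun x => pd j η x * J j x :=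
      ((continuous_pd j hη).mul (hJ j).continuous).integrable_of_hasCompactSupport
        (hasCompactSupport_pd j hηc).mul_right
    have hi2 (j : Fin 2) : Integrable fun x => η x * pd j (J j) x :=
      (cη.mul (continuous_pd j (hJ j))).integrable_of_hasCompactSupport hηc.mul_right
    have hpt (x : Plane) : η x * (y₀ * (p x * p x + q x * q x) + (p x * r₂ x - q x * r₁ x)) =
        -(η x * pd 0 (J 0) x + η x * pd 1 (J 1) x) := by
      rw [hdJ, hdJ, h₁, h₂, lap, lap]
      ring
    simp only [hpt]
    rw [integral_neg, integral_add (hi2 0) (hi2 1), integral_add (hi1 0) (hi1 1), hib, hib]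
    ring
  -- The equation gives `½ Δ|ψ|² = D - (p r₁ + q r₂) + (W - x₀) |ψ|²`; multiply by `θ` and move the
  -- Laplacian onto `θ`.
  have energy : ∫ x, ((1 / 2 * lap θ x - θ x * (W x - x₀)) * (p x * p x + q x * q x)
        + θ x * (p x * r₁ x + q x * r₂ x)) = ∫ x, θ x * D x := by
    have hl := integral_lap_mul hθ ((hp.mul hp).add (hq.mul hq)) hθc
    have hi1 : Integrable fun x => lap θ x * (p x * p x + q x * q x) :=
      (clθ.mul ((cp.mul cp).add (cq.mul cq))).integrable_of_hasCompactSupport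
        (hasCompactSupport_lap hθc).mul_right
    have hi2 : Integrable fun x => θ x * (p x * r₁ x + q x * r₂ x -
        (W x - x₀) * (p x * p x + q x * q x)) := by
      refine Continuous.integrable_of_hasCompactSupport ?_ hθc.mul_right
      fun_prop
    have hi3 : Integrable fun x => θ x * lap (fun x => p x * p x + q x * q x) x :=
      (cθ.mul (continuous_lap ((hp.mul hp).add (hq.mul hq)))).integrable_of_hasCompactSupport
        hθc.mul_right
    have e1 (x : Plane) : (1 / 2 * lap θ x - θ x * (W x - x₀)) * (p x * p x + q x * q x)
        + θ x * (p x * r₁ x + q x * r₂ x) = 1 / 2 * (lap θ x * (p x * p x + q x * q x))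
        + θ x * (p x * r₁ x + q x * r₂ x - (W x - x₀) * (p x * p x + q x * q x)) := by ring
    have e2 (x : Plane) : θ x * D x = 1 / 2 * (θ x * lap (fun x => p x * p x + q x * q x) x)
        + θ x * (p x * r₁ x + q x * r₂ x - (W x - x₀) * (p x * p x + q x * q x)) := by
      rw [lap_sq_add_sq hp hq, h₁, h₂]
      simp only [D]
      ring
    simp only [e1, e2]
    rw [integral_add (hi1.const_mul _) hi2, integral_add (hi3.const_mul _) hi2,
      integral_const_mul, integral_const_mul]
    rw [hl]
  rw [current, energy, ← integral_const_mul, ← integral_const_mul]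
  have hiD : Integrable fun x => θ x * D x :=
    (cθ.mul cD).integrable_of_hasCompactSupport hθc.mul_right
  rw [← integral_add (hiD.const_mul _) (hκi.const_mul _)]
  refine (abs_integral_le_integral_abs).trans (integral_mono_of_nonneg
    (Eventually.of_forall fun x => abs_nonneg _) ((hiD.const_mul _).add (hκi.const_mul _))
    (Eventually.of_forall fun x => ?_))
  set P : ℝ := p x * p x + q x * q x with hP
  have hP0 : 0 ≤ P := add_nonneg (mul_self_nonneg _) (mul_self_nonneg _)
  have hJD : J 0 x ^ 2 + J 1 x ^ 2 ≤ P * D x := by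
    have e1 (b c : ℝ) : (p x * c - q x * b) ^ 2 ≤ P * (b ^ 2 + c ^ 2) := by
      rw [hP]; nlinarith [sq_nonneg (p x * b + q x * c)]
    have e2 (j : Fin 2) :
        J j x = p x * (pd j q x + a j x * p x) - q x * (pd j p x - a j x * q x) := by
      simp only [J]; ring
    have := e1 (pd 0 p x - a 0 x * q x) (pd 0 q x + a 0 x * p x)
    have := e1 (pd 1 p x - a 1 x * q x) (pd 1 q x + a 1 x * p x)
    rw [e2, e2]
    simp only [D]
    linarith
  have hcs : (pd 0 η x * J 0 x + pd 1 η x * J 1 x) ^ 2 ≤ (κ x * P) * (θ x * D x) := by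
    calc (pd 0 η x * J 0 x + pd 1 η x * J 1 x) ^ 2
        ≤ (pd 0 η x ^ 2 + pd 1 η x ^ 2) * (J 0 x ^ 2 + J 1 x ^ 2) := by
          nlinarith [sq_nonneg (pd 0 η x * J 1 x - pd 1 η x * J 0 x)]
      _ ≤ (κ x * θ x) * (P * D x) := by
          gcongr
          · exact mul_nonneg (hκ0 x) (hθ0 x)
          · exact hκ x
      _ = _ := by ring
  have hκP : 0 ≤ κ x * P := mul_nonneg (hκ0 x) hP0
  have hθD : 0 ≤ θ x * D x := mul_nonneg (hθ0 x) (hD0 x)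
  -- The inequality between arithmetic and geometric means with weight `s`: `√(κ P · θ D) ≤ (s / 2)
  -- θ D + κ P / (2 s)`.
  refine abs_le_of_sq_le_sq ?_ (by positivity)
  refine hcs.trans ?_
  have : (s / 2 * (θ x * D x) + 1 / (2 * s) * (κ x * P)) ^ 2 =
      (s / 2 * (θ x * D x) - 1 / (2 * s) * (κ x * P)) ^ 2 + (κ x * P) * (θ x * D x) := by
    field_simp
    ring
  rw [this]
  exact le_add_of_nonneg_left (sq_nonneg _)

end Energy

/-! ### Convergence in the mean -/

section MeanConvergence

open scoped ENNReal

/-- Convergence in the mean of a sequence of square integrable functions. -/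
structure MeanTendsto (f : ℕ → Plane → ℝ) (g : Plane → ℝ) : Prop where
  memLp : ∀ n, MemLp (f n) 2 volume
  memLp_lim : MemLp g 2 volume
  tendsto : Tendsto (fun n => eLpNorm (f n - g) 2 volume) atTop (𝓝 0)

/-- Convergence of the integrals of a sequence of integrable functions. -/
structure IntegralTendsto (f : ℕ → Plane → ℝ) (g : Plane → ℝ) : Prop where
  integrable : ∀ n, Integrable (f n)
  integrable_lim : Integrable g
  tendsto : Tendsto (fun n => ∫ x, f n x) atTop (𝓝 (∫ x, g x))

theorem IntegralTendsto.add {f f' : ℕ → Plane → ℝ} {g g' : Plane → ℝ} (h : IntegralTendsto f g)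
    (h' : IntegralTendsto f' g') :
    IntegralTendsto (fun n x => f n x + f' n x) (fun x => g x + g' x) where
  integrable n := (h.integrable n).add (h'.integrable n)
  integrable_lim := h.integrable_lim.add h'.integrable_lim
  tendsto := by
    rw [integral_add h.integrable_lim h'.integrable_lim]
    simp only [integral_add (h.integrable _) (h'.integrable _)]
    exact h.tendsto.add h'.tendsto

theorem IntegralTendsto.const_mul {f : ℕ → Plane → ℝ} {g : Plane → ℝ} (h : IntegralTendsto f g)
    (c : ℝ) : IntegralTendsto (fun n x => c * f n x) (fun x => c * g x) where
  integrable n := (h.integrable n).const_mul c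
  integrable_lim := h.integrable_lim.const_mul c
  tendsto := by
    simp only [integral_const_mul]
    exact h.tendsto.const_mul c

theorem MeanTendsto.sub {f f' : ℕ → Plane → ℝ} {g g' : Plane → ℝ} (h : MeanTendsto f g)
    (h' : MeanTendsto f' g') :
    MeanTendsto (fun n x => f n x - f' n x) (fun x => g x - g' x) where
  memLp n := (h.memLp n).sub (h'.memLp n)
  memLp_lim := h.memLp_lim.sub h'.memLp_lim
  tendsto := by
    have h0 := h.tendsto.add h'.tendsto
    rw [add_zero] at h0
    refine tendsto_of_tendsto_of_tendsto_of_le_of_le tendsto_const_nhds h0 (fun _ => zero_le)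
      fun n => ?_
    have : (fun x => f n x - f' n x) - (fun x => g x - g' x) = (f n - g) - (f' n - g') := by
      funext x
      simp only [Pi.sub_apply]
      ring
    rw [this]
    exact eLpNorm_sub_le ((h.memLp n).sub h.memLp_lim).1 ((h'.memLp n).sub h'.memLp_lim).1
      (by norm_num)

theorem memLp_bdd_mul {k f : Plane → ℝ} (hk : AEStronglyMeasurable k volume) {C : ℝ}
    (hC : ∀ x, |k x| ≤ C) (hf : MemLp f 2 volume) : MemLp (fun x => k x * f x) 2 volume :=
  hf.of_le_mul (c := C) (hk.mul hf.1) (Eventually.of_forall fun x => by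
    rw [norm_mul, Real.norm_eq_abs]
    exact mul_le_mul_of_nonneg_right (hC x) (norm_nonneg _))

theorem MeanTendsto.bdd_mul {f : ℕ → Plane → ℝ} {g k : Plane → ℝ} (h : MeanTendsto f g)
    (hk : AEStronglyMeasurable k volume) {C : ℝ} (hC : ∀ x, |k x| ≤ C) :
    MeanTendsto (fun n x => k x * f n x) (fun x => k x * g x) where
  memLp n := memLp_bdd_mul hk hC (h.memLp n)
  memLp_lim := memLp_bdd_mul hk hC h.memLp_lim
  tendsto := by
    have h0 := ENNReal.Tendsto.const_mul (a := ENNReal.ofReal C) h.tendsto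
      (Or.inr ENNReal.ofReal_ne_top)
    rw [mul_zero] at h0
    refine tendsto_of_tendsto_of_tendsto_of_le_of_le tendsto_const_nhds h0 (fun _ => zero_le)
      fun n => ?_
    refine eLpNorm_le_mul_eLpNorm_of_ae_le_mul (Eventually.of_forall fun x => ?_) 2
    simp only [Pi.sub_apply, ← mul_sub, norm_mul, Real.norm_eq_abs]
    exact mul_le_mul_of_nonneg_right (hC x) (abs_nonneg _)

theorem MeanTendsto.mul {f f' : ℕ → Plane → ℝ} {g g' : Plane → ℝ} (h : MeanTendsto f g)
    (h' : MeanTendsto f' g') :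
    IntegralTendsto (fun n x => f n x * f' n x) (fun x => g x * g' x) where
  integrable n := (h.memLp n).integrable_mul (h'.memLp n)
  integrable_lim := h.memLp_lim.integrable_mul h'.memLp_lim
  tendsto := by
    have key {u v : Plane → ℝ} (hu : MemLp u 2 volume) (hv : MemLp v 2 volume) :
        ∫ x, u x * v x = inner ℝ (hu.toLp u) (hv.toLp v) := by
      rw [L2.inner_def]
      refine integral_congr_ae ?_
      filter_upwards [hu.coeFn_toLp, hv.coeFn_toLp] with x h1 h2
      rw [h1, h2]
      simp [mul_comm]
    have hl {u : ℕ → Plane → ℝ} {v : Plane → ℝ} (hu : MeanTendsto u v) :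
        Tendsto (fun n => (hu.memLp n).toLp (u n)) atTop (𝓝 (hu.memLp_lim.toLp v)) :=
      (Lp.tendsto_Lp_iff_tendsto_eLpNorm'' _ _ _ _).2 hu.tendsto
    rw [key h.memLp_lim h'.memLp_lim]
    simp only [key (h.memLp _) (h'.memLp _)]
    exact (hl h).inner (hl h')

/-- The radii of a sequence of mollifiers. -/
def radius (n : ℕ) : ℝ := 1 / ((n : ℝ) + 1)

theorem radius_pos (n : ℕ) : 0 < radius n := Nat.one_div_pos_of_nat

theorem radius_le_one (n : ℕ) : radius n ≤ 1 := by
  rw [radius, div_le_one (by positivity)]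
  linarith [Nat.cast_nonneg (α := ℝ) n]

theorem meanTendsto_mollify {f : Plane → ℝ} (hf : MemLp f 2 volume) :
    MeanTendsto (fun n => mollify (radius n) f) f where
  memLp n := memLp_mollify hf (radius_pos n)
  memLp_lim := hf
  tendsto := (tendsto_eLpNorm_mollify_sub hf).comp (tendsto_nhdsWithin_iff.2
    ⟨tendsto_one_div_add_atTop_nhds_zero_nat, Eventually.of_forall radius_pos⟩)

theorem exists_abs_le_of_hasCompactSupport {k : Plane → ℝ} (hk : Continuous k)
    (hc : HasCompactSupport k) : ∃ C, ∀ x, |k x| ≤ C :=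
  hk.bounded_above_of_compact_support hc

/-- Multiplication by a continuous function and mollification commute up to an error that
tends locally to zero in the mean. -/
theorem meanTendsto_mollify_commutator {w Q k : Plane → ℝ} (hw : MemLp w 2 volume)
    (hQ : Continuous Q) (hk : Continuous k) (hc : HasCompactSupport k) :
    MeanTendsto (fun n x => k x * (Q x * mollify (radius n) w x
      - mollify (radius n) (fun y => Q y * w y) x)) (fun _ => 0) := by
  obtain ⟨R, hR⟩ := hc.isCompact.isBounded.subset_closedBall (0 : Plane)
  -- On the support of `k`, mollifiers of radius at most `1` see `Q` only on `K`. Truncating `Q` to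
  -- `K` makes it bounded, and then both products converge to `k Q w`.
  set K : Set Plane := Metric.closedBall 0 (R + 1) with hK
  obtain ⟨C, hC⟩ := (isCompact_closedBall (0 : Plane) (R + 1)).exists_bound_of_continuousOn
    hQ.continuousOn
  have hC' (x : Plane) : |K.indicator Q x| ≤ max C 0 := by
    by_cases hx : x ∈ K
    · rw [Set.indicator_of_mem hx]
      exact (hC x hx).trans (le_max_left _ _)
    · rw [Set.indicator_of_notMem hx, abs_zero]
      exact le_max_right _ _
  have hQm : AEStronglyMeasurable (K.indicator Q) volume :=
    (hQ.stronglyMeasurable.indicator Metric.isClosed_closedBall.measurableSet).aestronglyMeasurable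
  have hg : MemLp (fun x => K.indicator Q x * w x) 2 volume := memLp_bdd_mul hQm hC' hw
  obtain ⟨C₁, hC₁⟩ := exists_abs_le_of_hasCompactSupport hk hc
  obtain ⟨C₂, hC₂⟩ := exists_abs_le_of_hasCompactSupport (hk.mul hQ) hc.mul_right
  have h := ((meanTendsto_mollify hw).bdd_mul (hk.mul hQ).aestronglyMeasurable hC₂).sub
    ((meanTendsto_mollify hg).bdd_mul hk.aestronglyMeasurable hC₁)
  have hzero (x : Plane) (hx : x ∉ Metric.closedBall (0 : Plane) R) : k x = 0 :=
    image_eq_zero_of_notMem_tsupport fun h => hx (hR h)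
  convert h using 1
  · funext n x
    rw [Pi.mul_apply, mul_sub, mul_assoc]
    congr 1
    by_cases hx : x ∈ Metric.closedBall (0 : Plane) R
    · congr 1
      rw [mollify_apply, mollify_apply]
      congr 1
      funext y
      by_cases hy : mollifier (radius n) (x - y) = 0
      · simp [hy]
      · have h1 := mem_ball_zero_iff.1 (support_mollifier_subset (radius_pos n) hy)
        have h2 := mem_closedBall_zero_iff.1 hx
        have h3 : ‖y‖ ≤ ‖x‖ + ‖x - y‖ := by
          have := norm_sub_le x (x - y)
          rwa [sub_sub_cancel] at this
        have h4 : y ∈ K := by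
          rw [hK, mem_closedBall_zero_iff]
          linarith [radius_le_one n]
        rw [Set.indicator_of_mem h4]
    · rw [hzero x hx, zero_mul, zero_mul]
  · funext x
    by_cases hx : x ∈ Metric.closedBall (0 : Plane) R
    · have : x ∈ K := Metric.closedBall_subset_closedBall (by linarith) hx
      simp only [Pi.mul_apply, Set.indicator_of_mem this]
      ring
    · simp only [Pi.mul_apply, hzero x hx]
      ring

end MeanConvergence

/-! ### Square integrable weak solutions vanish -/

section WeakSolutions

open ContinuousLinearMap (lsmul)
open scoped Convolution

/-- The symmetric gauge of the constant magnetic field `B`. -/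
def symGauge (B : ℝ) (x : Plane) : Plane := !₂[-(B / 2 * x 1), B / 2 * x 0]

theorem contDiff_symGauge_apply (B : ℝ) (j : Fin 2) {n : WithTop ℕ∞} :
    ContDiff ℝ n (fun x => symGauge B x j) := by
  have h (i : Fin 2) : ContDiff ℝ n (fun x : Plane => x i) :=
    (EuclideanSpace.proj (𝕜 := ℝ) i).contDiff
  fin_cases j
  · exact (contDiff_const.mul (h 1)).neg
  · exact contDiff_const.mul (h 0)

theorem contDiff_symGauge (B : ℝ) {n : WithTop ℕ∞} : ContDiff ℝ n (symGauge B) :=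
  contDiff_euclidean.2 fun j => contDiff_symGauge_apply B j

theorem hasFDerivAt_symGauge_apply (B : ℝ) (x : Plane) :
    HasFDerivAt (fun x => symGauge B x 0) (-((B / 2) • EuclideanSpace.proj (𝕜 := ℝ) (1 : Fin 2))) x ∧
    HasFDerivAt (fun x => symGauge B x 1) ((B / 2) • EuclideanSpace.proj (𝕜 := ℝ) (0 : Fin 2)) x :=
  ⟨((EuclideanSpace.proj (𝕜 := ℝ) (1 : Fin 2)).hasFDerivAt.const_mul (B / 2)).neg,
    (EuclideanSpace.proj (𝕜 := ℝ) (0 : Fin 2)).hasFDerivAt.const_mul (B / 2)⟩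

theorem fderiv_symGauge_apply (B : ℝ) (x v : Plane) (j : Fin 2) :
    fderiv ℝ (fun x => symGauge B x j) x v = symGauge B v j := by
  fin_cases j
  · change fderiv ℝ (fun x => symGauge B x 0) x v = symGauge B v 0
    rw [(hasFDerivAt_symGauge_apply B x).1.fderiv]
    simp [symGauge]
  · change fderiv ℝ (fun x => symGauge B x 1) x v = symGauge B v 1
    rw [(hasFDerivAt_symGauge_apply B x).2.fderiv]
    simp [symGauge]

theorem pd_symGauge (B : ℝ) (j : Fin 2) (x : Plane) : pd j (fun x => symGauge B x j) x = 0 := by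
  rw [pd, fderiv_symGauge_apply]
  fin_cases j <;> simp [symGauge, e]

theorem fderiv_symGauge (B : ℝ) (x v : Plane) (j : Fin 2) :
    fderiv ℝ (symGauge B) x v j = symGauge B v j := by
  rw [← fderiv_symGauge_apply B x v j]
  have h := ((EuclideanSpace.proj (𝕜 := ℝ) j).hasFDerivAt.comp x
    ((contDiff_symGauge B (n := 1)).differentiable one_ne_zero x).hasFDerivAt)
  have h' : HasFDerivAt (fun x => symGauge B x j) _ x := h
  rw [h'.fderiv]
  rfl

theorem curl_symGauge (B : ℝ) (x : Plane) : curl (symGauge B) x = B := by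
  rw [curl, fderiv_symGauge, fderiv_symGauge]
  simp [symGauge, e]

/-- The angular derivative of the mollifier vanishes. -/
theorem symGauge_mul_pd_mollifier (B ε : ℝ) (x y : Plane) :
    symGauge B y 0 * pd 0 (mollifier ε) (x - y) + symGauge B y 1 * pd 1 (mollifier ε) (x - y) =
    symGauge B x 0 * pd 0 (mollifier ε) (x - y) + symGauge B x 1 * pd 1 (mollifier ε) (x - y) := by
  -- The symmetric gauge at `x - y` is orthogonal to `x - y`, and it is linear, so it equals the
  -- difference of its values at `x` and `y`.
  have h1 : inner ℝ (x - y) (symGauge B (x - y)) = 0 := by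
    simp [PiLp.inner_apply, symGauge, Fin.sum_univ_two]
    ring
  have h2 := fderiv_mollifier_of_inner_eq_zero ε h1
  have hdec : symGauge B (x - y) = (symGauge B x 0 - symGauge B y 0) • e 0 +
      (symGauge B x 1 - symGauge B y 1) • e 1 := by
    ext j; fin_cases j <;> simp [e, symGauge] <;> ring
  rw [hdec, map_add, map_smul, map_smul, smul_eq_mul, smul_eq_mul] at h2
  simp only [pd]
  linarith

theorem pd_mollify {ε : ℝ} (hε : 0 < ε) {w : Plane → ℝ} (hw : LocallyIntegrable w) (j : Fin 2)
    (x : Plane) : pd j (mollify ε w) x = ∫ y, pd j (mollifier ε) (x - y) * w y := by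
  rw [pd, mollify, fderiv_convolution_apply ((contDiff_mollifier ε).of_le (by norm_cast))
    (hasCompactSupport_mollifier hε) hw, convolution_eq_swap]
  rfl

theorem pd_pd_mollify {ε : ℝ} (hε : 0 < ε) {w : Plane → ℝ} (hw : LocallyIntegrable w) (j : Fin 2)
    (x : Plane) : pd j (pd j (mollify ε w)) x =
      ∫ y, pd j (pd j (mollifier ε)) (x - y) * w y := by
  have h1 : pd j (mollify ε w) = (pd j (mollifier ε)) ⋆[lsmul ℝ ℝ, volume] w := by
    funext x
    rw [pd_mollify hε hw, convolution_eq_swap]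
    rfl
  rw [pd, h1, fderiv_convolution_apply (contDiff_pd j (contDiff_mollifier ε) (by norm_cast))
    (hasCompactSupport_pd j (hasCompactSupport_mollifier hε)) hw, convolution_eq_swap]
  rfl

theorem pd_comp_sub (j : Fin 2) {f : Plane → ℝ} (hf : ContDiff ℝ 1 f) (x y : Plane) :
    pd j (fun y => f (x - y)) y = -pd j f (x - y) := by
  have h : HasFDerivAt (fun y => f (x - y)) _ y :=
    (hf.differentiable one_ne_zero (x - y)).hasFDerivAt.comp y ((hasFDerivAt_id y).const_sub x)
  simp [pd, h.fderiv]

theorem integral_combination {f₁ f₂ f₃ f₄ f₅ f₆ : Plane → ℝ} (h₁ : Integrable f₁)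
    (h₂ : Integrable f₂) (h₃ : Integrable f₃) (h₄ : Integrable f₄) (h₅ : Integrable f₅)
    (h₆ : Integrable f₆) (a b c : ℝ) :
    ∫ y, (-f₁ y - f₂ y + (a * f₃ y + b * f₄ y) + f₅ y + c * f₆ y) =
      -(∫ y, f₁ y) - (∫ y, f₂ y) + (a * (∫ y, f₃ y) + b * ∫ y, f₄ y) + (∫ y, f₅ y)
        + c * ∫ y, f₆ y := by
  have j₁ : Integrable fun y => -f₁ y := h₁.neg
  have j₂ : Integrable fun y => -f₁ y - f₂ y := j₁.sub h₂
  have j₃ : Integrable fun y => a * f₃ y + b * f₄ y := (h₃.const_mul a).add (h₄.const_mul b)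
  have j₄ : Integrable fun y => -f₁ y - f₂ y + (a * f₃ y + b * f₄ y) := j₂.add j₃
  have j₅ : Integrable fun y => -f₁ y - f₂ y + (a * f₃ y + b * f₄ y) + f₅ y := j₄.add h₅
  rw [integral_add j₅ (h₆.const_mul c), integral_add j₄ h₅, integral_add j₂ j₃,
    integral_sub j₁ h₂, integral_add (h₃.const_mul a) (h₄.const_mul b), integral_neg,
    integral_const_mul, integral_const_mul, integral_const_mul]

/-- The real part of the weak form of the equation `((-i∇ + a)² + W - x₀ - i y₀) (u + i v) = 0` in
the symmetric gauge `a`. -/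
def IsWeakSolution (B x₀ y₀ : ℝ) (W u v : Plane → ℝ) : Prop :=
  ∀ g : Plane → ℝ, ContDiff ℝ ∞ g → HasCompactSupport g →
    ∫ x, (-lap g x * u x - 2 * (symGauge B x 0 * pd 0 g x + symGauge B x 1 * pd 1 g x) * v x
      + g x * ((symGauge B x 0 ^ 2 + symGauge B x 1 ^ 2 + W x - x₀) * u x) + y₀ * (g x * v x)) = 0

/-- Mollifications of a weak solution solve the equation up to a commutator. -/
theorem mollify_equation {B x₀ y₀ ε : ℝ} (hε : 0 < ε) {W u v : Plane → ℝ} (hW : Continuous W)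
    (hu : LocallyIntegrable u) (hv : LocallyIntegrable v)
    (h : IsWeakSolution B x₀ y₀ W u v) (x : Plane) :
    -lap (mollify ε u) x + 2 * (symGauge B x 0 * pd 0 (mollify ε v) x
      + symGauge B x 1 * pd 1 (mollify ε v) x)
      + mollify ε (fun y => (symGauge B y 0 ^ 2 + symGauge B y 1 ^ 2 + W y - x₀) * u y) x
      + y₀ * mollify ε v x = 0 := by
  have hρ := contDiff_mollifier ε
  have hρc := hasCompactSupport_mollifier hε
  have hg : ContDiff ℝ ∞ (fun y => mollifier ε (x - y)) := hρ.comp (contDiff_const.sub contDiff_id)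
  have hcs {k : Plane → ℝ} (hk : HasCompactSupport k) : HasCompactSupport fun y => k (x - y) :=
    hk.comp_homeomorph (Homeomorph.subLeft x)
  -- The weak equation is tested with the reflected and translated kernel `y ↦ mollifier ε (x - y)`.
  have h0 := h _ hg (hcs hρc)
  have hpd (j : Fin 2) : pd j (fun y => mollifier ε (x - y)) =
      fun y => -pd j (mollifier ε) (x - y) := funext fun y => pd_comp_sub j (hρ.of_le (by norm_cast)) x y
  have hpd2 (j : Fin 2) (y : Plane) : pd j (pd j (fun y => mollifier ε (x - y))) y =
      pd j (pd j (mollifier ε)) (x - y) := by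
    rw [hpd]
    have h1 : pd j (fun y => -pd j (mollifier ε) (x - y)) y
        = -pd j (fun y => pd j (mollifier ε) (x - y)) y := by
      simp [pd, fderiv_fun_neg]
    rw [h1, pd_comp_sub j (contDiff_pd j hρ (by norm_cast)), neg_neg]
  have hint {k f : Plane → ℝ} (hk : Continuous k) (hkc : HasCompactSupport k)
      (hf : LocallyIntegrable f) : Integrable fun y => k (x - y) * f y :=
    hf.integrable_smul_left_of_hasCompactSupport (g := fun y => k (x - y))
      (hk.comp (continuous_const.sub continuous_id)) (hcs hkc)
  have hpj (j : Fin 2) : ContDiff ℝ ∞ (pd j (mollifier ε)) := contDiff_pd j hρ (by norm_cast)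
  have hpjc (j : Fin 2) := hasCompactSupport_pd j hρc
  have hQ : Continuous fun y => symGauge B y 0 ^ 2 + symGauge B y 1 ^ 2 + W y - x₀ :=
    ((((contDiff_symGauge_apply B 0 (n := 0)).continuous.pow 2).add
      ((contDiff_symGauge_apply B 1 (n := 0)).continuous.pow 2)).add hW).sub continuous_const
  have hQu : LocallyIntegrable fun y =>
      (symGauge B y 0 ^ 2 + symGauge B y 1 ^ 2 + W y - x₀) * u y :=
    hu.continuous_smul hQ
  have i1 (j : Fin 2) : Integrable fun y => pd j (pd j (mollifier ε)) (x - y) * u y :=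
    hint (continuous_pd j ((hpj j).of_le (by norm_cast))) (hasCompactSupport_pd j (hpjc j)) hu
  have i2 (j : Fin 2) : Integrable fun y => pd j (mollifier ε) (x - y) * v y :=
    hint (hpj j).continuous (hpjc j) hv
  have i3 := hint hρ.continuous hρc hQu
  have i4 := hint hρ.continuous hρc hv
  have hpt (y : Plane) : -lap (fun y => mollifier ε (x - y)) y * u y
      - 2 * (symGauge B y 0 * pd 0 (fun y => mollifier ε (x - y)) y
        + symGauge B y 1 * pd 1 (fun y => mollifier ε (x - y)) y) * v y
      + mollifier ε (x - y) * ((symGauge B y 0 ^ 2 + symGauge B y 1 ^ 2 + W y - x₀) * u y)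
      + y₀ * (mollifier ε (x - y) * v y) =
      -(pd 0 (pd 0 (mollifier ε)) (x - y) * u y) - pd 1 (pd 1 (mollifier ε)) (x - y) * u y
      + (2 * symGauge B x 0 * (pd 0 (mollifier ε) (x - y) * v y)
        + 2 * symGauge B x 1 * (pd 1 (mollifier ε) (x - y) * v y))
      + mollifier ε (x - y) * ((symGauge B y 0 ^ 2 + symGauge B y 1 ^ 2 + W y - x₀) * u y)
      + y₀ * (mollifier ε (x - y) * v y) := by
    rw [lap, hpd2, hpd2, hpd, hpd]
    -- Radiality is used here: the vector potential at `y` may be replaced by its value at `x`, so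
    -- the first order term leaves no commutator.
    linear_combination 2 * v y * symGauge_mul_pd_mollifier B ε x y
  simp only [hpt] at h0
  rw [integral_combination (i1 0) (i1 1) (i2 0) (i2 1) i3 i4] at h0
  rw [lap, pd_pd_mollify hε hu, pd_pd_mollify hε hu, pd_mollify hε hv, pd_mollify hε hv,
    mollify_apply, mollify_apply]
  simp only [smul_eq_mul]
  linarith

end WeakSolutions

/-! ### Uniqueness for square integrable weak solutions. -/

section Uniqueness

theorem continuous_symGauge_potential (B x₀ : ℝ) {W : Plane → ℝ} (hW : Continuous W) :
    Continuous fun y => symGauge B y 0 ^ 2 + symGauge B y 1 ^ 2 + W y - x₀ :=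
  ((((contDiff_symGauge_apply B 0 (n := 0)).continuous.pow 2).add
    ((contDiff_symGauge_apply B 1 (n := 0)).continuous.pow 2)).add hW).sub continuous_const

theorem mollify_neg (ε : ℝ) (w : Plane → ℝ) :
    mollify ε (fun y => -w y) = fun x => -mollify ε w x := by
  funext x
  simp only [mollify_apply, smul_neg, integral_neg]

theorem pd_neg (j : Fin 2) (f : Plane → ℝ) (x : Plane) : pd j (fun y => -f y) x = -pd j f x := by
  simp [pd, fderiv_fun_neg]

/-- The local energy estimate for square integrable weak solutions. -/
theorem abs_integral_le_of_weak {B x₀ y₀ s Cκ : ℝ} {W u v η θ κ : Plane → ℝ} (hW : Continuous W)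
    (hu : MemLp u 2 volume) (hv : MemLp v 2 volume) (h₁ : IsWeakSolution B x₀ y₀ W u v)
    (h₂ : IsWeakSolution B x₀ y₀ W v (fun x => -u x))
    (hη : ContDiff ℝ 1 η) (hηc : HasCompactSupport η) (hθ : ContDiff ℝ 2 θ)
    (hθc : HasCompactSupport θ) (hθ0 : ∀ x, 0 ≤ θ x) (hκ0 : ∀ x, 0 ≤ κ x) (hκC : ∀ x, κ x ≤ Cκ)
    (hκm : AEStronglyMeasurable κ volume)
    (hκ : ∀ x, pd 0 η x ^ 2 + pd 1 η x ^ 2 ≤ κ x * θ x) (hs : 0 < s) :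
    |y₀ * ∫ x, η x * (u x ^ 2 + v x ^ 2)| ≤
      s / 2 * (∫ x, (1 / 2 * lap θ x - θ x * (W x - x₀)) * (u x ^ 2 + v x ^ 2))
      + 1 / (2 * s) * ∫ x, κ x * (u x ^ 2 + v x ^ 2) := by
  have hul : LocallyIntegrable u := hu.locallyIntegrable (by norm_num)
  have hvl : LocallyIntegrable v := hv.locallyIntegrable (by norm_num)
  let Q : Plane → ℝ := fun y => symGauge B y 0 ^ 2 + symGauge B y 1 ^ 2 + W y - x₀
  have hQ : Continuous Q := continuous_symGauge_potential B x₀ hW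
  let p : ℕ → Plane → ℝ := fun n => mollify (radius n) u
  let q : ℕ → Plane → ℝ := fun n => mollify (radius n) v
  have hp (n : ℕ) : ContDiff ℝ 2 (p n) :=
    (contDiff_mollify (radius_pos n) hul).of_le (by norm_cast)
  have hq (n : ℕ) : ContDiff ℝ 2 (q n) :=
    (contDiff_mollify (radius_pos n) hvl).of_le (by norm_cast)
  have tp : MeanTendsto p u := meanTendsto_mollify hu
  have tq : MeanTendsto q v := meanTendsto_mollify hv
  -- The right hand sides for the mollified functions are commutators of mollification with `Q`;
  -- multiplied by a cut-off they vanish in the mean.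
  let r₁ : ℕ → Plane → ℝ := fun n x => Q x * p n x - mollify (radius n) (fun y => Q y * u y) x
  let r₂ : ℕ → Plane → ℝ := fun n x => Q x * q n x - mollify (radius n) (fun y => Q y * v y) x
  have e₁ (n : ℕ) (x : Plane) : r₁ n x = -lap (p n) x
      + 2 * (symGauge B x 0 * pd 0 (q n) x + symGauge B x 1 * pd 1 (q n) x)
      + (symGauge B x 0 ^ 2 + symGauge B x 1 ^ 2 + W x - x₀) * p n x + y₀ * q n x := by
    have := mollify_equation (radius_pos n) hW hul hvl h₁ x
    simp only [r₁, p, q, Q]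
    linarith
  have e₂ (n : ℕ) (x : Plane) : r₂ n x = -lap (q n) x
      - 2 * (symGauge B x 0 * pd 0 (p n) x + symGauge B x 1 * pd 1 (p n) x)
      + (symGauge B x 0 ^ 2 + symGauge B x 1 ^ 2 + W x - x₀) * q n x - y₀ * p n x := by
    -- `h₂` is the weak equation for `-i (u + i v) = v - i u`, that is, the imaginary part of the
    -- original one.
    have := mollify_equation (radius_pos n) hW hvl hul.neg h₂ x
    have hneg : mollify (radius n) (-u) = fun x => -mollify (radius n) u x :=
      mollify_neg _ _
    rw [hneg, pd_neg, pd_neg] at this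
    simp only [r₂, p, q, Q]
    linarith
  have energy (n : ℕ) := abs_integral_le_of_equation (a := fun j x => symGauge B x j)
    (fun j => contDiff_symGauge_apply B j) (fun j x => pd_symGauge B j x) hW (hp n) (hq n)
    (e₁ n) (e₂ n) hη hηc hθ hθc hθ0 hκ0 hκ (y₀ := y₀) (x₀ := x₀) (s := s)
  have t₁ {k : Plane → ℝ} (hk : Continuous k) (hc : HasCompactSupport k) :
      MeanTendsto (fun n x => k x * r₁ n x) (fun _ => 0) :=
    meanTendsto_mollify_commutator hu hQ hk hc
  have t₂ {k : Plane → ℝ} (hk : Continuous k) (hc : HasCompactSupport k) :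
      MeanTendsto (fun n x => k x * r₂ n x) (fun _ => 0) :=
    meanTendsto_mollify_commutator hv hQ hk hc
  have tP {k : Plane → ℝ} (hk : AEStronglyMeasurable k volume) {C : ℝ} (hC : ∀ x, |k x| ≤ C) :
      IntegralTendsto (fun n x => k x * (p n x * p n x + q n x * q n x))
        (fun x => k x * (u x ^ 2 + v x ^ 2)) := by
    have := ((tp.bdd_mul hk hC).mul tp).add ((tq.bdd_mul hk hC).mul tq)
    convert this using 1
    · funext n x; ring
    · funext x; ring
  obtain ⟨C₁, hC₁⟩ := exists_abs_le_of_hasCompactSupport hη.continuous hηc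
  have hG : Continuous fun x => 1 / 2 * lap θ x - θ x * (W x - x₀) :=
    (continuous_const.mul (continuous_lap hθ)).sub
      (hθ.continuous.mul (hW.sub continuous_const))
  have hGc : HasCompactSupport fun x => 1 / 2 * lap θ x - θ x * (W x - x₀) :=
    ((hasCompactSupport_lap hθc).mul_left (f := fun _ => 1 / 2)).sub
      (hθc.mul_right (f' := fun x => W x - x₀))
  obtain ⟨C₂, hC₂⟩ := exists_abs_le_of_hasCompactSupport hG hGc
  have hκabs (x : Plane) : |κ x| ≤ Cκ := by rw [abs_of_nonneg (hκ0 x)]; exact hκC x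
  have T₁ : IntegralTendsto (fun n x => η x * (y₀ * (p n x * p n x + q n x * q n x)
      + (p n x * r₂ n x - q n x * r₁ n x))) (fun x => y₀ * (η x * (u x ^ 2 + v x ^ 2))) := by
    have := ((tP hη.continuous.aestronglyMeasurable hC₁).const_mul y₀).add
      (((t₂ hη.continuous hηc).mul tp).add (((t₁ hη.continuous hηc).mul tq).const_mul (-1)))
    convert this using 1
    · funext n x; ring
    · funext x; ring
  have T₂ : IntegralTendsto (fun n x => (1 / 2 * lap θ x - θ x * (W x - x₀)) *
      (p n x * p n x + q n x * q n x) + θ x * (p n x * r₁ n x + q n x * r₂ n x))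
      (fun x => (1 / 2 * lap θ x - θ x * (W x - x₀)) * (u x ^ 2 + v x ^ 2)) := by
    have := (tP hG.aestronglyMeasurable hC₂).add
      (((t₁ hθ.continuous hθc).mul tp).add ((t₂ hθ.continuous hθc).mul tq))
    convert this using 1
    · funext n x; ring
    · funext x; ring
  have T₃ := tP hκm hκabs
  have hlim := le_of_tendsto_of_tendsto' T₁.tendsto.abs
    ((T₂.tendsto.const_mul (s / 2)).add (T₃.tendsto.const_mul (1 / (2 * s))))
    fun n => energy n (T₃.integrable n) hs
  rwa [integral_const_mul] at hlim

theorem pd_comp_smul (j : Fin 2) {f : Plane → ℝ} (hf : ContDiff ℝ 1 f) (c : ℝ) (x : Plane) :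
    pd j (fun y => f (c • y)) x = c * pd j f (c • x) := by
  have h : HasFDerivAt (fun y => f (c • y)) _ x :=
    (hf.differentiable one_ne_zero (c • x)).hasFDerivAt.comp x ((hasFDerivAt_id x).const_smul c)
  simp [pd, h.fderiv]

theorem lap_comp_smul {f : Plane → ℝ} (hf : ContDiff ℝ 2 f) (c : ℝ) (x : Plane) :
    lap (fun y => f (c • y)) x = c ^ 2 * lap f (c • x) := by
  have h (j : Fin 2) : pd j (pd j fun y => f (c • y)) x = c ^ 2 * pd j (pd j f) (c • x) := by
    rw [funext (pd_comp_smul j (hf.of_le one_le_two) c)]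
    have h1 : ContDiff ℝ 1 (pd j f) := contDiff_pd j hf (by norm_num)
    have h2 : pd j (fun y => c * pd j f (c • y)) x = c * pd j (fun y => pd j f (c • y)) x := by
      simp only [pd]
      have hd : DifferentiableAt ℝ (fun y => (fderiv ℝ f (c • y)) (e j)) x :=
        (h1.comp (contDiff_const_smul c)).differentiable one_ne_zero x
      rw [fderiv_const_mul hd]
      rfl
    rw [h2, pd_comp_smul j h1]
    ring
  rw [lap, h, h, lap]
  ring

theorem pd_const_mul (j : Fin 2) {f : Plane → ℝ} (hf : ContDiff ℝ 1 f) (c : ℝ) (x : Plane) :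
    pd j (fun y => c * f y) x = c * pd j f x := by
  simp only [pd]
  rw [fderiv_const_mul (hf.differentiable one_ne_zero x)]
  rfl

theorem lap_const_mul {f : Plane → ℝ} (hf : ContDiff ℝ 2 f) (c : ℝ) (x : Plane) :
    lap (fun y => c * f y) x = c * lap f x := by
  have h (j : Fin 2) : pd j (pd j fun y => c * f y) x = c * pd j (pd j f) x := by
    rw [funext (pd_const_mul j (hf.of_le one_le_two) c),
      pd_const_mul j (contDiff_pd j hf (by norm_num))]
  rw [lap, h, h, lap]
  ring

/-- The energy estimate on balls of radius `R`, with constants independent of `R`. -/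
theorem exists_abs_integral_le_of_weak {B x₀ y₀ c d : ℝ} {W u v : Plane → ℝ} (hW : Continuous W)
    (hc : 0 < c) (hWd : ∀ x, -c * ‖x‖ ^ 2 + d ≤ W x)
    (hu : MemLp u 2 volume) (hv : MemLp v 2 volume) (h₁ : IsWeakSolution B x₀ y₀ W u v)
    (h₂ : IsWeakSolution B x₀ y₀ W v (fun x => -u x)) :
    ∃ C, ∀ R : ℝ, 1 ≤ R → ∀ s : ℝ, 0 < s →
      |y₀| * (∫ x in Metric.closedBall (0 : Plane) R, (u x ^ 2 + v x ^ 2)) ≤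
        s * C * (∫ x, (u x ^ 2 + v x ^ 2))
        + C / s * ∫ x in (Metric.ball (0 : Plane) R)ᶜ, (u x ^ 2 + v x ^ 2) := by
  -- The gradient of `β` lives where `1 ≤ ‖x‖ ≤ 2`, and there `ξ = 1`; after rescaling, `θ` equals
  -- `R⁻²` wherever `η` varies.
  let β : ContDiffBump (0 : Plane) := ⟨1, 2, one_pos, one_lt_two⟩
  let ξ : ContDiffBump (0 : Plane) := ⟨2, 3, two_pos, by norm_num⟩
  have hβ : ContDiff ℝ 2 β := β.contDiff
  have hξ : ContDiff ℝ 2 ξ := ξ.contDiff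
  obtain ⟨b₀, hb₀⟩ := exists_abs_le_of_hasCompactSupport (continuous_pd 0 (hβ.of_le one_le_two))
    (hasCompactSupport_pd 0 β.hasCompactSupport)
  obtain ⟨b₁, hb₁⟩ := exists_abs_le_of_hasCompactSupport (continuous_pd 1 (hβ.of_le one_le_two))
    (hasCompactSupport_pd 1 β.hasCompactSupport)
  obtain ⟨l, hl⟩ := exists_abs_le_of_hasCompactSupport (continuous_lap hξ)
    (hasCompactSupport_lap ξ.hasCompactSupport)
  have hl0 : 0 ≤ l := (abs_nonneg _).trans (hl 0)
  set C₁ : ℝ := b₀ ^ 2 + b₁ ^ 2 with hC₁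
  have hC₁0 : 0 ≤ C₁ := by positivity
  set C₂ : ℝ := l + 9 * c + |d| + |x₀| with hC₂
  have hC₂0 : 0 ≤ C₂ := by positivity
  have hPi : Integrable fun x => u x ^ 2 + v x ^ 2 := hu.integrable_sq.add hv.integrable_sq
  have hP0 (x : Plane) : 0 ≤ u x ^ 2 + v x ^ 2 := by positivity
  refine ⟨C₁ + C₂, fun R hR s hs => ?_⟩
  have hR0 : 0 < R := by linarith
  let η : Plane → ℝ := fun x => β (R⁻¹ • x)
  -- The factor `R⁻²` offsets the quadratic decrease of `W` on the support `‖x‖ ≤ 3 R` (hence the `9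
  -- * c` in `C₂`), and it matches the factor `R⁻²` in `|∇η|²`.
  let θ : Plane → ℝ := fun x => (R ^ 2)⁻¹ * ξ (R⁻¹ • x)
  let κ : Plane → ℝ := (Metric.ball (0 : Plane) R)ᶜ.indicator fun _ => C₁
  have hη : ContDiff ℝ 2 η := hβ.comp (contDiff_const_smul _)
  have hξR : ContDiff ℝ 2 fun x : Plane => ξ (R⁻¹ • x) := hξ.comp (contDiff_const_smul _)
  have hθ : ContDiff ℝ 2 θ := contDiff_const.mul hξR
  have hηc : HasCompactSupport η := β.hasCompactSupport.comp_smul (inv_ne_zero hR0.ne')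
  have hθc : HasCompactSupport θ :=
    (ξ.hasCompactSupport.comp_smul (inv_ne_zero hR0.ne')).mul_left
  have hnorm (x : Plane) : ‖R⁻¹ • x‖ = ‖x‖ / R := by
    rw [norm_smul, norm_inv, Real.norm_eq_abs, abs_of_pos hR0, inv_mul_eq_div]
  have hκm : AEStronglyMeasurable κ volume :=
    (stronglyMeasurable_const.indicator measurableSet_ball.compl).aestronglyMeasurable
  have hκC (x : Plane) : κ x ≤ C₁ := Set.indicator_le_self' (fun _ _ => hC₁0) x
  have hκ0 (x : Plane) : 0 ≤ κ x := Set.indicator_nonneg (fun _ _ => hC₁0) x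
  have hκ (x : Plane) : pd 0 η x ^ 2 + pd 1 η x ^ 2 ≤ κ x * θ x := by
    have hθ0 : 0 ≤ θ x := mul_nonneg (by positivity) ξ.nonneg
    have hpd (j : Fin 2) : pd j η x = R⁻¹ * pd j β (R⁻¹ • x) :=
      pd_comp_smul j (hβ.of_le one_le_two) _ x
    by_cases hx : x ∈ Metric.ball (0 : Plane) R
    · have hx' : R⁻¹ • x ∈ Metric.ball (0 : Plane) β.rIn := by
        rw [mem_ball_zero_iff, hnorm, div_lt_iff₀ hR0]
        have := mem_ball_zero_iff.1 hx
        simpa [β] using this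
      have h0 (j : Fin 2) : pd j β (R⁻¹ • x) = 0 := by
        rw [pd, (β.eventuallyEq_one_of_mem_ball hx').fderiv_eq]
        simp
      rw [hpd, hpd, h0, h0]
      simpa using mul_nonneg (hκ0 x) hθ0
    · have hκx : κ x = C₁ := Set.indicator_of_mem (s := (Metric.ball (0 : Plane) R)ᶜ) hx _
      by_cases hx2 : ‖x‖ ≤ 2 * R
      · have hξ1 : ξ (R⁻¹ • x) = 1 := by
          refine ξ.one_of_mem_closedBall ?_
          rw [mem_closedBall_zero_iff, hnorm, div_le_iff₀ hR0]
          exact hx2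
        rw [hκx, hpd, hpd]
        simp only [θ, hξ1, hC₁]
        have e0 := sq_le_sq' (abs_le.1 (hb₀ (R⁻¹ • x))).1 (abs_le.1 (hb₀ (R⁻¹ • x))).2
        have e1 := sq_le_sq' (abs_le.1 (hb₁ (R⁻¹ • x))).1 (abs_le.1 (hb₁ (R⁻¹ • x))).2
        rw [mul_pow, mul_pow, inv_pow, mul_one, ← mul_add, mul_comm]
        gcongr
      · have h0 (j : Fin 2) : pd j β (R⁻¹ • x) = 0 := by
          have hnot : R⁻¹ • x ∉ tsupport β := by
            rw [β.tsupport_eq, mem_closedBall_zero_iff, hnorm, div_le_iff₀ hR0]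
            exact hx2
          rw [pd, image_eq_zero_of_notMem_tsupport fun h => hnot (tsupport_fderiv_subset ℝ h)]
          simp
        rw [hpd, hpd, h0, h0]
        simpa using mul_nonneg (hκ0 x) hθ0
  have hG (x : Plane) : 1 / 2 * lap θ x - θ x * (W x - x₀) ≤ C₂ := by
    have hlap : lap θ x = (R ^ 2)⁻¹ * ((R⁻¹) ^ 2 * lap ξ (R⁻¹ • x)) := by
      rw [lap_const_mul hξR, lap_comp_smul hξ]
    have hRi : (R ^ 2)⁻¹ ≤ 1 := inv_le_one_of_one_le₀ (one_le_pow₀ hR)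
    have hlapθ : 1 / 2 * lap θ x ≤ l := by
      have h3 := (abs_le.1 (hl (R⁻¹ • x))).2
      have h4 : (R ^ 2)⁻¹ * ((R ^ 2)⁻¹ * lap ξ (R⁻¹ • x)) ≤ 1 * (1 * l) := by
        calc _ ≤ (R ^ 2)⁻¹ * ((R ^ 2)⁻¹ * l) := by gcongr
          _ ≤ _ := by gcongr
      rw [hlap, inv_pow]
      linarith
    have hθW : -(θ x * (W x - x₀)) ≤ 9 * c + |d| + |x₀| := by
      by_cases hx : ‖x‖ ≤ 3 * R
      · have h5 : -(W x - x₀) ≤ 9 * c * R ^ 2 + |d| + |x₀| := by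
          have h6 := hWd x
          have h7 : ‖x‖ ^ 2 ≤ 9 * R ^ 2 := by
            have := pow_le_pow_left₀ (norm_nonneg x) hx 2
            linarith [mul_pow 3 R 2]
          have h8 := mul_le_mul_of_nonneg_left h7 hc.le
          have := neg_abs_le d
          have := le_abs_self x₀
          linarith
        have h9 : 9 * c * R ^ 2 + |d| + |x₀| ≤ R ^ 2 * (9 * c + |d| + |x₀|) := by
          have : 1 ≤ R ^ 2 := one_le_pow₀ hR
          nlinarith [abs_nonneg d, abs_nonneg x₀]
        have hξ1 : ξ (R⁻¹ • x) ≤ 1 := ξ.le_one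
        have hξ0 : 0 ≤ ξ (R⁻¹ • x) := ξ.nonneg
        calc -(θ x * (W x - x₀)) = (R ^ 2)⁻¹ * (ξ (R⁻¹ • x) * -(W x - x₀)) := by
              simp only [θ]; ring
          _ ≤ (R ^ 2)⁻¹ * (ξ (R⁻¹ • x) * (R ^ 2 * (9 * c + |d| + |x₀|))) := by
              gcongr; exact h5.trans h9
          _ ≤ (R ^ 2)⁻¹ * (1 * (R ^ 2 * (9 * c + |d| + |x₀|))) := by gcongr
          _ = 9 * c + |d| + |x₀| := by field_simp
      · have : ξ (R⁻¹ • x) = 0 := by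
          refine ξ.zero_of_le_dist ?_
          rw [dist_zero_right, hnorm, le_div_iff₀ hR0]
          exact (not_le.1 hx).le
        simp only [θ, this]
        simp only [mul_zero, zero_mul, neg_zero]
        positivity
    linarith
  have key := abs_integral_le_of_weak hW hu hv h₁ h₂ (hη.of_le one_le_two) hηc hθ hθc
    (fun x => mul_nonneg (by positivity) ξ.nonneg) hκ0 hκC hκm hκ hs
  have hηi : Integrable fun x => η x * (u x ^ 2 + v x ^ 2) :=
    hPi.bdd_mul (c := 1) hη.continuous.aestronglyMeasurable (Eventually.of_forall fun x => by
      rw [Real.norm_eq_abs, abs_of_nonneg β.nonneg]; exact β.le_one)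
  have hmain : ∫ x in Metric.closedBall (0 : Plane) R, (u x ^ 2 + v x ^ 2) ≤
      ∫ x, η x * (u x ^ 2 + v x ^ 2) := by
    rw [← integral_indicator measurableSet_closedBall]
    refine integral_mono (hPi.indicator measurableSet_closedBall) hηi fun x => ?_
    by_cases hx : x ∈ Metric.closedBall (0 : Plane) R
    · have : η x = 1 := by
        refine β.one_of_mem_closedBall ?_
        rw [mem_closedBall_zero_iff, hnorm, div_le_iff₀ hR0]
        simpa [β] using mem_closedBall_zero_iff.1 hx
      simp only [Set.indicator_of_mem hx, this, one_mul, le_refl]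
    · rw [Set.indicator_of_notMem hx]
      exact mul_nonneg β.nonneg (hP0 x)
  have hη0 : 0 ≤ ∫ x, η x * (u x ^ 2 + v x ^ 2) :=
    integral_nonneg fun x => mul_nonneg β.nonneg (hP0 x)
  have hκint : ∫ x, κ x * (u x ^ 2 + v x ^ 2) =
      C₁ * ∫ x in (Metric.ball (0 : Plane) R)ᶜ, (u x ^ 2 + v x ^ 2) := by
    rw [← integral_const_mul, ← integral_indicator measurableSet_ball.compl]
    congr 1
    funext x
    by_cases hx : x ∈ (Metric.ball (0 : Plane) R)ᶜ
    · simp only [κ, Set.indicator_of_mem hx]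
    · simp only [κ, Set.indicator_of_notMem hx, zero_mul]
  have hGint : ∫ x, (1 / 2 * lap θ x - θ x * (W x - x₀)) * (u x ^ 2 + v x ^ 2) ≤
      C₂ * ∫ x, (u x ^ 2 + v x ^ 2) := by
    rw [← integral_const_mul]
    -- If the integrand were not integrable its integral would be `0` by convention, and the bound
    -- would still hold.
    by_cases hi : Integrable fun x => (1 / 2 * lap θ x - θ x * (W x - x₀)) * (u x ^ 2 + v x ^ 2)
    · exact integral_mono hi (hPi.const_mul _) fun x => mul_le_mul_of_nonneg_right (hG x) (hP0 x)
    · rw [integral_undef hi]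
      exact integral_nonneg fun x => mul_nonneg hC₂0 (hP0 x)
  calc |y₀| * (∫ x in Metric.closedBall (0 : Plane) R, (u x ^ 2 + v x ^ 2))
      ≤ |y₀| * ∫ x, η x * (u x ^ 2 + v x ^ 2) := by gcongr
    _ = |y₀ * ∫ x, η x * (u x ^ 2 + v x ^ 2)| := by rw [abs_mul, abs_of_nonneg hη0]
    _ ≤ _ := key
    _ ≤ s / 2 * (C₂ * ∫ x, (u x ^ 2 + v x ^ 2)) + 1 / (2 * s) *
        (C₁ * ∫ x in (Metric.ball (0 : Plane) R)ᶜ, (u x ^ 2 + v x ^ 2)) := by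
      rw [hκint]
      gcongr
    _ ≤ _ := by
      refine add_le_add ?_ ?_
      · rw [← mul_assoc]
        gcongr <;> linarith
      · rw [← mul_assoc]
        gcongr
        rw [div_mul_eq_mul_div, one_mul, div_le_div_iff₀ (by positivity) hs]
        nlinarith [mul_nonneg hs.le hC₁0, mul_nonneg hs.le hC₂0]

/-- A magnetic Schrödinger operator whose potential is bounded below by a quadratic function has
no square integrable weak eigenfunctions with nonreal eigenvalue. -/
theorem integral_eq_zero_of_weak {B x₀ y₀ c d : ℝ} {W u v : Plane → ℝ} (hW : Continuous W)
    (hc : 0 < c) (hWd : ∀ x, -c * ‖x‖ ^ 2 + d ≤ W x) (hy₀ : y₀ ≠ 0)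
    (hu : MemLp u 2 volume) (hv : MemLp v 2 volume) (h₁ : IsWeakSolution B x₀ y₀ W u v)
    (h₂ : IsWeakSolution B x₀ y₀ W v (fun x => -u x)) :
    ∫ x, (u x ^ 2 + v x ^ 2) = 0 := by
  obtain ⟨C, hC⟩ := exists_abs_integral_le_of_weak hW hc hWd hu hv h₁ h₂
  have hPi : Integrable fun x => u x ^ 2 + v x ^ 2 := hu.integrable_sq.add hv.integrable_sq
  have hP0 (x : Plane) : 0 ≤ u x ^ 2 + v x ^ 2 := by positivity
  set I := ∫ x, (u x ^ 2 + v x ^ 2) with hI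
  have l1 : Tendsto (fun n : ℕ => ∫ x in Metric.closedBall (0 : Plane) n, (u x ^ 2 + v x ^ 2))
      atTop (𝓝 I) := by
    have := tendsto_setIntegral_of_monotone (μ := volume) (f := fun x => u x ^ 2 + v x ^ 2)
      (s := fun n : ℕ => Metric.closedBall (0 : Plane) n)
      (fun n => measurableSet_closedBall)
      (fun m n hmn => Metric.closedBall_subset_closedBall (by exact_mod_cast hmn))
      hPi.integrableOn
    rwa [Metric.iUnion_closedBall_nat, setIntegral_univ] at this
  have l2 : Tendsto (fun n : ℕ => ∫ x in (Metric.ball (0 : Plane) n)ᶜ, (u x ^ 2 + v x ^ 2))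
      atTop (𝓝 0) := by
    have := tendsto_setIntegral_of_antitone (μ := volume) (f := fun x => u x ^ 2 + v x ^ 2)
      (s := fun n : ℕ => (Metric.ball (0 : Plane) n)ᶜ)
      (fun n => measurableSet_ball.compl)
      (fun m n hmn => Set.compl_subset_compl.2
        (Metric.ball_subset_ball (by exact_mod_cast hmn)))
      ⟨0, hPi.integrableOn⟩
    rwa [← Set.compl_iUnion, Metric.iUnion_ball_nat, Set.compl_univ, setIntegral_empty] at this
  -- For fixed `s` the tail term disappears as the radius tends to infinity; afterwards `s` tends to
  -- zero.
  have l3 (s : ℝ) (hs : 0 < s) : |y₀| * I ≤ s * C * I := by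
    have h := (l2.const_mul (C / s)).const_add (s * C * I)
    rw [mul_zero, add_zero] at h
    refine le_of_tendsto_of_tendsto (l1.const_mul |y₀|) h ?_
    filter_upwards [eventually_ge_atTop 1] with n hn
    exact hC n (by exact_mod_cast hn) s hs
  have l4 : |y₀| * I ≤ 0 := by
    have h : Tendsto (fun s : ℝ => s * C * I) (𝓝[>] 0) (𝓝 (0 * C * I)) :=
      ((tendsto_id.mono_left nhdsWithin_le_nhds).mul_const C).mul_const I
    rw [zero_mul, zero_mul] at h
    exact ge_of_tendsto h (eventually_mem_nhdsWithin.mono l3)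
  have hI0 : 0 ≤ I := integral_nonneg hP0
  have := abs_pos.2 hy₀
  nlinarith

end Uniqueness

/-! ### Triviality of the deficiency spaces -/

section Deficiency

open scoped InnerProductSpace

/-- The `k`-th unit spinor. -/
def unitSpinor (k : Fin 2) : Spinor := EuclideanSpace.single k 1

/-- The eigenvalues of `σ₃`. -/
def spinSign (k : Fin 2) : ℝ := ![1, -1] k

theorem σ₃_unitSpinor (k : Fin 2) :
    Matrix.toEuclideanLin σ₃ (unitSpinor k) = (spinSign k : ℂ) • unitSpinor k := by
  ext i
  fin_cases k <;> fin_cases i <;>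
    simp [unitSpinor, spinSign, σ₃, Matrix.toLpLin_apply]

theorem fderiv_ofReal_smul {g : Plane → ℝ} (hg : ContDiff ℝ 1 g) (b : Spinor) (j : Fin 2)
    (x : Plane) : fderiv ℝ (fun x => (g x : ℂ) • b) x (e j) = (pd j g x : ℂ) • b := by
  have h1 : HasFDerivAt (fun x => (g x : ℂ)) (Complex.ofRealCLM.comp (fderiv ℝ g x)) x :=
    Complex.ofRealCLM.hasFDerivAt.comp x (hg.differentiable one_ne_zero x).hasFDerivAt
  rw [(h1.smul_const b).fderiv]
  rfl

theorem contDiff_ofReal_smul {n : WithTop ℕ∞} {g : Plane → ℝ} (hg : ContDiff ℝ n g) (b : Spinor) :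
    ContDiff ℝ n (fun x => (g x : ℂ) • b) :=
  (Complex.ofRealCLM.contDiff.comp hg).smul contDiff_const

/-- The Pauli expression on real multiples of a unit spinor. -/
theorem pauliExpr_ofReal_smul {A : Plane → Plane} (hA : ContDiff ℝ 1 A) (V : Plane → ℝ)
    {g : Plane → ℝ} (hg : ContDiff ℝ 2 g) (k : Fin 2) (x : Plane) :
    pauliExpr A V (fun x => (g x : ℂ) • unitSpinor k) x =
      (((-lap g x + (A x 0 ^ 2 + A x 1 ^ 2 + V x - spinSign k * curl A x) * g x : ℝ) : ℂ)
      + Complex.I * ((2 * (A x 0 * pd 0 g x + A x 1 * pd 1 g x)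
        + (fderiv ℝ A x (e 0) 0 + fderiv ℝ A x (e 1) 1) * g x : ℝ) : ℂ)) • unitSpinor k := by
  have h2 (j : Fin 2) := momentum_momentum hA j (contDiff_ofReal_smul hg (unitSpinor k)) x
  simp only [pauliExpr, h2, fderiv_ofReal_smul (hg.of_le one_le_two),
    fderiv_ofReal_smul (contDiff_pd _ hg (m := 1) (by norm_num)), map_smul, σ₃_unitSpinor,
    Fin.sum_univ_two, lap]
  match_scalars
  ring

theorem inner_unitSpinor_smul (w : Spinor) (k : Fin 2) (c : ℂ) :
    ⟪w, c • unitSpinor k⟫_ℂ = c * (starRingEnd ℂ) (w k) := by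
  simp [unitSpinor, EuclideanSpace.inner_single_right]

/-- Testing orthogonality with `exp (i χ) g` times a unit spinor, `g` real, moves the problem to the
symmetric gauge and separates the spin components, shifting `V` by `∓B`. The inner product
conjugates `w`, so `ζ` solves the equation with `-i∇ + a` in place of `-i∇ - a`. The real and
imaginary parts of the tested identity give the two weak equations. -/
theorem isWeakSolution_of_orthogonal {A : Plane → Plane} {V : Plane → ℝ} {B : ℝ}
    (hA : ContDiff ℝ 1 A) (hV : Continuous V) (hB : ∀ x, curl A x = B) {χ : Plane → ℝ}
    (hχ : ContDiff ℝ 2 χ) (hgrad : ∀ x j, fderiv ℝ χ x (e j) = A x j - symGauge B x j) {z : ℂ}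
    {w : Hilb} (hw : ∀ u : (pauliMinimal A V hA hV).domain,
      ⟪w, pauliMinimal A V hA hV u - z • (u : Hilb)⟫_ℂ = 0) (k : Fin 2) {ζ : Plane → ℂ}
    (hζ : ζ = fun x => Complex.exp (Complex.I * χ x) * (starRingEnd ℂ) (w x k)) :
    MemLp (fun x => (ζ x).re) 2 volume ∧ MemLp (fun x => (ζ x).im) 2 volume ∧
    IsWeakSolution B z.re z.im (fun x => V x - spinSign k * B) (fun x => (ζ x).re)
      (fun x => (ζ x).im) ∧
    IsWeakSolution B z.re z.im (fun x => V x - spinSign k * B) (fun x => (ζ x).im)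
      (fun x => -(ζ x).re) := by
  have hsB (x : Plane) : curl A x = curl (symGauge B) x := by rw [hB, curl_symGauge]
  have hdiv (x : Plane) : fderiv ℝ (symGauge B) x (e 0) 0 + fderiv ℝ (symGauge B) x (e 1) 1 = 0 := by
    rw [fderiv_symGauge, fderiv_symGauge]
    simp [symGauge, e]
  have hζm : AEStronglyMeasurable ζ volume := by
    rw [hζ]
    refine (contDiff_gauge hχ).continuous.aestronglyMeasurable.mul ?_
    exact ((Complex.continuous_conj.comp
      (EuclideanSpace.proj (𝕜 := ℂ) k).continuous).comp_aestronglyMeasurable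
        (Lp.aestronglyMeasurable w))
  have hζn (x : Plane) : ‖ζ x‖ ≤ ‖w x‖ := by
    rw [hζ]
    have h1 : ‖Complex.exp (Complex.I * χ x)‖ = 1 := by
      rw [mul_comm]; exact Complex.norm_exp_ofReal_mul_I _
    simp only [norm_mul, h1, one_mul, RCLike.norm_conj]
    exact PiLp.norm_apply_le (w x) k
  have hζL : MemLp ζ 2 volume := (Lp.memLp w).of_le hζm (Eventually.of_forall hζn)
  have key (g : Plane → ℝ) (hg : ContDiff ℝ ∞ g) (hgc : HasCompactSupport g) :
      ∃ F : Plane → ℂ, Integrable F ∧ ∫ x, F x = 0 ∧ ∀ x, F x =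
        (((-lap g x + (symGauge B x 0 ^ 2 + symGauge B x 1 ^ 2 + (V x - spinSign k * B) - z.re)
          * g x : ℝ) : ℂ)
        + Complex.I * ((2 * (symGauge B x 0 * pd 0 g x + symGauge B x 1 * pd 1 g x)
          - z.im * g x : ℝ) : ℂ)) * ζ x := by
    have hg2 : ContDiff ℝ 2 g := hg.of_le (by norm_cast)
    have hψ : ContDiff ℝ 2 fun x => (g x : ℂ) • unitSpinor k := contDiff_ofReal_smul hg2 _
    have hφ : ContDiff ℝ 2 fun x => Complex.exp (Complex.I * χ x) • ((g x : ℂ) • unitSpinor k) :=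
      (contDiff_gauge hχ).smul hψ
    have hφc : HasCompactSupport fun x =>
        Complex.exp (Complex.I * χ x) • ((g x : ℂ) • unitSpinor k) := by
      refine hgc.mono fun x hx => ?_
      exact fun h => hx (by simp [h])
    have h0 := integral_inner_eq_zero_of_orthogonal hA hV hw hφ hφc
    refine ⟨_, ?_, h0, fun x => ?_⟩
    · have hm1 : MemLp (fun x => pauliExpr A V (fun x => Complex.exp (Complex.I * χ x) •
          ((g x : ℂ) • unitSpinor k)) x - z • Complex.exp (Complex.I * χ x) •
          ((g x : ℂ) • unitSpinor k)) 2 volume :=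
        (memLp_pauliExpr_of_contDiff hA hV hφ hφc).sub
          ((hφ.continuous.memLp_of_hasCompactSupport hφc).const_smul z)
      have := L2.integrable_inner (𝕜 := ℂ) w (hm1.toLp _)
      refine this.congr ?_
      filter_upwards [hm1.coeFn_toLp] with x hx
      rw [hx]
    · rw [pauliExpr_gauge ((contDiff_symGauge B)) hχ hgrad hsB V hψ,
        pauliExpr_ofReal_smul (contDiff_symGauge B) V hg2, hdiv, curl_symGauge, smul_smul,
        smul_smul, smul_smul, ← sub_smul, inner_unitSpinor_smul, hζ]
      have hz : z = (z.re : ℂ) + z.im * Complex.I := (Complex.re_add_im z).symm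
      conv_lhs => rw [hz]
      push_cast
      ring
  refine ⟨hζL.re, hζL.im, fun g hg hgc => ?_, fun g hg hgc => ?_⟩
  · obtain ⟨F, hF1, hF2, hF3⟩ := key g hg hgc
    have h1 : ∫ x, (F x).re = 0 := by
      have := integral_re hF1
      rw [hF2] at this
      simpa using this
    rw [← h1]
    congr 1
    funext x
    rw [hF3]
    simp only [Complex.mul_re, Complex.add_re, Complex.ofReal_re, Complex.I_re, Complex.I_im,
      Complex.add_im, Complex.ofReal_im, Complex.mul_im]
    ring
  · obtain ⟨F, hF1, hF2, hF3⟩ := key g hg hgc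
    have h1 : ∫ x, (F x).im = 0 := by
      have := integral_im hF1
      rw [hF2] at this
      simpa using this
    rw [← h1]
    congr 1
    funext x
    rw [hF3]
    simp only [Complex.mul_re, Complex.add_re, Complex.ofReal_re, Complex.I_re, Complex.I_im,
      Complex.add_im, Complex.ofReal_im, Complex.mul_im]
    ring

/-- Nonreal numbers are in the resolvent set of the Pauli operator with constant magnetic field and
electric potential bounded below by a quadratic function. -/
theorem mem_resolventSet_pauliOperator {A : Plane → Plane} {V : Plane → ℝ} {B c d : ℝ}
    (hA : ContDiff ℝ 1 A) (hV : Continuous V) (hB : ∀ x, curl A x = B) (hc : 0 < c)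
    (hVd : ∀ x, -c * ‖x‖ ^ 2 + d ≤ V x) {z : ℂ} (hz : z.im ≠ 0) :
    z ∈ resolventSet (pauliOperator A V hA hV) := by
  refine mem_resolventSet_closure (dense_domain_pauliMinimal hA hV)
    (pauliMinimal_symmetric hA hV) hz fun w hw => ?_
  obtain ⟨χ, hχ, hgrad⟩ := exists_gauge hA (contDiff_symGauge B (n := 1))
    fun x => by rw [hB, curl_symGauge]
  have hk (k : Fin 2) : ∀ᵐ x, w x k = 0 := by
    obtain ⟨h1, h2, h3, h4⟩ := isWeakSolution_of_orthogonal hA hV hB hχ hgrad hw k rfl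
    have h5 := integral_eq_zero_of_weak (W := fun x => V x - spinSign k * B)
      (hV.sub continuous_const) hc (d := d - spinSign k * B)
      (fun x => by have := hVd x; linarith) hz h1 h2 h3 h4
    have h6 := (integral_eq_zero_iff_of_nonneg
      (fun x => add_nonneg (sq_nonneg _) (sq_nonneg _))
      (h1.integrable_sq.add h2.integrable_sq)).1 h5
    filter_upwards [h6] with x hx
    set ζ : ℂ := Complex.exp (Complex.I * χ x) * (starRingEnd ℂ) (w x k)
    have h6 : ζ.re ^ 2 + ζ.im ^ 2 = 0 := hx
    have h7 : ζ = 0 := Complex.ext (by simp only [Complex.zero_re]; nlinarith)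
      (by simp only [Complex.zero_im]; nlinarith)
    have h8 := (mul_eq_zero.1 h7).resolve_left (Complex.exp_ne_zero _)
    simpa using h8
  refine Lp.ext ?_
  filter_upwards [hk 0, hk 1, Lp.coeFn_zero Spinor 2 (volume : Measure Plane)] with x h0 h1 h2
  rw [h2]
  ext i
  fin_cases i
  · exact h0
  · exact h1

end Deficiency

/-! ### Eigenfunctions of the harmonic oscillator -/

section Oscillator

open Polynomial

/-- Hermite polynomials by the raising operator `p ↦ 2 B X p - p'`. The lowering identity `hd` gives
both the next equation and, since its right side is nonzero, nonvanishing of the new polynomial. -/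
theorem exists_hermite_polynomial {B : ℝ} (hB : 0 < B) (n : ℕ) :
    ∃ p : ℝ[X], p ≠ 0 ∧
      derivative (derivative p) - C (2 * B) * X * derivative p + C (2 * n * B) * p = 0 := by
  induction n with
  | zero => exact ⟨1, one_ne_zero, by simp⟩
  | succ n ih =>
    obtain ⟨p, hp0, hp⟩ := ih
    have hd : derivative (C (2 * B) * X * p - derivative p) = C (2 * (n + 1) * B) * p := by
      simp only [derivative_sub, derivative_mul, derivative_C, derivative_X, zero_mul, zero_add,
        mul_one]
      have h1 : (C (2 * (n + 1) * B) : ℝ[X]) = C (2 * B) + C (2 * n * B) := by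
        rw [← C_add]; congr 1; ring
      rw [h1]
      linear_combination -hp
    refine ⟨C (2 * B) * X * p - derivative p, fun h0 => ?_, ?_⟩
    · rw [h0, derivative_zero] at hd
      have h1 : (C (2 * (n + 1) * B) : ℝ[X]) ≠ 0 := by
        rw [Ne, C_eq_zero]; positivity
      exact (mul_ne_zero h1 hp0) hd.symm
    · rw [hd, derivative_mul, derivative_C]
      push_cast
      ring

theorem integrable_polynomial_mul_gaussian {B : ℝ} (hB : 0 < B) (p : ℝ[X]) :
    Integrable fun s : ℝ => p.eval s * Real.exp (-B * s ^ 2) := by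
  induction p using Polynomial.induction_on' with
  | add p q hp hq =>
    simp only [eval_add, add_mul]
    exact hp.add hq
  | monomial n a =>
    have h := (integrable_rpow_mul_exp_neg_mul_sq hB (s := n)
      (by linarith [Nat.cast_nonneg (α := ℝ) n])).const_mul a
    simpa only [Real.rpow_natCast, eval_monomial, mul_assoc] using h

/-- The eigenfunctions of the harmonic oscillator with frequency `B`. -/
theorem exists_oscillator_eigenfunction {B : ℝ} (hB : 0 < B) (n : ℕ) :
    ∃ k k' : ℝ → ℝ, (∀ s, HasDerivAt k (k' s) s) ∧
      (∀ s, HasDerivAt k' ((B ^ 2 * s ^ 2 - (2 * n + 1) * B) * k s) s) ∧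
      Integrable (fun s => k s ^ 2) ∧ Integrable (fun s => k' s ^ 2) ∧
      Integrable (fun s => s ^ 2 * k s ^ 2) ∧ 0 < ∫ s, k s ^ 2 ∧
      (∫ s, k' s ^ 2) + B ^ 2 * (∫ s, s ^ 2 * k s ^ 2) = (2 * n + 1) * B * ∫ s, k s ^ 2 := by
  obtain ⟨p, hp0, hp⟩ := exists_hermite_polynomial hB n
  let w : ℝ → ℝ := fun s => Real.exp (-(B / 2) * s ^ 2)
  have hw (s : ℝ) : HasDerivAt w (-(B * s) * w s) s := by
    have h1 : HasDerivAt (fun s : ℝ => -(B / 2) * s ^ 2) (-(B / 2) * (2 * s)) s := by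
      simpa using (hasDerivAt_pow 2 s).const_mul (-(B / 2))
    convert h1.exp using 1
    simp only [w]
    ring
  have hw2 (s : ℝ) : w s * w s = Real.exp (-B * s ^ 2) := by
    simp only [w]
    rw [← Real.exp_add]
    congr 1
    ring
  -- Differentiating a polynomial times the Gaussian acts on the polynomial factor as `q ↦ q' - B X
  -- q`.
  have hder (q : ℝ[X]) (s : ℝ) : HasDerivAt (fun s => q.eval s * w s)
      ((derivative q - C B * X * q).eval s * w s) s := by
    refine ((q.hasDerivAt s).fun_mul (hw s)).congr_deriv ?_
    simp only [eval_sub, eval_mul, eval_C, eval_X]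
    ring
  set p₁ : ℝ[X] := derivative p - C B * X * p with hp₁
  have hp₂ : derivative p₁ - C B * X * p₁ = (C (B ^ 2) * X ^ 2 - C ((2 * n + 1) * B)) * p := by
    rw [hp₁]
    simp only [derivative_sub, derivative_mul, derivative_C, derivative_X, zero_mul, zero_add,
      mul_one]
    have h1 : (C ((2 * n + 1) * B) : ℝ[X]) = C B + C (2 * n * B) := by
      rw [← C_add]; congr 1; ring
    have h2 : (C (B ^ 2) : ℝ[X]) = C B * C B := by rw [← C_mul]; congr 1; ring
    have h3 : (C (2 * B) : ℝ[X]) = C B + C B := by rw [← C_add]; congr 1; ring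
    rw [h3] at hp
    rw [h1, h2]
    linear_combination hp
  have hsq (q r : ℝ[X]) : Integrable fun s => (q.eval s * w s) * (r.eval s * w s) := by
    refine (integrable_polynomial_mul_gaussian hB (q * r)).congr (Eventually.of_forall fun s => ?_)
    simp only [eval_mul, ← hw2]
    ring
  have hk : ∀ s, HasDerivAt (fun s => p.eval s * w s) (p₁.eval s * w s) s := hder p
  have hk' (s : ℝ) : HasDerivAt (fun s => p₁.eval s * w s)
      ((B ^ 2 * s ^ 2 - (2 * n + 1) * B) * (p.eval s * w s)) s := by
    convert hder p₁ s using 1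
    rw [hp₂]
    simp only [eval_mul, eval_sub, eval_C, eval_X, eval_pow]
    ring
  have i1 : Integrable fun s => (p.eval s * w s) ^ 2 := by
    simpa only [sq] using hsq p p
  have i2 : Integrable fun s => (p₁.eval s * w s) ^ 2 := by
    simpa only [sq] using hsq p₁ p₁
  have i3 : Integrable fun s => s ^ 2 * (p.eval s * w s) ^ 2 := by
    refine (hsq (X * p) (X * p)).congr (Eventually.of_forall fun s => ?_)
    simp only [eval_mul, eval_X]
    ring
  refine ⟨fun s => p.eval s * w s, fun s => p₁.eval s * w s, hk, hk', i1, i2, i3, ?_, ?_⟩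
  · rw [integral_pos_iff_support_of_nonneg (fun s => sq_nonneg _) i1]
    have hcont : Continuous fun s => (p.eval s * w s) ^ 2 :=
      (continuous_iff_continuousAt.2 fun s => (hk s).continuousAt).pow 2
    refine hcont.isOpen_support.measure_pos volume ?_
    by_contra hne
    rw [Set.not_nonempty_iff_eq_empty, Function.support_eq_empty_iff] at hne
    refine hp0 (Polynomial.funext fun s => ?_)
    have h1 : (p.eval s * w s) ^ 2 = 0 := congrFun hne s
    have h2 := (mul_eq_zero.1 (pow_eq_zero_iff two_ne_zero |>.1 h1)).resolve_right
      (Real.exp_pos _).ne'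
    rw [h2, eval_zero]
  -- The energy identity comes from integrating `(k k')' = k'² + k k''` over the line.
  · have h0 := integral_eq_zero_of_hasDerivAt_of_integrable (fun s => (hk s).mul (hk' s))
      (((hsq p₁ p₁).add ((i3.const_mul (B ^ 2)).sub (i1.const_mul ((2 * n + 1) * B)))).congr
        (Eventually.of_forall fun s => by simp only [Pi.add_apply, Pi.sub_apply]; ring)) (hsq p p₁)
    have h1 : ∫ s, ((p₁.eval s * w s) ^ 2 + (B ^ 2 * (s ^ 2 * (p.eval s * w s) ^ 2)
        - (2 * n + 1) * B * (p.eval s * w s) ^ 2)) = 0 := by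
      rw [← h0]
      congr 1
      funext s
      ring
    have i4 : Integrable fun s => B ^ 2 * (s ^ 2 * (p.eval s * w s) ^ 2)
        - (2 * n + 1) * B * (p.eval s * w s) ^ 2 := (i3.const_mul _).sub (i1.const_mul _)
    rw [integral_add i2 i4, integral_sub (i3.const_mul _) (i1.const_mul _), integral_const_mul,
      integral_const_mul] at h1
    linarith

end Oscillator

/-! ### Rotated coordinates -/

section Rotated

/-- The coordinate of `x - x₀` in the direction `(a, b)`. -/
def coord (a b : ℝ) (x₀ x : Plane) : ℝ := a * (x 0 - x₀ 0) + b * (x 1 - x₀ 1)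

theorem hasFDerivAt_coord (a b : ℝ) (x₀ x : Plane) :
    HasFDerivAt (coord a b x₀) (a • EuclideanSpace.proj (𝕜 := ℝ) (0 : Fin 2)
      + b • EuclideanSpace.proj (𝕜 := ℝ) (1 : Fin 2)) x :=
  (((EuclideanSpace.proj (𝕜 := ℝ) (0 : Fin 2)).hasFDerivAt.sub_const _).const_mul a).add
    (((EuclideanSpace.proj (𝕜 := ℝ) (1 : Fin 2)).hasFDerivAt.sub_const _).const_mul b)

theorem contDiff_coord (a b : ℝ) (x₀ : Plane) {n : WithTop ℕ∞} : ContDiff ℝ n (coord a b x₀) := by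
  have h (i : Fin 2) : ContDiff ℝ n (fun x : Plane => x i) :=
    (EuclideanSpace.proj (𝕜 := ℝ) i).contDiff
  exact (contDiff_const.mul ((h 0).sub contDiff_const)).add
    (contDiff_const.mul ((h 1).sub contDiff_const))

/-- The rotation with matrix `!![a, b; -b, a]`. -/
def rotation {a b : ℝ} (h : a ^ 2 + b ^ 2 = 1) : Plane →ₗᵢ[ℝ] Plane where
  toFun x := !₂[a * x 0 + b * x 1, -b * x 0 + a * x 1]
  map_add' x y := by ext j; fin_cases j <;> simp <;> ring
  map_smul' c x := by ext j; fin_cases j <;> simp <;> ring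
  norm_map' x := by
    rw [EuclideanSpace.norm_eq, EuclideanSpace.norm_eq]
    congr 1
    simp only [Fin.sum_univ_two, Real.norm_eq_abs, sq_abs]
    simp
    linear_combination (x 0 ^ 2 + x 1 ^ 2) * h

theorem measurePreserving_coord {a b : ℝ} (h : a ^ 2 + b ^ 2 = 1) (x₀ : Plane) :
    MeasurePreserving (fun x => (coord a b x₀ x, coord (-b) a x₀ x)) volume volume := by
  have h1 := ((rotation h).toLinearIsometryEquiv rfl).measurePreserving
  have h2 := (volume_preserving_finTwoArrow ℝ).comp ((PiLp.volume_preserving_ofLp (Fin 2)).comp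
    (h1.comp (measurePreserving_sub_right volume x₀)))
  exact h2

theorem integrable_mul_coord {a b : ℝ} (h : a ^ 2 + b ^ 2 = 1) (x₀ : Plane) {f g : ℝ → ℝ}
    (hf : Integrable f) (hg : Integrable g) :
    Integrable fun x => f (coord a b x₀ x) * g (coord (-b) a x₀ x) :=
  (measurePreserving_coord h x₀).integrable_comp_of_integrable (hf.mul_prod hg)

theorem integral_mul_coord {a b : ℝ} (h : a ^ 2 + b ^ 2 = 1) (x₀ : Plane) {f g : ℝ → ℝ}
    (hf : Integrable f) (hg : Integrable g) :
    ∫ x, f (coord a b x₀ x) * g (coord (-b) a x₀ x) = (∫ s, f s) * ∫ t, g t := by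
  have hm := measurePreserving_coord h x₀
  have hfg : Integrable (fun z : ℝ × ℝ => f z.1 * g z.2) volume := hf.mul_prod hg
  have h1 := integral_map (μ := (volume : Measure Plane)) hm.measurable.aemeasurable
    (f := fun z : ℝ × ℝ => f z.1 * g z.2) (by rw [hm.map_eq]; exact hfg.aestronglyMeasurable)
  rw [hm.map_eq] at h1
  rw [← integral_prod_mul f g]
  exact h1.symm

theorem norm_sub_sq_eq_coord {a b : ℝ} (h : a ^ 2 + b ^ 2 = 1) (x₀ x : Plane) :
    ‖x - x₀‖ ^ 2 = coord a b x₀ x ^ 2 + coord (-b) a x₀ x ^ 2 := by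
  rw [EuclideanSpace.real_norm_sq_eq]
  simp only [Fin.sum_univ_two, coord, PiLp.sub_apply]
  linear_combination -((x 0 - x₀ 0) ^ 2 + (x 1 - x₀ 1) ^ 2) * h

end Rotated

/-! ### Wave packets in crossed electric and magnetic fields -/

section WavePacket

theorem contDiff_two_of_hasDerivAt {k k' k'' : ℝ → ℝ} (h : ∀ s, HasDerivAt k (k' s) s)
    (h' : ∀ s, HasDerivAt k' (k'' s) s) (hc : Continuous k'') : ContDiff ℝ 2 k := by
  have d1 : deriv k = k' := funext fun s => (h s).deriv
  have d2 : deriv k' = k'' := funext fun s => (h' s).deriv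
  have h1 : ContDiff ℝ 1 k' := by
    rw [contDiff_one_iff_deriv, d2]
    exact ⟨fun s => (h' s).differentiableAt, hc⟩
  rw [show (2 : WithTop ℕ∞) = 1 + 1 from one_add_one_eq_two.symm, contDiff_succ_iff_deriv, d1]
  exact ⟨fun s => (h s).differentiableAt, by simp, h1⟩

theorem pd_mul_coord {f f' g g' : ℝ → ℝ} (hf : ∀ s, HasDerivAt f (f' s) s)
    (hg : ∀ s, HasDerivAt g (g' s) s) (a b : ℝ) (x₀ x : Plane) :
    pd 0 (fun x => f (coord a b x₀ x) * g (coord (-b) a x₀ x)) x =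
      a * (f' (coord a b x₀ x) * g (coord (-b) a x₀ x))
        - b * (f (coord a b x₀ x) * g' (coord (-b) a x₀ x)) ∧
    pd 1 (fun x => f (coord a b x₀ x) * g (coord (-b) a x₀ x)) x =
      b * (f' (coord a b x₀ x) * g (coord (-b) a x₀ x))
        + a * (f (coord a b x₀ x) * g' (coord (-b) a x₀ x)) := by
  have h1 : HasFDerivAt (fun x => f (coord a b x₀ x) * g (coord (-b) a x₀ x)) _ x :=
    ((hf (coord a b x₀ x)).comp_hasFDerivAt x (hasFDerivAt_coord a b x₀ x)).fun_mul
      ((hg (coord (-b) a x₀ x)).comp_hasFDerivAt x (hasFDerivAt_coord (-b) a x₀ x))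
  constructor <;>
  · simp only [pd, h1.fderiv]
    simp [e]
    ring

theorem lap_mul_coord {f f' f'' g g' g'' : ℝ → ℝ} (hf : ∀ s, HasDerivAt f (f' s) s)
    (hf' : ∀ s, HasDerivAt f' (f'' s) s) (hg : ∀ s, HasDerivAt g (g' s) s)
    (hg' : ∀ s, HasDerivAt g' (g'' s) s) {a b : ℝ} (hab : a ^ 2 + b ^ 2 = 1) (x₀ x : Plane)
    (hf'c : ContDiff ℝ 1 f') (hg'c : ContDiff ℝ 1 g') (hfc : ContDiff ℝ 1 f)
    (hgc : ContDiff ℝ 1 g) :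
    lap (fun x => f (coord a b x₀ x) * g (coord (-b) a x₀ x)) x =
      f'' (coord a b x₀ x) * g (coord (-b) a x₀ x)
        + f (coord a b x₀ x) * g'' (coord (-b) a x₀ x) := by
  have e0 := funext fun x => (pd_mul_coord hf hg a b x₀ x).1
  have e1 := funext fun x => (pd_mul_coord hf hg a b x₀ x).2
  have hs : ContDiff ℝ 1 (coord a b x₀) := contDiff_coord a b x₀
  have ht : ContDiff ℝ 1 (coord (-b) a x₀) := contDiff_coord (-b) a x₀
  have c1 : ContDiff ℝ 1 fun x => f' (coord a b x₀ x) * g (coord (-b) a x₀ x) :=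
    (hf'c.comp hs).mul (hgc.comp ht)
  have c2 : ContDiff ℝ 1 fun x => f (coord a b x₀ x) * g' (coord (-b) a x₀ x) :=
    (hfc.comp hs).mul (hg'c.comp ht)
  have p1 := pd_mul_coord hf' hg a b x₀ x
  have p2 := pd_mul_coord hf hg' a b x₀ x
  rw [lap, e0, e1, pd_sub 0 (contDiff_const.mul c1) (contDiff_const.mul c2),
    pd_add 1 (contDiff_const.mul c1) (contDiff_const.mul c2), pd_const_mul 0 c1,
    pd_const_mul 0 c2, pd_const_mul 1 c1, pd_const_mul 1 c2, p1.1, p1.2, p2.1, p2.2]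
  linear_combination (f'' (coord a b x₀ x) * g (coord (-b) a x₀ x)
        + f (coord a b x₀ x) * g'' (coord (-b) a x₀ x)) * hab

/-- The vector potential `B s (-b, a)` where `s` is the coordinate in direction `(a, b)`. -/
def landauGauge (B a b : ℝ) (x₀ x : Plane) : Plane :=
  !₂[-b * (B * coord a b x₀ x), a * (B * coord a b x₀ x)]

theorem contDiff_landauGauge (B a b : ℝ) (x₀ : Plane) {n : WithTop ℕ∞} :
    ContDiff ℝ n (landauGauge B a b x₀) := by
  refine contDiff_euclidean.2 fun j => ?_
  have h : ContDiff ℝ n (coord a b x₀) := contDiff_coord a b x₀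
  fin_cases j
  · exact contDiff_const.mul (contDiff_const.mul h)
  · exact contDiff_const.mul (contDiff_const.mul h)

theorem fderiv_landauGauge (B a b : ℝ) (x₀ x v : Plane) :
    fderiv ℝ (landauGauge B a b x₀) x v 0 = -b * (B * (a * v 0 + b * v 1)) ∧
    fderiv ℝ (landauGauge B a b x₀) x v 1 = a * (B * (a * v 0 + b * v 1)) := by
  have h (j : Fin 2) : HasFDerivAt (fun x => landauGauge B a b x₀ x j)
      ((EuclideanSpace.proj (𝕜 := ℝ) j).comp (fderiv ℝ (landauGauge B a b x₀) x)) x :=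
    (EuclideanSpace.proj (𝕜 := ℝ) j).hasFDerivAt.comp x
      ((contDiff_landauGauge B a b x₀ (n := 1)).differentiable one_ne_zero x).hasFDerivAt
  have h0 : HasFDerivAt (fun x => landauGauge B a b x₀ x 0) _ x :=
    ((hasFDerivAt_coord a b x₀ x).const_mul B).const_mul (-b)
  have h1 : HasFDerivAt (fun x => landauGauge B a b x₀ x 1) _ x :=
    ((hasFDerivAt_coord a b x₀ x).const_mul B).const_mul a
  have e0 := congrArg (fun l : Plane →L[ℝ] ℝ => l v) ((h 0).unique h0)
  have e1 := congrArg (fun l : Plane →L[ℝ] ℝ => l v) ((h 1).unique h1)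
  constructor
  · refine Eq.trans e0 ?_
    simp
    ring
  · refine Eq.trans e1 ?_
    simp
    ring

theorem curl_landauGauge (B : ℝ) {a b : ℝ} (hab : a ^ 2 + b ^ 2 = 1) (x₀ x : Plane) :
    curl (landauGauge B a b x₀) x = B := by
  rw [curl, (fderiv_landauGauge B a b x₀ x _).2, (fderiv_landauGauge B a b x₀ x _).1]
  simp [e]
  linear_combination B * hab

/-- The Pauli expression in the Landau gauge on a product of functions of the two coordinates. -/
theorem pauliExpr_landauGauge {f f' f'' g g' g'' : ℝ → ℝ} (hf : ∀ s, HasDerivAt f (f' s) s)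
    (hf' : ∀ s, HasDerivAt f' (f'' s) s) (hg : ∀ s, HasDerivAt g (g' s) s)
    (hg' : ∀ s, HasDerivAt g' (g'' s) s) (hf'' : Continuous f'') (hg'' : Continuous g'')
    (B : ℝ) {a b : ℝ} (hab : a ^ 2 + b ^ 2 = 1) (V : Plane → ℝ) (x₀ x : Plane) {s t : ℝ}
    (hs : s = coord a b x₀ x) (ht : t = coord (-b) a x₀ x) :
    pauliExpr (landauGauge B a b x₀) V
      (fun x => ((f (coord a b x₀ x) * g (coord (-b) a x₀ x) : ℝ) : ℂ) • unitSpinor 0) x =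
      (((-(f'' s * g t + f s * g'' t) + (B ^ 2 * s ^ 2 + V x - B) * (f s * g t) : ℝ) : ℂ)
        + Complex.I * ((2 * (B * s * (f s * g' t)) : ℝ) : ℂ)) • unitSpinor 0 := by
  subst hs ht
  have hfc : ContDiff ℝ 2 f := contDiff_two_of_hasDerivAt hf hf' hf''
  have hgc : ContDiff ℝ 2 g := contDiff_two_of_hasDerivAt hg hg' hg''
  have hf'c : ContDiff ℝ 1 f' := by
    rw [contDiff_one_iff_deriv, funext fun s => (hf' s).deriv]
    exact ⟨fun s => (hf' s).differentiableAt, hf''⟩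
  have hg'c : ContDiff ℝ 1 g' := by
    rw [contDiff_one_iff_deriv, funext fun s => (hg' s).deriv]
    exact ⟨fun s => (hg' s).differentiableAt, hg''⟩
  have hF : ContDiff ℝ 2 fun x => f (coord a b x₀ x) * g (coord (-b) a x₀ x) :=
    (hfc.comp (contDiff_coord a b x₀)).mul (hgc.comp (contDiff_coord (-b) a x₀))
  rw [pauliExpr_ofReal_smul (contDiff_landauGauge B a b x₀) V hF, curl_landauGauge B hab,
    lap_mul_coord hf hf' hg hg' hab x₀ x hf'c hg'c (hfc.of_le one_le_two) (hgc.of_le one_le_two),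
    (pd_mul_coord hf hg a b x₀ x).1, (pd_mul_coord hf hg a b x₀ x).2,
    (fderiv_landauGauge B a b x₀ x _).2, (fderiv_landauGauge B a b x₀ x _).1]
  have l0 : landauGauge B a b x₀ x 0 = -b * (B * coord a b x₀ x) := rfl
  have l1 : landauGauge B a b x₀ x 1 = a * (B * coord a b x₀ x) := rfl
  have e00 : e 0 0 = 1 := by simp [e]
  have e01 : e 0 1 = 0 := by simp [e]
  have e10 : e 1 0 = 0 := by simp [e]
  have e11 : e 1 1 = 1 := by simp [e]
  have hσ : spinSign 0 = 1 := rfl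
  rw [l0, l1, e00, e01, e10, e11, hσ]
  congr 2
  · rw [Complex.ofReal_inj]
    linear_combination (B ^ 2 * coord a b x₀ x ^ 2 * (f (coord a b x₀ x)
      * g (coord (-b) a x₀ x))) * hab
  · congr 1
    rw [Complex.ofReal_inj]
    linear_combination (2 * B * coord a b x₀ x * (f (coord a b x₀ x)
      * g' (coord (-b) a x₀ x))) * hab

theorem norm_unitSpinor (k : Fin 2) : ‖unitSpinor k‖ = 1 := by
  simp [unitSpinor]

/-- A smooth plateau function on the line together with its first two derivatives. -/
theorem exists_plateau : ∃ (κ κ' κ'' : ℝ → ℝ) (C : ℝ), 0 ≤ C ∧ (∀ s, HasDerivAt κ (κ' s) s) ∧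
    (∀ s, HasDerivAt κ' (κ'' s) s) ∧ Continuous κ'' ∧ (∀ s, |κ s| ≤ 1) ∧ (∀ s, |κ' s| ≤ C) ∧
    (∀ s, |κ'' s| ≤ C) ∧ (∀ s, |s| ≤ 1 → κ s = 1) ∧
    (∀ s, 2 < |s| → κ s = 0 ∧ κ' s = 0 ∧ κ'' s = 0) := by
  let κ : ContDiffBump (0 : ℝ) := ⟨1, 2, one_pos, one_lt_two⟩
  have h0 : ContDiff ℝ (1 + 1) κ := κ.contDiff
  have h1 : ContDiff ℝ 1 (deriv κ) := h0.deriv'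
  have h2 : Continuous (deriv (deriv κ)) := h1.continuous_deriv le_rfl
  have c1 : HasCompactSupport (deriv κ) := κ.hasCompactSupport.deriv
  have c2 : HasCompactSupport (deriv (deriv κ)) := c1.deriv
  obtain ⟨C₁, hC₁⟩ := h1.continuous.bounded_above_of_compact_support c1
  obtain ⟨C₂, hC₂⟩ := h2.bounded_above_of_compact_support c2
  refine ⟨κ, deriv κ, deriv (deriv κ), max C₁ C₂, ?_, ?_, ?_, h2, ?_, ?_, ?_, ?_, ?_⟩
  · exact ((norm_nonneg _).trans (hC₁ 0)).trans (le_max_left _ _)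
  · exact fun s => (h0.differentiable (by simp) s).hasDerivAt
  · exact fun s => (h1.differentiable one_ne_zero s).hasDerivAt
  · intro s
    rw [abs_of_nonneg κ.nonneg]
    exact κ.le_one
  · exact fun s => (hC₁ s).trans (le_max_left _ _)
  · exact fun s => (hC₂ s).trans (le_max_right _ _)
  · intro s hs
    refine κ.one_of_mem_closedBall ?_
    simpa [κ] using hs
  · intro s hs
    have hs0 : s ∉ tsupport κ := by
      rw [κ.tsupport_eq, mem_closedBall_zero_iff, Real.norm_eq_abs]
      exact not_le.2 hs
    have hs1 : s ∉ tsupport (deriv κ) := fun h => hs0 (tsupport_deriv_subset (𝕜 := ℝ) h)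
    exact ⟨image_eq_zero_of_notMem_tsupport hs0, image_eq_zero_of_notMem_tsupport hs1,
      image_eq_zero_of_notMem_tsupport fun h => hs1 (tsupport_deriv_subset (𝕜 := ℝ) h)⟩

end WavePacket

/-! ### Cut-offs, shifted oscillators and a pointwise residual bound. -/

section WavePacketEstimate

/-- Dilating one fixed plateau by `L` costs a factor `1 / L` per derivative, so `C` does not depend
on `L`. -/
theorem exists_scaled_plateau : ∃ C : ℝ, 0 ≤ C ∧ ∀ L : ℝ, 0 < L → ∃ κ κ' κ'' : ℝ → ℝ,
    (∀ s, HasDerivAt κ (κ' s) s) ∧ (∀ s, HasDerivAt κ' (κ'' s) s) ∧ Continuous κ'' ∧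
    (∀ s, |κ s| ≤ 1) ∧ (∀ s, |κ' s| ≤ C / L) ∧ (∀ s, |κ'' s| ≤ C / L ^ 2) ∧
    (∀ s, |s| ≤ L → κ s = 1) ∧ (∀ s, 2 * L < |s| → κ s = 0 ∧ κ' s = 0 ∧ κ'' s = 0) := by
  obtain ⟨κ, κ', κ'', C, hC, h1, h2, h3, b0, b1, b2, p1, p2⟩ := exists_plateau
  refine ⟨C, hC, fun L hL => ⟨fun s => κ (s / L), fun s => κ' (s / L) / L,
    fun s => κ'' (s / L) / L ^ 2, fun s => ?_, fun s => ?_, by fun_prop, fun s => b0 _,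
    fun s => ?_, fun s => ?_, fun s hs => p1 _ ?_, fun s hs => ?_⟩⟩
  · have h : HasDerivAt (fun s => κ (s / L)) (κ' (s / L) * (1 / L)) s :=
      (h1 (s / L)).comp s ((hasDerivAt_id s).div_const L)
    rwa [mul_one_div] at h
  · have h : HasDerivAt (fun s => κ' (s / L) / L) (κ'' (s / L) * (1 / L) / L) s :=
      ((h2 (s / L)).comp s ((hasDerivAt_id s).div_const L)).div_const L
    rwa [mul_one_div, div_div, ← pow_two] at h
  · rw [abs_div, abs_of_pos hL]
    exact div_le_div_of_nonneg_right (b1 _) hL.le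
  · rw [abs_div, abs_of_pos (pow_pos hL 2)]
    exact div_le_div_of_nonneg_right (b2 _) (pow_pos hL 2).le
  · rw [abs_div, abs_of_pos hL]
    exact (div_le_one hL).2 hs
  · have h : 2 < |s / L| := by
      rw [abs_div, abs_of_pos hL]
      exact (lt_div_iff₀ hL).2 hs
    simp [p2 _ h]

/-- Shifted oscillator eigenfunctions with control of their width and momentum. -/
theorem exists_shifted_oscillator_eigenfunction {B : ℝ} (hB : 0 < B) (n : ℕ) (s₀ : ℝ) :
    ∃ k k' : ℝ → ℝ, (∀ s, HasDerivAt k (k' s) s) ∧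
      (∀ s, HasDerivAt k' ((B ^ 2 * (s + s₀) ^ 2 - (2 * n + 1) * B) * k s) s) ∧
      Integrable (fun s => k s ^ 2) ∧ Integrable (fun s => k' s ^ 2) ∧
      Integrable (fun s => s ^ 2 * k s ^ 2) ∧ 0 < ∫ s, k s ^ 2 ∧
      ∫ s, k' s ^ 2 ≤ (2 * n + 1) * B * ∫ s, k s ^ 2 ∧
      ∫ s, s ^ 2 * k s ^ 2 ≤ (2 * (2 * n + 1) / B + 2 * s₀ ^ 2) * ∫ s, k s ^ 2 := by
  obtain ⟨k, k', h1, h2, i0, i1, i2, hN, hE⟩ := exists_oscillator_eigenfunction hB n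
  have j0 := i0.comp_add_right s₀
  have j1 := i1.comp_add_right s₀
  have j2 := i2.comp_add_right s₀
  have hbd (s : ℝ) : s ^ 2 * k (s + s₀) ^ 2 ≤
      2 * ((s + s₀) ^ 2 * k (s + s₀) ^ 2) + 2 * s₀ ^ 2 * k (s + s₀) ^ 2 := by
    nlinarith [sq_nonneg (k (s + s₀)), mul_nonneg (sq_nonneg (s + 2 * s₀))
      (sq_nonneg (k (s + s₀)))]
  have hk : Continuous k := continuous_iff_continuousAt.2 fun s => (h1 s).continuousAt
  have j3 : Integrable fun s => s ^ 2 * k (s + s₀) ^ 2 := by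
    refine ((j2.const_mul 2).add (j0.const_mul (2 * s₀ ^ 2))).mono'
      (by fun_prop) (ae_of_all _ fun s => ?_)
    rw [Real.norm_of_nonneg (by positivity)]
    exact hbd s
  have e0 : ∫ s, k (s + s₀) ^ 2 = ∫ s, k s ^ 2 :=
    integral_add_right_eq_self (fun s => k s ^ 2) s₀
  have e1 : ∫ s, k' (s + s₀) ^ 2 = ∫ s, k' s ^ 2 :=
    integral_add_right_eq_self (fun s => k' s ^ 2) s₀
  have e2 : ∫ s, (s + s₀) ^ 2 * k (s + s₀) ^ 2 = ∫ s, s ^ 2 * k s ^ 2 :=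
    integral_add_right_eq_self (fun s => s ^ 2 * k s ^ 2) s₀
  have q1 : 0 ≤ ∫ s, k' s ^ 2 := integral_nonneg fun s => sq_nonneg _
  have q2 : 0 ≤ ∫ s, s ^ 2 * k s ^ 2 := integral_nonneg fun s => by positivity
  refine ⟨fun s => k (s + s₀), fun s => k' (s + s₀), fun s => (h1 _).comp_add_const s s₀,
    fun s => (h2 _).comp_add_const s s₀, j0, j1, j3, by rwa [e0], ?_, ?_⟩
  -- The potential energy in the energy identity is nonnegative and is dropped.
  · rw [e0, e1]
    nlinarith [mul_nonneg (sq_nonneg B) q2]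
  · rw [e0]
    have h3 : ∫ s, s ^ 2 * k (s + s₀) ^ 2 ≤
        2 * (∫ s, s ^ 2 * k s ^ 2) + 2 * s₀ ^ 2 * ∫ s, k s ^ 2 := by
      rw [← e0, ← e2, ← integral_const_mul, ← integral_const_mul,
        ← integral_add (j2.const_mul 2) (j0.const_mul (2 * s₀ ^ 2))]
      exact integral_mono j3 ((j2.const_mul 2).add (j0.const_mul (2 * s₀ ^ 2))) hbd
    have h4 : ∫ s, s ^ 2 * k s ^ 2 ≤ (2 * n + 1) / B * ∫ s, k s ^ 2 := by
      rw [div_mul_eq_mul_div, le_div_iff₀ hB]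
      nlinarith
    calc _ ≤ _ := h3
      _ ≤ 2 * ((2 * n + 1) / B * ∫ s, k s ^ 2) + 2 * s₀ ^ 2 * ∫ s, k s ^ 2 := by linarith
      _ = _ := by ring

/-- Here `p` and `q` stand for the cut-offs in the two coordinates, `k` for the oscillator
eigenfunction and `T` for the Taylor error of the potential. The two squares are the real and
imaginary parts of the residual; the four terms of the real part cost a factor `4`. -/
theorem wavePacket_residual_le {p p' p'' q q' q'' D₁ D₂ k k' T η B s : ℝ}
    (hp : |p| ≤ 1) (hp' : |p'| ≤ D₁) (hp'' : |p''| ≤ D₂) (hq : |q| ≤ 1) (hq' : |q'| ≤ D₁)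
    (hq'' : |q''| ≤ D₂) (hT : |T| ≤ η) :
    (-(p'' * k + 2 * (p' * k')) * q - p * k * q'' + T * (p * k * q)) ^ 2
      + (2 * (B * s * (p * k * q'))) ^ 2 ≤
      (8 * D₂ ^ 2 + 4 * η ^ 2) * k ^ 2 + 16 * D₁ ^ 2 * k' ^ 2
        + 4 * B ^ 2 * D₁ ^ 2 * (s ^ 2 * k ^ 2) := by
  have m {x y X Y : ℝ} (hx : |x| ≤ X) (hy : |y| ≤ Y) : (x * y) ^ 2 ≤ (X * Y) ^ 2 := by
    refine sq_le_sq' ?_ ?_ <;>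
    · have := abs_le.1 ((abs_mul x y).trans_le
        (mul_le_mul hx hy (abs_nonneg _) ((abs_nonneg _).trans hx)))
      linarith [this.1, this.2]
  have m1 := mul_le_mul_of_nonneg_right (m hp'' hq) (sq_nonneg k)
  have m2 := mul_le_mul_of_nonneg_right (m hp' hq) (sq_nonneg k')
  have m3 := mul_le_mul_of_nonneg_right (m hp hq'') (sq_nonneg k)
  have m4 := mul_le_mul_of_nonneg_right (m hT ((abs_mul p q).trans_le
    (mul_le_one₀ hp (abs_nonneg _) hq))) (sq_nonneg k)
  have m5 := mul_le_mul_of_nonneg_right (m hp hq') (sq_nonneg (B * s * k))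
  have h4 (w x y z : ℝ) : (w + x + y + z) ^ 2 ≤ 4 * (w ^ 2 + x ^ 2 + y ^ 2 + z ^ 2) := by
    nlinarith [sq_nonneg (w - x), sq_nonneg (w - y), sq_nonneg (w - z), sq_nonneg (x - y),
      sq_nonneg (x - z), sq_nonneg (y - z)]
  have := h4 (-(p'' * q * k)) (-(2 * (p' * q * k'))) (-(p * q'' * k)) (T * (p * q) * k)
  calc _ = (-(p'' * q * k) + -(2 * (p' * q * k')) + -(p * q'' * k) + T * (p * q) * k) ^ 2
        + 4 * ((p * q') ^ 2 * (B * s * k) ^ 2) := by ring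
    _ ≤ 4 * ((-(p'' * q * k)) ^ 2 + (-(2 * (p' * q * k'))) ^ 2 + (-(p * q'' * k)) ^ 2
        + (T * (p * q) * k) ^ 2) + 4 * ((p * q') ^ 2 * (B * s * k) ^ 2) := by linarith
    _ = 4 * ((p'' * q) ^ 2 * k ^ 2) + 16 * ((p' * q) ^ 2 * k' ^ 2)
        + 4 * ((p * q'') ^ 2 * k ^ 2) + 4 * ((T * (p * q)) ^ 2 * k ^ 2)
        + 4 * ((p * q') ^ 2 * (B * s * k) ^ 2) := by ring
    _ ≤ 4 * ((D₂ * 1) ^ 2 * k ^ 2) + 16 * ((D₁ * 1) ^ 2 * k' ^ 2)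
        + 4 * ((1 * D₂) ^ 2 * k ^ 2) + 4 * ((η * 1) ^ 2 * k ^ 2)
        + 4 * ((1 * D₁) ^ 2 * (B * s * k) ^ 2) := by linarith
    _ = _ := by ring

end WavePacketEstimate

/-! ### Construction of the wave packets. -/

section WavePacketExistence

/-- Approximate eigenfunctions localized near a point `x₀` around which the electric potential is
affine up to an error `η`. -/
theorem exists_wavePacket : ∃ C : ℝ, 0 ≤ C ∧ ∀ (A : Plane → Plane) (V : Plane → ℝ) (B a b : ℝ)
    (x₀ : Plane) (n : ℕ) (r E L η : ℝ), ContDiff ℝ 1 A → 0 < B → (∀ x, curl A x = B) →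
    a ^ 2 + b ^ 2 = 1 → 0 < L → 2 * n * B = r - V x₀ + E ^ 2 / (4 * B ^ 2) →
    (∀ x, ‖x - x₀‖ ≤ 3 * L → |V x - V x₀ - E * coord a b x₀ x| ≤ η) →
    2 * (2 * n + 1) / B + 2 * (E / (2 * B ^ 2)) ^ 2 ≤ L ^ 2 / 2 →
    ∃ φ : Plane → Spinor, ContDiff ℝ 2 φ ∧ HasCompactSupport φ ∧ 0 < ∫ x, ‖φ x‖ ^ 2 ∧
      ∫ x, ‖pauliExpr A V φ x - (r : ℂ) • φ x‖ ^ 2 ≤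
        4 * ((8 * (C / L ^ 2) ^ 2 + 4 * η ^ 2) + 16 * (C / L) ^ 2 * ((2 * n + 1) * B)
          + 4 * B ^ 2 * (C / L) ^ 2 * (2 * (2 * n + 1) / B + 2 * (E / (2 * B ^ 2)) ^ 2))
        * ∫ x, ‖φ x‖ ^ 2 := by
  obtain ⟨C, hC, hpl⟩ := exists_scaled_plateau
  refine ⟨C, hC, fun A V B a b x₀ n r E L η hA hB hcurl hab hL hn hT hΘ => ?_⟩
  obtain ⟨κ, κ', κ'', hκ, hκ', hκ'', b0, b1, b2, p1, p2⟩ := hpl L hL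
  obtain ⟨k, k', hk, hk', i0, i1, i2, hN, n1, n2⟩ :=
    exists_shifted_oscillator_eigenfunction hB n (E / (2 * B ^ 2))
  -- The shift completing the square: `B² s² + E s = B² (s + s₀)² - E² / (4 B²)`.
  set s₀ := E / (2 * B ^ 2) with hs₀
  set N := ∫ s, k s ^ 2
  set Θ := 2 * (2 * n + 1) / B + 2 * s₀ ^ 2
  have ck : Continuous k := continuous_iff_continuousAt.2 fun s => (hk s).continuousAt
  have ck' : Continuous k' := continuous_iff_continuousAt.2 fun s => (hk' s).continuousAt
  have cκ : Continuous κ := continuous_iff_continuousAt.2 fun s => (hκ s).continuousAt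
  have cκ' : Continuous κ' := continuous_iff_continuousAt.2 fun s => (hκ' s).continuousAt
  let f : ℝ → ℝ := fun s => κ s * k s
  let f' : ℝ → ℝ := fun s => κ' s * k s + κ s * k' s
  let f'' : ℝ → ℝ := fun s => (κ'' s * k s + κ' s * k' s)
    + (κ' s * k' s + κ s * ((B ^ 2 * (s + s₀) ^ 2 - (2 * n + 1) * B) * k s))
  have hf (s : ℝ) : HasDerivAt f (f' s) s := (hκ s).mul (hk s)
  have hf' (s : ℝ) : HasDerivAt f' (f'' s) s :=
    ((hκ' s).mul (hk s)).add ((hκ s).mul (hk' s))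
  have cf'' : Continuous f'' := by fun_prop
  have cf : Continuous f := cκ.mul ck
  let F : Plane → ℝ := fun x => f (coord a b x₀ x) * κ (coord (-b) a x₀ x)
  have hF : ContDiff ℝ 2 F := ((contDiff_two_of_hasDerivAt hf hf' cf'').comp
    (contDiff_coord a b x₀)).mul ((contDiff_two_of_hasDerivAt hκ hκ' hκ'').comp
    (contDiff_coord (-b) a x₀))
  let A' := landauGauge B a b x₀
  have hA' : ContDiff ℝ 1 A' := contDiff_landauGauge B a b x₀
  have hcc (x : Plane) : curl A x = curl A' x := by
    rw [hcurl, curl_landauGauge B hab]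
  obtain ⟨χ, hχ, hχA⟩ := exists_gauge hA hA' hcc
  have hψ : ContDiff ℝ 2 fun x => (F x : ℂ) • unitSpinor 0 := contDiff_ofReal_smul hF _
  -- A spin-up product in the Landau gauge, carried to the gauge `A`. For spin up the term `-σ₃ B`
  -- cancels the zero-point energy `B`.
  let φ : Plane → Spinor := fun x => Complex.exp (Complex.I * χ x) • ((F x : ℂ) • unitSpinor 0)
  have hexp (x : Plane) : ‖Complex.exp (Complex.I * χ x)‖ = 1 := Complex.norm_exp_I_mul_ofReal _
  have hφn (x : Plane) : ‖φ x‖ ^ 2 = f (coord a b x₀ x) ^ 2 * κ (coord (-b) a x₀ x) ^ 2 := by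
    rw [norm_smul, hexp, norm_smul, norm_unitSpinor, Complex.norm_real, one_mul, mul_one,
      Real.norm_eq_abs, sq_abs, mul_pow]
  -- The square of half-side `2 L` lies in the ball of radius `3 L`, as `8 ≤ 9`.
  have hsmall {x : Plane} (h1 : |coord a b x₀ x| ≤ 2 * L) (h2 : |coord (-b) a x₀ x| ≤ 2 * L) :
      ‖x - x₀‖ ≤ 3 * L := by
    refine le_of_sq_le_sq ?_ (by positivity)
    rw [norm_sub_sq_eq_coord hab]
    have q1 := sq_le_sq' (abs_le.1 h1).1 (abs_le.1 h1).2
    have q2 := sq_le_sq' (abs_le.1 h2).1 (abs_le.1 h2).2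
    nlinarith
  -- lower bound of the norm
  let G (l : ℝ) : ℝ → ℝ := (Set.Icc (-l) l).indicator 1
  have hGi (l : ℝ) : Integrable (G l) :=
    (integrable_indicator_iff measurableSet_Icc).2 (integrableOn_const (by simp))
  have G1 {l s : ℝ} (hs : |s| ≤ l) : G l s = 1 :=
    Set.indicator_of_mem (s := Set.Icc (-l) l) (abs_le.1 hs) _
  have G0 (l s : ℝ) : 0 ≤ G l s := Set.indicator_nonneg (fun _ _ => zero_le_one) s
  have hG (l : ℝ) (hl : 0 < l) : ∫ s, G l s = 2 * l := by
    rw [integral_indicator_one measurableSet_Icc, Real.volume_real_Icc_of_le (by linarith)]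
    ring
  have hf2 : Integrable fun s => f s ^ 2 := by
    refine i0.mono' (by fun_prop) (ae_of_all _ fun s => ?_)
    rw [Real.norm_of_nonneg (sq_nonneg _), mul_pow]
    exact mul_le_of_le_one_left (sq_nonneg _) ((sq_le_one_iff_abs_le_one _).2 (b0 s))
  have hκ2 : Integrable fun s => κ s ^ 2 := by
    refine (hGi (2 * L)).mono' (by fun_prop) (ae_of_all _ fun s => ?_)
    rw [Real.norm_of_nonneg (sq_nonneg _)]
    by_cases hs : |s| ≤ 2 * L
    · rw [G1 hs]
      exact (sq_le_one_iff_abs_le_one _).2 (b0 s)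
    · rw [(p2 s (not_le.1 hs)).1]
      simpa using G0 (2 * L) s
  -- Chebyshev's inequality: by `hΘ` at most half of the mass of `k` lies where `|s| > L`, and `f =
  -- k` elsewhere.
  have lf : N / 2 ≤ ∫ s, f s ^ 2 := by
    have h1 : ∫ s, (k s ^ 2 - (L ^ 2)⁻¹ * (s ^ 2 * k s ^ 2)) ≤ ∫ s, f s ^ 2 := by
      refine integral_mono (i0.sub (i2.const_mul _)) hf2 fun s => ?_
      by_cases hs : |s| ≤ L
      · have : 0 ≤ (L ^ 2)⁻¹ * (s ^ 2 * k s ^ 2) := by positivity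
        simp only [f, p1 s hs, one_mul]
        linarith
      · have h2 : 1 ≤ (L ^ 2)⁻¹ * s ^ 2 := by
          rw [inv_mul_eq_div, one_le_div (by positivity), ← sq_abs s]
          exact pow_le_pow_left₀ hL.le (not_le.1 hs).le 2
        have h3 := mul_le_mul_of_nonneg_right h2 (sq_nonneg (k s))
        have h4 := sq_nonneg (f s)
        simp only
        linarith
    rw [integral_sub i0 (i2.const_mul _), integral_const_mul] at h1
    have h2 : (L ^ 2)⁻¹ * (∫ s, s ^ 2 * k s ^ 2) ≤ N / 2 := by
      rw [inv_mul_le_iff₀ (by positivity)]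
      calc _ ≤ Θ * N := n2
        _ ≤ L ^ 2 / 2 * N := mul_le_mul_of_nonneg_right hΘ hN.le
        _ = _ := by ring
    linarith
  have lκ : 2 * L ≤ ∫ s, κ s ^ 2 := by
    rw [← hG L hL]
    refine integral_mono (hGi L) hκ2 fun s => ?_
    by_cases hs : |s| ≤ L
    · simp [G1 hs, p1 s hs]
    · rw [show G L s = 0 from
        Set.indicator_of_notMem (s := Set.Icc (-L) L) (fun h => hs (abs_le.2 h)) _]
      exact sq_nonneg _
  have hφI : ∫ x, ‖φ x‖ ^ 2 = (∫ s, f s ^ 2) * ∫ s, κ s ^ 2 := by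
    simp_rw [hφn]
    exact integral_mul_coord hab x₀ hf2 hκ2
  have hlow : L * N ≤ ∫ x, ‖φ x‖ ^ 2 := by
    rw [hφI]
    calc L * N = N / 2 * (2 * L) := by ring
      _ ≤ _ := mul_le_mul lf lκ (by positivity) (by linarith)
  -- upper bound of the residual
  let h : ℝ → ℝ := fun s => (8 * (C / L ^ 2) ^ 2 + 4 * η ^ 2) * k s ^ 2
    + 16 * (C / L) ^ 2 * k' s ^ 2 + 4 * B ^ 2 * (C / L) ^ 2 * (s ^ 2 * k s ^ 2)
  have j0 : Integrable fun s => (8 * (C / L ^ 2) ^ 2 + 4 * η ^ 2) * k s ^ 2 := i0.const_mul _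
  have j1 : Integrable fun s => 16 * (C / L) ^ 2 * k' s ^ 2 := i1.const_mul _
  have j2 : Integrable fun s => 4 * B ^ 2 * (C / L) ^ 2 * (s ^ 2 * k s ^ 2) := i2.const_mul _
  have hhi : Integrable h := (j0.add j1).add j2
  have hhI : ∫ s, h s ≤ ((8 * (C / L ^ 2) ^ 2 + 4 * η ^ 2) + 16 * (C / L) ^ 2 * ((2 * n + 1) * B)
      + 4 * B ^ 2 * (C / L) ^ 2 * Θ) * N := by
    have e1 : ∫ s, h s = (8 * (C / L ^ 2) ^ 2 + 4 * η ^ 2) * N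
        + 16 * (C / L) ^ 2 * (∫ s, k' s ^ 2)
        + 4 * B ^ 2 * (C / L) ^ 2 * ∫ s, s ^ 2 * k s ^ 2 := by
      rw [← integral_const_mul, ← integral_const_mul, ← integral_const_mul,
        ← integral_add j0 j1]
      exact integral_add (j0.add j1) j2
    have m1 := mul_le_mul_of_nonneg_left n1 (show 0 ≤ 16 * (C / L) ^ 2 by positivity)
    have m2 := mul_le_mul_of_nonneg_left n2 (show 0 ≤ 4 * B ^ 2 * (C / L) ^ 2 by positivity)
    rw [e1]
    linarith
  have hpt (x : Plane) : ‖pauliExpr A V φ x - (r : ℂ) • φ x‖ ^ 2 ≤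
      h (coord a b x₀ x) * G (2 * L) (coord (-b) a x₀ x) := by
    have hs1 : B ^ 2 * (2 * s₀) = E := by
      rw [hs₀]
      field_simp
    have hs2 : E ^ 2 / (4 * B ^ 2) = B ^ 2 * s₀ ^ 2 := by
      rw [hs₀]
      field_simp
      ring
    have e1 : pauliExpr A V φ x = _ := pauliExpr_gauge hA' hχ hχA hcc V hψ x
    have e2 := pauliExpr_landauGauge hf hf' hκ hκ' cf'' hκ'' B hab V x₀ x rfl rfl
    set s := coord a b x₀ x
    set t := coord (-b) a x₀ x
    have e3 : pauliExpr A V φ x - (r : ℂ) • φ x = Complex.exp (Complex.I * χ x) •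
        ((((-(f'' s * κ t + f s * κ'' t) + (B ^ 2 * s ^ 2 + V x - B - r) * (f s * κ t) : ℝ) : ℂ)
        + Complex.I * ((2 * (B * s * (f s * κ' t)) : ℝ) : ℂ)) • unitSpinor 0) := by
      rw [e1, e2]
      simp only [φ, F]
      rw [smul_comm (r : ℂ), ← smul_sub, smul_smul, ← sub_smul]
      congr 2
      push_cast
      ring
    have e4 (R J : ℝ) : ‖(R : ℂ) + Complex.I * (J : ℂ)‖ ^ 2 = R ^ 2 + J ^ 2 := by
      rw [← Complex.normSq_eq_norm_sq, mul_comm, Complex.normSq_add_mul_I]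
    rw [e3, norm_smul, hexp, one_mul, norm_smul, norm_unitSpinor, mul_one, e4]
    have hh0 : 0 ≤ h s := by
      simp only [h]
      positivity
    by_cases ht : |t| ≤ 2 * L
    · by_cases hs : |s| ≤ 2 * L
      · rw [G1 ht, mul_one]
        refine le_trans (le_of_eq ?_) (wavePacket_residual_le (B := B) (s := s) (k := k s)
          (k' := k' s) (b0 s) (b1 s) (b2 s) (b0 t) (b1 t) (b2 t) (hT x (hsmall hs ht)))
        congr 1
        · congr 1
          simp only [f, f'']
          -- `hn` says that `r` is the level `n`; completing the square then removes everything from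
          -- the potential except its Taylor error.
          linear_combination (κ s * k s * κ t) * (hn + hs2 - s * hs1)
      · obtain ⟨z0, z1, z2⟩ := p2 s (not_le.1 hs)
        simp only [f, f'', z0, z1, z2]
        refine le_trans (le_of_eq ?_) (mul_nonneg hh0 (G0 _ _))
        ring
    · obtain ⟨z0, z1, z2⟩ := p2 t (not_le.1 ht)
      simp only [z0, z1, z2]
      refine le_trans (le_of_eq ?_) (mul_nonneg hh0 (G0 _ _))
      ring
  refine ⟨φ, (contDiff_gauge hχ).smul hψ, ?_, (by positivity : 0 < L * N).trans_le hlow, ?_⟩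
  · refine HasCompactSupport.intro (isCompact_closedBall x₀ (3 * L)) fun x hx => ?_
    have hx' : f (coord a b x₀ x) * κ (coord (-b) a x₀ x) = 0 := by
      by_contra h0
      refine hx (mem_closedBall_iff_norm.2 (hsmall ?_ ?_))
      · by_contra h1
        exact h0 (by simp [f, (p2 _ (not_le.1 h1)).1])
      · by_contra h1
        exact h0 (by simp [(p2 _ (not_le.1 h1)).1])
    simp only [φ, F, hx']
    simp
  · calc ∫ x, ‖pauliExpr A V φ x - (r : ℂ) • φ x‖ ^ 2
        ≤ ∫ x, h (coord a b x₀ x) * G (2 * L) (coord (-b) a x₀ x) :=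
          integral_mono_of_nonneg (ae_of_all _ fun x => sq_nonneg _)
            (integrable_mul_coord hab x₀ hhi (hGi _)) (ae_of_all _ hpt)
      -- The packet has length at most `4 L` in the direction `t`; compared with the lower bound `L
      -- * N` for the norm this yields the leading factor `4`.
      _ = (∫ s, h s) * (2 * (2 * L)) := by
          rw [integral_mul_coord hab x₀ hhi (hGi _), hG _ (by positivity)]
      _ ≤ (((8 * (C / L ^ 2) ^ 2 + 4 * η ^ 2) + 16 * (C / L) ^ 2 * ((2 * n + 1) * B)
          + 4 * B ^ 2 * (C / L) ^ 2 * Θ) * N) * (2 * (2 * L)) :=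
          mul_le_mul_of_nonneg_right hhI (by positivity)
      _ = 4 * ((8 * (C / L ^ 2) ^ 2 + 4 * η ^ 2) + 16 * (C / L) ^ 2 * ((2 * n + 1) * B)
          + 4 * B ^ 2 * (C / L) ^ 2 * Θ) * (L * N) := by ring
      _ ≤ _ := mul_le_mul_of_nonneg_left hlow (by positivity)

end WavePacketExistence

/-! ### Weyl's criterion, Taylor expansion and the choice of levels. -/

section EssentialSpectrum

theorem sq_norm_toLp {f : Plane → Spinor} (hf : MemLp f 2 volume) :
    ‖hf.toLp f‖ ^ 2 = ∫ x, ‖f x‖ ^ 2 := by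
  have h1 : ((‖hf.toLp f‖ ^ 2 : ℝ) : ℂ) = ((∫ x, ‖f x‖ ^ 2 : ℝ) : ℂ) := by
    rw [← integral_complex_ofReal]
    push_cast
    rw [← RCLike.ofReal_eq_complex_ofReal, ← inner_self_eq_norm_sq_to_K (𝕜 := ℂ), L2.inner_def]
    refine integral_congr_ae ?_
    filter_upwards [hf.coeFn_toLp] with x hx
    rw [hx, inner_self_eq_norm_sq_to_K]
  exact Complex.ofReal_injective h1

/-- Weyl's criterion in terms of integrals of squares, which allows trial fields that are merely
`C²`. -/
theorem mem_spectrum_pauliOperator_of_approx {A : Plane → Plane} {V : Plane → ℝ}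
    (hA : ContDiff ℝ 1 A) (hV : Continuous V) {z : ℂ}
    (h : ∀ δ > 0, ∃ φ : Plane → Spinor, ContDiff ℝ 2 φ ∧ HasCompactSupport φ ∧
      0 < ∫ x, ‖φ x‖ ^ 2 ∧
      ∫ x, ‖pauliExpr A V φ x - z • φ x‖ ^ 2 ≤ δ * ∫ x, ‖φ x‖ ^ 2) :
    z ∈ spectrum (pauliOperator A V hA hV) := by
  refine mem_spectrum_of_approx fun δ hδ => ?_
  obtain ⟨φ, hφ, hc, hpos, hle⟩ := h (δ ^ 2) (by positivity)
  obtain ⟨u, hu, hTu⟩ := exists_mem_domain_pauliOperator hA hV hφ hc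
  have hm := hφ.continuous.memLp_of_hasCompactSupport (p := 2) (μ := volume) hc
  have hm' := memLp_pauliExpr_of_contDiff hA hV hφ hc
  have n1 : ‖(u : Hilb)‖ ^ 2 = ∫ x, ‖φ x‖ ^ 2 := by rw [hu, sq_norm_toLp]
  refine ⟨u, fun h0 => ?_, ?_⟩
  · rw [← n1, h0] at hpos
    simp at hpos
  · have e1 : pauliOperator A V hA hV u - z • (u : Hilb) = (hm'.sub (hm.const_smul z)).toLp _ := by
      rw [hTu, hu, MemLp.toLp_sub hm' (hm.const_smul z), MemLp.toLp_const_smul]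
    refine le_of_sq_le_sq ?_ (by positivity)
    rw [e1, sq_norm_toLp, mul_pow, n1]
    exact hle

theorem gradient_eq_toDual_symm (V : Plane → ℝ) :
    ∇ V = fun x => (InnerProductSpace.toDual ℝ Plane).symm (fderiv ℝ V x) := rfl

theorem contDiff_gradient {V : Plane → ℝ} (hV : ContDiff ℝ 2 V) : ContDiff ℝ 1 (∇ V) := by
  rw [gradient_eq_toDual_symm]
  exact (InnerProductSpace.toDual ℝ Plane).symm.contDiff.comp
    (hV.fderiv_right (m := 1) (by norm_num))

/-- Taylor's formula with the remainder controlled by the Hessian. -/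
theorem abs_sub_sub_gradient_le {V : Plane → ℝ} (hV : ContDiff ℝ 2 V) {x₀ : Plane} {ρ M : ℝ}
    (hM : ∀ x, ‖x - x₀‖ ≤ ρ → hessNorm V x ≤ M) {x : Plane} (hx : ‖x - x₀‖ ≤ ρ) :
    |V x - V x₀ - inner ℝ (∇ V x₀) (x - x₀)| ≤ M * ρ ^ 2 := by
  have hρ : 0 ≤ ρ := (norm_nonneg _).trans hx
  have hM0 : 0 ≤ M := (norm_nonneg _).trans (hM x hx)
  have hx₀ : x₀ ∈ Metric.closedBall x₀ ρ := Metric.mem_closedBall_self hρ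
  have h1 (y : Plane) (hy : y ∈ Metric.closedBall x₀ ρ) :
      ‖fderiv ℝ V y - fderiv ℝ V x₀‖ ≤ M * ρ := by
    have h2 := (convex_closedBall x₀ ρ).norm_image_sub_le_of_norm_fderiv_le (𝕜 := ℝ)
      (fun z _ => (contDiff_gradient hV).differentiable one_ne_zero z)
      (fun z hz => hM z (mem_closedBall_iff_norm.1 hz)) hx₀ hy
    rw [gradient_eq_toDual_symm, ← map_sub, LinearIsometryEquiv.norm_map] at h2
    exact h2.trans (mul_le_mul_of_nonneg_left (mem_closedBall_iff_norm.1 hy) hM0)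
  have h3 := (convex_closedBall x₀ ρ).norm_image_sub_le_of_norm_fderiv_le'
    (fun z _ => hV.differentiable two_ne_zero z) h1 hx₀ (mem_closedBall_iff_norm.2 hx)
  have h4 : inner ℝ (∇ V x₀) (x - x₀) = fderiv ℝ V x₀ (x - x₀) := by
    rw [gradient_eq_toDual_symm, InnerProductSpace.toDual_symm_apply]
  rw [h4, ← Real.norm_eq_abs]
  exact h3.trans ((mul_le_mul_of_nonneg_left hx (by positivity)).trans_eq (by ring))

theorem exists_inner_eq_norm_mul_coord (v x₀ : Plane) : ∃ a b : ℝ, a ^ 2 + b ^ 2 = 1 ∧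
    ∀ x, inner ℝ v (x - x₀) = ‖v‖ * coord a b x₀ x := by
  have hv2 : ‖v‖ ^ 2 = v 0 ^ 2 + v 1 ^ 2 := by
    rw [EuclideanSpace.real_norm_sq_eq, Fin.sum_univ_two]
  by_cases hv : v = 0
  · exact ⟨1, 0, by norm_num, fun x => by simp [hv]⟩
  · have h0 : ‖v‖ ≠ 0 := norm_ne_zero_iff.2 hv
    refine ⟨v 0 / ‖v‖, v 1 / ‖v‖, ?_, fun x => ?_⟩
    · rw [div_pow, div_pow, ← add_div, ← hv2, div_self (pow_ne_zero 2 h0)]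
    · rw [PiLp.inner_apply, Fin.sum_univ_two, coord]
      simp
      field_simp

/-- A function that is continuous on the positive half line and tends to infinity takes natural
values arbitrarily far out. -/
theorem frequently_eq_natCast {q : ℝ → ℝ} (hq : ContinuousOn q (Set.Ioi 0))
    (h : Tendsto q atTop atTop) : ∃ᶠ t in atTop, ∃ n : ℕ, q t = n := by
  rw [frequently_atTop]
  intro a
  let t₁ := max a 1
  obtain ⟨n, hn⟩ := exists_nat_ge (q t₁)
  obtain ⟨t₂, h1, h2⟩ := ((h.eventually_ge_atTop (n : ℝ)).and (eventually_ge_atTop t₁)).exists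
  obtain ⟨t, ht, htn⟩ := intermediate_value_Icc h2 (hq.mono fun t ht =>
    (zero_lt_one.trans_le (le_max_right a 1)).trans_le ht.1) ⟨hn, h1⟩
  exact ⟨t, (le_max_left _ _).trans ht.1, n, htn⟩

end EssentialSpectrum

/-! ### Every real number is in the spectrum. -/

section EssentialSpectrum

/-- Wave packets of scale `L = |V| ^ ((1 + ε) / 2)` are placed at points of the path where `r` is
exactly a level of the local oscillator. The number of the level grows with `|V|`, and the exponent
`1 + ε` makes `L²` exceed the resulting squared width and momentum. -/
theorem ofReal_mem_spectrum_pauliOperator {A : Plane → Plane} {V : Plane → ℝ} {B : ℝ}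
    (hA : ContDiff ℝ 1 A) (hB₀ : 0 < B) (hB : ∀ x, curl A x = B) (hV : ContDiff ℝ 2 V)
    {γ : ℝ → Plane} (hγ : ContinuousOn γ (Set.Ioi 0))
    (hγ_top : Tendsto (fun t => ‖γ t‖) atTop atTop) {ε ν : ℝ} (hε : 0 < ε)
    (hrate : VariesWithRate (hessNorm V) ν (γ '' Set.Ioi 0))
    (hVγ : Tendsto (fun t => V (γ t)) atTop atBot)
    (hHess : Tendsto (fun t => hessNorm V (γ t) * |V (γ t)| ^ (1 + ε)) atTop (𝓝 0))
    (hgrowth : Tendsto (fun t => 1 / ‖γ t‖ ^ (2 * ν) * |V (γ t)| ^ (1 + ε)) atTop (𝓝 0))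
    (hgrad : limsup (fun t => ((‖∇ V (γ t)‖ ^ 2 / |V (γ t)| : ℝ) : EReal)) atTop
      < (((2 * B) ^ 2 : ℝ) : EReal)) (r : ℝ) :
    (r : ℂ) ∈ spectrum (pauliOperator A V hA hV.continuous) := by
  obtain ⟨C, -, hwp⟩ := exists_wavePacket
  obtain ⟨K, hK, hrate⟩ := hrate
  refine mem_spectrum_pauliOperator_of_approx hA hV.continuous fun δ hδ => ?_
  have hΛ : Tendsto (fun t => |V (γ t)|) atTop atTop := tendsto_abs_atBot_atTop.comp hVγ
  have hP : Tendsto (fun t => |V (γ t)| ^ (1 + ε)) atTop atTop :=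
    (tendsto_rpow_atTop (by linarith)).comp hΛ
  have hΛP : Tendsto (fun t => |V (γ t)| / |V (γ t)| ^ (1 + ε)) atTop (𝓝 0) := by
    refine ((tendsto_rpow_neg_atTop hε).comp hΛ).congr' ?_
    filter_upwards [hΛ.eventually_gt_atTop 0] with t ht
    rw [Function.comp_apply, Real.rpow_add ht, Real.rpow_one, Real.rpow_neg ht.le]
    field_simp
  -- This dominates the constant in `exists_wavePacket` for `L² = |V| ^ (1 + ε)`; the `80` is `16 *
  -- 3 + 4 * 8`, from `hn3` and `hΘ`.
  have hT : Tendsto (fun t => 4 * ((8 * (C / |V (γ t)| ^ (1 + ε)) ^ 2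
      + 4 * (9 * K * (hessNorm V (γ t) * |V (γ t)| ^ (1 + ε))) ^ 2)
      + 80 * C ^ 2 * (|V (γ t)| / |V (γ t)| ^ (1 + ε)))) atTop (𝓝 0) := by
    have h := ((((((tendsto_const_nhds (x := C)).div_atTop hP).pow 2).const_mul 8).add
      (((hHess.const_mul (9 * K)).pow 2).const_mul 4)).add
      (hΛP.const_mul (80 * C ^ 2))).const_mul 4
    simpa using h
  -- The possibly fractional level number at which the local oscillator has energy `r`.
  let q : ℝ → ℝ := fun t => (r - V (γ t) + ‖∇ V (γ t)‖ ^ 2 / (4 * B ^ 2)) / (2 * B)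
  have hq : ContinuousOn q (Set.Ioi 0) := by
    have h1 : ContinuousOn (fun t => V (γ t)) (Set.Ioi 0) := hV.continuous.comp_continuousOn hγ
    have h2 : ContinuousOn (fun t => ∇ V (γ t)) (Set.Ioi 0) :=
      (contDiff_gradient hV).continuous.comp_continuousOn hγ
    exact ((continuousOn_const.sub h1).add ((h2.norm.pow 2).div_const _)).div_const _
  have hq_top : Tendsto q atTop atTop := by
    have h1 : Tendsto (fun t => (r - V (γ t)) / (2 * B)) atTop atTop :=
      (tendsto_atTop_add_const_left atTop r (tendsto_neg_atBot_atTop.comp hVγ)).atTop_div_const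
        (by positivity)
    refine tendsto_atTop_mono (fun t => ?_) h1
    exact div_le_div_of_nonneg_right (le_add_of_nonneg_right (by positivity)) (by positivity)
  -- The thresholds: `|r| + B` absorbs constants in `hn3`, `1 / 36` gives `3 L ≤ ½ ‖x₀‖ ^ ν`, and
  -- `B² / 16` gives the width condition `hΘP`.
  obtain ⟨t, ⟨n, hn⟩, ht0, hV0, hΛr, hE, hgr, hγ0, hΛPt, hTt⟩ :=
    ((frequently_eq_natCast hq hq_top).and_eventually ((eventually_gt_atTop 0).and
      ((hVγ.eventually_lt_atBot 0).and ((hΛ.eventually_ge_atTop (|r| + B)).and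
      ((eventually_lt_of_limsup_lt hgrad).and
      ((hgrowth.eventually_lt_const (show (0 : ℝ) < 1 / 36 by norm_num)).and
      ((hγ_top.eventually_gt_atTop 0).and
      ((hΛP.eventually_lt_const (show 0 < B ^ 2 / 16 by positivity)).and
      (hT.eventually_lt_const hδ))))))))).exists
  set x₀ := γ t
  set Λ := |V x₀| with hΛ_def
  set P := Λ ^ (1 + ε)
  set E := ‖∇ V x₀‖
  have hVΛ : V x₀ = -Λ := by rw [hΛ_def, abs_of_neg hV0, neg_neg]
  have hΛ0 : 0 < Λ := abs_pos.2 hV0.ne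
  have hP0 : 0 < P := Real.rpow_pos_of_pos hΛ0 _
  have hE2 : E ^ 2 ≤ 4 * B ^ 2 * Λ := by
    have h := (div_lt_iff₀ hΛ0).1 (EReal.coe_lt_coe_iff.1 hE)
    linarith
  have hL0 : 0 < √P := Real.sqrt_pos.2 hP0
  have hL2 : √P ^ 2 = P := Real.sq_sqrt hP0.le
  have hn' : 2 * n * B = r - V x₀ + E ^ 2 / (4 * B ^ 2) := by
    have h : (r - V x₀ + E ^ 2 / (4 * B ^ 2)) / (2 * B) = n := hn
    rw [← h]
    field_simp
  have hE4 : E ^ 2 / (4 * B ^ 2) ≤ Λ := (div_le_iff₀' (by positivity)).2 hE2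
  -- One `Λ` comes from `-V x₀`, one from the gradient term by `hE4`, and one covers `r + B`.
  have hn3 : (2 * n + 1) * B ≤ 3 * Λ := by linarith [le_abs_self r]
  have hΘ : B ^ 2 * (2 * (2 * n + 1) / B + 2 * (E / (2 * B ^ 2)) ^ 2) ≤ 8 * Λ := by
    have h : B ^ 2 * (2 * (2 * n + 1) / B + 2 * (E / (2 * B ^ 2)) ^ 2) =
        2 * ((2 * n + 1) * B) + 2 * (E ^ 2 / (4 * B ^ 2)) := by
      field_simp
      ring
    linarith
  obtain ⟨a, b, hab, hcoord⟩ := exists_inner_eq_norm_mul_coord (∇ V x₀) x₀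
  have hball : 3 * √P ≤ 1 / 2 * ‖x₀‖ ^ ν := by
    have h1 : 0 < ‖x₀‖ ^ (2 * ν) := Real.rpow_pos_of_pos hγ0 _
    rw [one_div_mul_eq_div, div_lt_iff₀ h1] at hgr
    refine le_of_sq_le_sq ?_ (by positivity)
    have h2 : (‖x₀‖ ^ ν) ^ 2 = ‖x₀‖ ^ (2 * ν) := by
      rw [← Real.rpow_natCast, ← Real.rpow_mul (norm_nonneg _), mul_comm]
      norm_num
    rw [mul_pow, mul_pow, hL2, h2]
    linarith
  have hH (y : Plane) : 0 ≤ hessNorm V y := norm_nonneg _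
  have hηT (x : Plane) (hx : ‖x - x₀‖ ≤ 3 * √P) :
      |V x - V x₀ - E * coord a b x₀ x| ≤ 9 * K * (hessNorm V x₀ * P) := by
    -- The rate condition bounds the Hessian on the whole ball by `K` times its value at the centre.
    have h1 := abs_sub_sub_gradient_le hV (M := K * hessNorm V x₀) (fun y hy => by
      have h := hrate x₀ ⟨t, ht0, rfl⟩ (y - x₀) (hy.trans hball)
      rwa [add_sub_cancel, abs_of_nonneg (hH y), abs_of_nonneg (hH x₀)] at h) hx
    rw [hcoord, mul_pow, hL2] at h1
    exact h1.trans_eq (by ring)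
  have hΘP : 2 * (2 * n + 1) / B + 2 * (E / (2 * B ^ 2)) ^ 2 ≤ √P ^ 2 / 2 := by
    rw [hL2]
    rw [div_lt_iff₀ hP0] at hΛPt
    refine le_of_mul_le_mul_left (hΘ.trans ?_) (show 0 < B ^ 2 by positivity)
    linarith
  obtain ⟨φ, h1, h2, h3, h4⟩ := hwp A V B a b x₀ n r E (√P) _ hA hB₀ hB hab hL0 hn' hηT hΘP
  refine ⟨φ, h1, h2, h3, h4.trans (mul_le_mul_of_nonneg_right (le_trans ?_ hTt.le) h3.le)⟩
  rw [hL2, div_pow C (√P), hL2]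
  have hCP : 0 ≤ C ^ 2 / P := by positivity
  have m1 := mul_le_mul_of_nonneg_left hn3 hCP
  have m2 := mul_le_mul_of_nonneg_left hΘ hCP
  have e1 : C ^ 2 * (Λ / P) = C ^ 2 / P * Λ := by ring
  linear_combination 64 * m1 + 16 * m2 + 320 * e1

end EssentialSpectrum

end Pauli

end

theorem theorem4 (A : Pauli.Plane → Pauli.Plane) (V : Pauli.Plane → ℝ) (B₀ : ℝ)
    (hA : ContDiff ℝ 2 A) (hB₀ : 0 < B₀) (hB : ∀ x, Pauli.curl A x = B₀)
    (hV : ContDiff ℝ 2 V)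
    (hVlower : ∃ c > 0, ∃ d : ℝ, ∀ x, -c * ‖x‖ ^ 2 + d ≤ V x)
    (γ : ℝ → Pauli.Plane) (hγ : ContinuousOn γ (Set.Ioi 0))
    (hγ_top : Tendsto (fun t => ‖γ t‖) atTop atTop)
    (ε ν : ℝ) (hε : 0 < ε) (hν : ν ∈ Set.Icc (0 : ℝ) 1)
    (hrate : Pauli.VariesWithRate (Pauli.hessNorm V) ν (γ '' Set.Ioi 0))
    (hVγ : Tendsto (fun t => V (γ t)) atTop atBot)
    (hHess : Tendsto (fun t => Pauli.hessNorm V (γ t) * |V (γ t)| ^ (1 + ε)) atTop (𝓝 0))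
    (hgrowth : Tendsto (fun t => 1 / ‖γ t‖ ^ (2 * ν) * |V (γ t)| ^ (1 + ε)) atTop (𝓝 0))
    (hgrad : limsup (fun t => ((‖∇ V (γ t)‖ ^ 2 / |V (γ t)| : ℝ) : EReal)) atTop
      < (((2 * B₀) ^ 2 : ℝ) : EReal)) :
    Pauli.essentialSpectrum (Pauli.pauliOperator A V (hA.of_le one_le_two) hV.continuous)
      = Set.range ((↑) : ℝ → ℂ) := by
  obtain ⟨c, hc, d, hd⟩ := hVlower
  exact Pauli.essentialSpectrum_eq_range_ofReal
    (fun _ hz => Pauli.mem_resolventSet_pauliOperator (hA.of_le one_le_two) hV.continuous hB hc hd hz)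
    (fun r => Pauli.ofReal_mem_spectrum_pauliOperator (hA.of_le one_le_two) hB₀ hB hV hγ hγ_top hε
      hrate hVγ hHess hgrowth hgrad r)
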